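/- Let $q$ be a prime power, $m\ge 4$, and write $V=V(m,q^2)=\mathbb F_{q^2}^m$, with coordinates with respect to a basis in which the non-degenerate Hermitian form $\eta$ is $$\eta(X,Y)=x_1^qy_1+x_2^qy_3+x_3^qy_2+\cdots+x_{m-1}^qy_m+x_m^qy_{m-1}\quad(m\text{ odd}),$$ $$\eta(X,Y)=x_1^qy_2+x_2^qy_1+\cdots+x_{m-1}^qy_m+x_m^qy_{m-1}\quad(m\text{ even}).$$ The points of the line Hermitian Grassmannian of $V$ are the totally $\eta$-isotropic $2$-dimensional subspaces $L$ of $V$; let $N$ be their number. Each $L$ is represented by the $2\times m$ matrix in row reduced echelon form (RREF) whose rows span $L$, regarded as a word of length $m$ over the alphabet $\mathfrak A=\mathbb F_{q^2}^2$ of columns. Let $\mathcal O\subseteq\mathfrak A^m$ be the set of these words. For $0\le t\le m$ and $\alpha\in\mathfrak A^t$ let $\psi(\alpha)$ be the number of words of $\mathcal O$ that begin with $\alpha$. Fix a total order $\prec$ on $\mathbb F_{q^2}$ whose least element is $0$, order $\mathfrak A$ lexicographically, and put, for $\omega\in\mathcal O$, $$\iota(\omega)=\sum_{j=1}^m\ \sum_{x\in\mathfrak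 A,\ x\prec\omega_j}\psi(\omega_1\cdots\omega_{j-1}x).$$ Complexity is the number of steps of a program, written independently of $q$, $m$ and the input, that works with variables holding natural numbers, variables and arrays holding elements of $\mathbb F_{q^2}$, assignments, conditionals and bounded loops. Each arithmetic operation on natural numbers or in $\mathbb F_{q^2}$, each conjugation $x\mapsto x^q$, each comparison of natural numbers, each equality test in $\mathbb F_{q^2}$, each memory access and each elementary control step costs one unit. The numbers $q$ and $m$ are part of the input, and in (ii) so is the list of the elements of $\mathbb F_{q^2}$ in increasing order. The constants implied by $O$ are absolute. **Theorem.** (i) There is a program which computes $\psi(\alpha)$ from $q$, $m$, $t$ and $\alpha\in\mathfrak A^t$, for all $0\le t\le m$, in $O(m^2)$ steps. (ii) The map $\iota$ is a bijection from $\mathcal O$ onto $\{0,1,\dots,N-1\}$. There is a program which computes $\iota(\omega)$ from $\omega\in\mathcal O$ in $O(q^4m^3)$ steps, and a program which computes $\iota^{-1}(i)$ from $i\in\{0,\dots,N-1\}$ in $O(q^4m^3)$ steps. -/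

import Mathlib

namespace HermGr

/-! ### The Hermitian form, totally isotropic lines and their representations -/

section Geometry

variable {F : Type*} [Field F]

/-- The Hermitian form on `F ^ m` (`F` of order `q ^ 2`), coordinates being numbered from `0`.
For `m` odd it is `x₀^q y₀ + (x₁^q y₂ + x₂^q y₁) + (x₃^q y₄ + x₄^q y₃) + ⋯`.
For `m` even it is `(x₀^q y₁ + x₁^q y₀) + (x₂^q y₃ + x₃^q y₂) + ⋯`, i.e. the restriction of the
form of `F ^ (m + 1)` to the hyperplane on which the first coordinate vanishes. -/
def eta (q : ℕ) {m : ℕ} (X Y : Fin m → F) : F :=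
  (if h : m % 2 = 1 then X ⟨0, by omega⟩ ^ q * Y ⟨0, by omega⟩ else 0) +
    ∑ i : Fin (m / 2),
      (X ⟨m % 2 + 2 * i, by omega⟩ ^ q * Y ⟨m % 2 + 2 * i + 1, by omega⟩ +
        X ⟨m % 2 + 2 * i + 1, by omega⟩ ^ q * Y ⟨m % 2 + 2 * i, by omega⟩)

/-- The points of the line Hermitian Grassmannian of `F ^ m`: the totally isotropic subspaces of
vector dimension `2`. -/
def IsPoint (q : ℕ) {m : ℕ} (L : Submodule F (Fin m → F)) : Prop :=
  Module.finrank F L = 2 ∧ ∀ x ∈ L, ∀ y ∈ L, eta q x y = 0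

/-- The leading (first non-zero) entry of row `i` of `G` is in column `j`. -/
def IsLead {k m : ℕ} (G : Matrix (Fin k) (Fin m) F) (i : Fin k) (j : Fin m) : Prop :=
  G i j ≠ 0 ∧ ∀ j' < j, G i j' = 0

/-- Row reduced echelon form: leading entries move strictly to the right from one row to the next
(zero rows being at the bottom), every leading entry is `1`, and the entries above a leading
entry are `0`. -/
def IsRREF {k m : ℕ} (G : Matrix (Fin k) (Fin m) F) : Prop :=
  (∀ i i' j', i < i' → IsLead G i' j' → ∃ j, j < j' ∧ IsLead G i j) ∧
    ∀ i j, IsLead G i j → G i j = 1 ∧ ∀ i' < i, G i' j = 0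

/-- `G` is the representation of the subspace `L`: `G` is in RREF and its rows span `L`. -/
def Represents {m : ℕ} (G : Matrix (Fin 2) (Fin m) F) (L : Submodule F (Fin m → F)) : Prop :=
  IsRREF G ∧ Submodule.span F (Set.range G.row) = L

/-- The prefix of length `t` of a word of length `m` over the alphabet `F ^ 2` (the letters are
the columns of `G`). -/
def takeCols {m : ℕ} (G : Matrix (Fin 2) (Fin m) F) (t : ℕ) (ht : t ≤ m) :
    Matrix (Fin 2) (Fin t) F :=
  fun r i => G r (Fin.castLE ht i)

/-- The concatenation `D | x` of a word `D` and a letter `x`. -/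
def snocCol {t : ℕ} (D : Matrix (Fin 2) (Fin t) F) (x : Fin 2 → F) :
    Matrix (Fin 2) (Fin (t + 1)) F :=
  fun r => Fin.snoc (α := fun _ => F) (D r) (x r)

/-- The number of points of the line Hermitian Grassmannian of `F ^ m` whose representation
begins with `D`. Here `D` is any word of length `t ≤ m`; the number is `0` if `D` is not the
beginning of a matrix in RREF. -/
noncomputable def psi (q : ℕ) {m t : ℕ} (ht : t ≤ m) (D : Matrix (Fin 2) (Fin t) F) : ℕ :=
  Nat.card {L : Submodule F (Fin m → F) //
    IsPoint q L ∧ ∃ G, Represents G L ∧ takeCols G t ht = D}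

/-- The number of points of the line Hermitian Grassmannian of `F ^ m`. -/
noncomputable def numPoints (F : Type*) [Field F] (q m : ℕ) : ℕ :=
  Nat.card {L : Submodule F (Fin m → F) // IsPoint q L}

/-- The set of the representations of the points of the line Hermitian Grassmannian. -/
def reps (F : Type*) [Field F] (q m : ℕ) : Set (Matrix (Fin 2) (Fin m) F) :=
  {G | ∃ L : Submodule F (Fin m → F), IsPoint q L ∧ Represents G L}

/-- The lexicographic order on the alphabet `F ^ 2` induced by a linear order of `F`. -/
def colLT [LinearOrder F] (x y : Fin 2 → F) : Prop :=
  x 0 < y 0 ∨ (x 0 = y 0 ∧ x 1 < y 1)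

open Classical in
/-- The prefix enumerator: `ι(ω) = ∑ⱼ ∑_{x ≺ ωⱼ} ψ(ω₁ … ωⱼ₋₁ x)`. -/
noncomputable def iota [Fintype F] [LinearOrder F] (q : ℕ) {m : ℕ}
    (G : Matrix (Fin 2) (Fin m) F) : ℕ :=
  ∑ j : Fin m, ∑ x : Fin 2 → F with colLT x (fun r => G r j),
    psi q (m := m) j.isLt (snocCol (takeCols G j j.isLt.le) x)

end Geometry

/-! ### Machine model

Programs over natural numbers and over elements of a field `F` of order `q ^ 2`. A program is a
finite text that does not depend on the field; every arithmetic operation, conjugation, memory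
access and elementary control step costs one unit. -/

/-- Expressions of type natural number. -/
inductive NExp where
  | const (n : ℕ)
  | var (v : ℕ)
  | add (a b : NExp)
  | sub (a b : NExp)
  | mul (a b : NExp)
  | div (a b : NExp)

/-- Expressions of type field element; `get a i` is the `i`-th entry of the array `a`. -/
inductive FExp where
  | zero
  | one
  | var (v : ℕ)
  | get (a : ℕ) (i : NExp)
  | add (x y : FExp)
  | neg (x : FExp)
  | mul (x y : FExp)
  | inv (x : FExp)
  | conj (x : FExp)

/-- Tests. -/
inductive Cond where
  | le (a b : NExp)
  | feq (x y : FExp)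
  | not (c : Cond)
  | and (c d : Cond)

/-- Programs; `loop a p` evaluates `a` once and then runs `p` that many times. -/
inductive Prog where
  | skip
  | setN (v : ℕ) (a : NExp)
  | setF (v : ℕ) (x : FExp)
  | store (arr : ℕ) (i : NExp) (x : FExp)
  | seq (p p' : Prog)
  | ite (c : Cond) (p p' : Prog)
  | loop (a : NExp) (p : Prog)

/-- The memory: variables holding natural numbers, variables holding field elements, and arrays
of field elements. -/
structure Mem (F : Type*) where
  num : ℕ → ℕ
  fld : ℕ → F
  arr : ℕ → ℕ → F

section Semantics

variable {F : Type*} [Field F]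

/-- Value of a numerical expression (truncated subtraction, division with remainder discarded). -/
def NExp.eval (s : Mem F) : NExp → ℕ
  | .const n => n
  | .var v => s.num v
  | .add a b => a.eval s + b.eval s
  | .sub a b => a.eval s - b.eval s
  | .mul a b => a.eval s * b.eval s
  | .div a b => a.eval s / b.eval s

/-- Number of steps for the evaluation of a numerical expression. -/
def NExp.cost : NExp → ℕ
  | .const _ => 1
  | .var _ => 1
  | .add a b => a.cost + b.cost + 1
  | .sub a b => a.cost + b.cost + 1
  | .mul a b => a.cost + b.cost + 1
  | .div a b => a.cost + b.cost + 1

/-- Value of a field expression; conjugation is `x ↦ x ^ q`. -/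
def FExp.eval (q : ℕ) (s : Mem F) : FExp → F
  | .zero => 0
  | .one => 1
  | .var v => s.fld v
  | .get a i => s.arr a (i.eval s)
  | .add x y => x.eval q s + y.eval q s
  | .neg x => -x.eval q s
  | .mul x y => x.eval q s * y.eval q s
  | .inv x => (x.eval q s)⁻¹
  | .conj x => x.eval q s ^ q

/-- Number of steps for the evaluation of a field expression. -/
def FExp.cost : FExp → ℕ
  | .zero => 1
  | .one => 1
  | .var _ => 1
  | .get _ i => i.cost + 1
  | .add x y => x.cost + y.cost + 1
  | .neg x => x.cost + 1
  | .mul x y => x.cost + y.cost + 1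
  | .inv x => x.cost + 1
  | .conj x => x.cost + 1

/-- Truth of a test. -/
def Cond.holds (q : ℕ) (s : Mem F) : Cond → Prop
  | .le a b => a.eval s ≤ b.eval s
  | .feq x y => x.eval q s = y.eval q s
  | .not c => ¬ c.holds q s
  | .and c d => c.holds q s ∧ d.holds q s

/-- Number of steps for a test. -/
def Cond.cost : Cond → ℕ
  | .le a b => a.cost + b.cost + 1
  | .feq x y => x.cost + y.cost + 1
  | .not c => c.cost + 1
  | .and c d => c.cost + d.cost + 1

open Classical in
/-- Execution of a program: the final memory and the number of steps. -/
noncomputable def Prog.run (q : ℕ) : Prog → Mem F → Mem F × ℕ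
  | .skip, s => (s, 1)
  | .setN v a, s => ({ s with num := Function.update s.num v (a.eval s) }, a.cost + 1)
  | .setF v x, s => ({ s with fld := Function.update s.fld v (x.eval q s) }, x.cost + 1)
  | .store b i x, s =>
      ({ s with
          arr := Function.update s.arr b
            (Function.update (s.arr b) (i.eval s) (x.eval q s)) }, i.cost + x.cost + 1)
  | .seq p p', s =>
      ((p'.run q (p.run q s).1).1, (p.run q s).2 + (p'.run q (p.run q s).1).2)
  | .ite c p p', s =>
      if c.holds q s then ((p.run q s).1, c.cost + (p.run q s).2 + 1)
      else ((p'.run q s).1, c.cost + (p'.run q s).2 + 1)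
  | .loop a p, s =>
      (fun r : Mem F × ℕ => ((p.run q r.1).1, r.2 + (p.run q r.1).2 + 1))^[a.eval s]
        (s, a.cost + 1)

end Semantics

/-! ### Conventions for input and output -/

section InOut

variable {F : Type*} [Field F]

/-- The `r`-th row of `D`, continued by zeros. -/
def rowArray {t : ℕ} (D : Matrix (Fin 2) (Fin t) F) (r : Fin 2) (i : ℕ) : F :=
  if h : i < t then D r ⟨i, h⟩ else 0

/-- The list of the elements of `F` in increasing order, continued by zeros. -/
def alphabet [Fintype F] [LinearOrder F] (i : ℕ) : F :=
  ((Finset.univ : Finset F).sort (· ≤ ·)).getD i 0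

/-- Initial memory: the numerical variables `0, 1, 2` contain `q, m, n`, the arrays `0` and `1`
contain the rows of `D`, the array `2` contains `E`; everything else is `0`. -/
def initMem (q m n : ℕ) {t : ℕ} (D : Matrix (Fin 2) (Fin t) F) (E : ℕ → F) : Mem F where
  num v := if v = 0 then q else if v = 1 then m else if v = 2 then n else 0
  fld _ := 0
  arr b := if b = 0 then rowArray D 0 else if b = 1 then rowArray D 1
    else if b = 2 then E else fun _ => 0

/-- The numerical output: the content of the numerical variable `0`. -/
def numOut (s : Mem F) : ℕ := s.num 0

/-- The matrix output: the rows are the first `m` entries of the arrays `0` and `1`. -/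
def matOut (m : ℕ) (s : Mem F) : Matrix (Fin 2) (Fin m) F := fun r i => s.arr r i

end InOut

end HermGr

namespace HermGr

/-! ### Conjugation, trace and norm of a field of order `q ^ 2` -/

section Conj

open Polynomial

variable {F : Type*} [Field F] [Fintype F] {q : ℕ}

/-! The core is to count, for a given prefix, all ordered pairs (X, Y) of vectors with zero Gram
matrix, reduced or not. The hyperbolic pairs of coordinates are aligned with the end of the word. So
the number of completions depends only on the Gram matrix H of the completed part of the prefix
(`gram`), on the number k of untouched hyperbolic pairs and, if the prefix stops inside a pair, on
its last column. With Q = q^(2k), the count at the end of a hyperbolic pair is Q²((Q-1)(Q-q²) +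
sq(Q-1) + zq⁴)/q⁴, where s is the number of isotropic points of H on the projective line and z
indicates H = 0. An expansion in additive characters of the Hermitian 2×2 matrices produces this
shape; the proof instead verifies it by backward induction over the columns (`cnt_isotropicWord`).
Since the formula is affine in s and z, only the sums of s and z over the next column matter
(`sum_isoPts_add`, `sum_isZeroH_add`, `sum_isoPerp`). These rest on the fibres of trace and norm
having q and q+1 elements.

The passage from pairs to points depends on the rank of the prefix (`scanRank`). In rank 2 every
completion is reduced. In rank 1 a pair with nonzero second row arises from a unique reduced word by
(X + μY, λY) with λ ≠ 0, which gives a factor (q²-1)q². In rank 0 the independent pairs are the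
ordered bases of the points, (q⁴-1)(q⁴-q²) for each, and the dependent ones are governed by the
number of isotropic vectors. Thus ψ is an explicit function of data gathered in a single pass over
the columns (`psi_eq_psiCount`), and even O(m) steps suffice.

For ι, the contribution of the places from j on is smaller than ψ of the prefix of length j
(`enumTail_lt`), so the words with a common prefix have their ranks in an interval of length ψ.
Hence ι is injective with values below N, and equality of cardinalities makes it bijective. Ranking
adds values of ψ over the letters before the actual one; unranking subtracts them until the
remainder is smaller than the next value. The programs are verified with loop invariants
(`loop_induction`) and frame conditions (`Prog.Keeps`). -/

theorem one_lt_of_card (hq : Fintype.card F = q ^ 2) : 1 < q := by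
  have h : 1 < Fintype.card F := Fintype.one_lt_card
  rw [hq] at h
  by_contra hc
  have : q ^ 2 ≤ 1 ^ 2 := Nat.pow_le_pow_left (by omega) 2
  omega

/-- As q divides a power of the characteristic p, it is itself a power of p, so conjugation is an
iterate of the Frobenius map and therefore additive. -/
theorem exists_conj (hq : Fintype.card F = q ^ 2) : ∃ σ : F →+* F, ∀ x, σ x = x ^ q := by
  obtain ⟨p, hc⟩ := CharP.exists F
  obtain ⟨n, hp, hn⟩ := FiniteField.card F p
  have := Fact.mk hp
  have hd : q ∣ p ^ (n : ℕ) := by rw [← hn, hq]; exact dvd_pow_self q two_ne_zero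
  obtain ⟨k, -, hk⟩ := (Nat.dvd_prime_pow hp).1 hd
  exact ⟨iterateFrobenius F p k, fun x => by rw [iterateFrobenius_def, hk]⟩

/-- The conjugation `x ↦ x ^ q` of a field of order `q ^ 2`. -/
noncomputable def conjHom (hq : Fintype.card F = q ^ 2) : F →+* F :=
  (exists_conj hq).choose

theorem conjHom_apply (hq : Fintype.card F = q ^ 2) (x : F) : conjHom hq x = x ^ q :=
  (exists_conj hq).choose_spec x

@[simp]
theorem conjHom_conjHom (hq : Fintype.card F = q ^ 2) (x : F) :
    conjHom hq (conjHom hq x) = x := by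
  rw [conjHom_apply, conjHom_apply, ← pow_mul, ← sq, ← hq, FiniteField.pow_card]

variable [DecidableEq F]

theorem card_fiber_le_of_poly (p : F[X]) (n : ℕ) (hn : p.natDegree ≤ n) (hp : p ≠ 0)
    (P : F → Prop) [DecidablePred P] (h : ∀ x, P x → p.eval x = 0) :
    (Finset.univ.filter P).card ≤ n := by
  refine le_trans (le_trans (Finset.card_le_card (t := p.roots.toFinset) ?_)
    (Multiset.toFinset_card_le _)) (le_trans (card_roots' p) hn)
  intro x hx
  simp only [Finset.mem_filter, Finset.mem_univ, true_and] at hx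
  simp [hp, h x hx]

theorem card_fixed_le (hq : Fintype.card F = q ^ 2) :
    (Finset.univ.filter fun x : F => conjHom hq x = x).card ≤ q := by
  have h1 := one_lt_of_card hq
  refine card_fiber_le_of_poly (X ^ q - X) q ?_ (FiniteField.X_pow_card_sub_X_ne_zero F h1) _ ?_
  · rw [FiniteField.X_pow_card_sub_X_natDegree_eq F h1]
  · intro x hx
    rw [conjHom_apply] at hx
    simp [hx]

theorem card_trace_fiber_le (hq : Fintype.card F = q ^ 2) (e : F) :
    (Finset.univ.filter fun x : F => x + conjHom hq x = e).card ≤ q := by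
  have h1 := one_lt_of_card hq
  have hdeg : (X ^ q + (X - C e) : F[X]).natDegree = q := by
    rw [natDegree_add_eq_left_of_natDegree_lt, natDegree_X_pow]
    rw [natDegree_X_pow, natDegree_X_sub_C]; exact h1
  refine card_fiber_le_of_poly (X ^ q + (X - C e)) q hdeg.le ?_ _ ?_
  · intro h; rw [h, natDegree_zero] at hdeg; omega
  · intro x hx
    rw [conjHom_apply] at hx
    simp [← hx]

theorem card_norm_fiber_le (hq : Fintype.card F = q ^ 2) (e : F) :
    (Finset.univ.filter fun x : F => x * conjHom hq x = e).card ≤ q + 1 := by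
  have hdeg : (X ^ (q + 1) - C e : F[X]).natDegree = q + 1 := natDegree_X_pow_sub_C
  refine card_fiber_le_of_poly (X ^ (q + 1) - C e) (q + 1) hdeg.le ?_ _ ?_
  · intro h; rw [h, natDegree_zero] at hdeg; omega
  · intro x hx
    rw [conjHom_apply] at hx
    simp [← hx, pow_succ, mul_comm]

/-- If `f` maps `s` to `t`, `|s| = a b`, `|t| ≤ a` and all fibres have at most `b` elements,
then every fibre has exactly `b` elements. -/
theorem card_fiber_eq {A B : Type*} [DecidableEq B] (s : Finset A) (t : Finset B) (f : A → B)
    (a b : ℕ) (hf : ∀ x ∈ s, f x ∈ t) (hs : s.card = a * b) (ht : t.card ≤ a)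
    (hb : ∀ y ∈ t, (s.filter fun x => f x = y).card ≤ b) :
    ∀ y ∈ t, (s.filter fun x => f x = y).card = b := by
  have h1 := Finset.card_eq_sum_card_fiberwise (f := f) (s := s) (t := t) hf
  have h2 : ∑ y ∈ t, (s.filter fun x => f x = y).card = ∑ y ∈ t, b := by
    refine le_antisymm (Finset.sum_le_sum hb) ?_
    rw [← h1, hs, Finset.sum_const, smul_eq_mul]
    exact Nat.mul_le_mul_right b ht
  exact (Finset.sum_eq_sum_iff_of_le hb).1 h2

/-- Root counting bounds the number of fixed elements by q and each fibre of the trace by q. The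
field has q² elements, so all these bounds are attained; no surjectivity argument is needed. -/
theorem card_trace_fiber (hq : Fintype.card F = q ^ 2) (e : F) (he : conjHom hq e = e) :
    (Finset.univ.filter fun x : F => x + conjHom hq x = e).card = q := by
  refine card_fiber_eq Finset.univ (Finset.univ.filter fun x : F => conjHom hq x = x)
    (fun x => x + conjHom hq x) q q ?_ ?_ (card_fixed_le hq)
    (fun y _ => card_trace_fiber_le hq y) e (by simpa using he)
  · intro x _
    simp [add_comm]
  · rw [Finset.card_univ, hq, sq]

/-- The same tight count on the multiplicative group, with q²-1 = (q-1)(q+1). -/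
theorem card_norm_fiber (hq : Fintype.card F = q ^ 2) (e : F) (he : conjHom hq e = e)
    (h0 : e ≠ 0) : (Finset.univ.filter fun x : F => x * conjHom hq x = e).card = q + 1 := by
  have h1 := one_lt_of_card hq
  have key := card_fiber_eq (Finset.univ.erase (0 : F))
    ((Finset.univ.filter fun x : F => conjHom hq x = x).erase 0)
    (fun x => x * conjHom hq x) (q - 1) (q + 1) ?_ ?_ ?_ ?_ e (by simpa [h0] using he)
  · rw [← key]
    congr 1
    ext x
    simp only [Finset.mem_filter, Finset.mem_univ, true_and, Finset.mem_erase, and_true]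
    refine ⟨fun h => ⟨?_, h⟩, fun h => h.2⟩
    rintro rfl
    exact h0 (by simpa using h.symm)
  · intro x hx
    simpa [mul_comm] using hx
  · rw [Finset.card_erase_of_mem (Finset.mem_univ _), Finset.card_univ, hq]
    obtain ⟨r, rfl⟩ : ∃ r, q = r + 1 := ⟨q - 1, by omega⟩
    simp only [Nat.add_sub_cancel]
    rw [Nat.sub_eq_iff_eq_add (by nlinarith)]
    ring
  · rw [Finset.card_erase_of_mem (by simp)]
    have := card_fixed_le hq
    omega
  · intro y _
    refine le_trans (Finset.card_le_card ?_) (card_norm_fiber_le hq y)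
    intro x hx
    simp only [Finset.mem_filter] at hx ⊢
    exact ⟨Finset.mem_univ _, hx.2⟩

/-- The number of `v` with `Tr (κ v + μ) = e`. -/
theorem card_trace_affine (hq : Fintype.card F = q ^ 2) (κ μ e : F) (hκ : κ ≠ 0)
    (he : conjHom hq e = e) :
    (Finset.univ.filter fun v : F => (κ * v + μ) + conjHom hq (κ * v + μ) = e).card = q := by
  refine Eq.trans ?_ (card_trace_fiber hq e he)
  refine Finset.card_bij (fun v _ => κ * v + μ) ?_ ?_ ?_
  · intro v hv; simpa using hv
  · intro v _ w _ h
    exact mul_left_cancel₀ hκ (add_right_cancel h)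
  · intro x hx
    refine ⟨κ⁻¹ * (x - μ), ?_, ?_⟩
    · have : κ * (κ⁻¹ * (x - μ)) + μ = x := by field_simp; ring
      simp only [Finset.mem_filter, Finset.mem_univ, true_and, this] at hx ⊢
      exact hx
    · field_simp; ring

end Conj

end HermGr

namespace HermGr

/-! ### Hermitian matrices of order `2` -/

section Herm

variable {F : Type*} [Field F] [Fintype F] [DecidableEq F] {q : ℕ}

/-- The number of isotropic points of the projective line with respect to the Hermitian matrix
with entries `α, β` in the first row and `β ^ q, γ` in the second row. -/
def isoPts (q : ℕ) (α β γ : F) : ℕ :=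
  if α = 0 ∧ β = 0 ∧ γ = 0 then q ^ 2 + 1 else if α * γ = β * β ^ q then 1 else q + 1

theorem sum_trace_affine (hq : Fintype.card F = q ^ 2) (κ μ e : F) (hκ : κ ≠ 0)
    (he : conjHom hq e = e) :
    (∑ v : F, if e + ((κ * v + μ) + conjHom hq (κ * v + μ)) = 0 then 1 else 0) = q := by
  rw [← Finset.card_filter]
  refine Eq.trans ?_ (card_trace_affine hq κ μ (-e) hκ (by rw [map_neg, he]))
  congr 1
  ext v
  simp only [Finset.mem_filter, Finset.mem_univ, true_and]
  rw [eq_neg_iff_add_eq_zero, add_comm]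

/-- The points of the projective line are (1:0), isotropic iff α = 0, and the (l:1). For α ≠ 0
completing the square turns isotropy of (l:1) into a norm equation for l + β/α, whose right side
vanishes exactly for singular matrices. For α = 0 ≠ β it is a trace equation. -/
theorem isoPts_eq (hq : Fintype.card F = q ^ 2) (α β γ : F) (hα : conjHom hq α = α)
    (hγ : conjHom hq γ = γ) :
    isoPts q α β γ = (if α = 0 then 1 else 0) +
      ∑ l : F, if l * conjHom hq l * α + (conjHom hq l * β + l * conjHom hq β) + γ = 0
        then 1 else 0 := by
  unfold isoPts
  rw [← conjHom_apply hq]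
  by_cases h0 : α = 0
  · subst h0
    by_cases hβ : β = 0
    · subst hβ
      by_cases hγ0 : γ = 0
      · simp [hγ0, hq, add_comm]
      · simp [hγ0]
    · have h1 := sum_trace_affine hq (conjHom hq β) 0 γ (by simpa using hβ) hγ
      simp only [hβ, false_and, and_false, if_false, zero_mul, if_true, mul_zero, zero_add]
      rw [if_neg (by simpa using hβ), add_comm]
      congr 1
      refine h1.symm.trans ?_
      refine Finset.sum_congr rfl fun l _ => ?_
      congr 1
      simp only [map_mul, conjHom_conjHom, add_zero, eq_iff_iff]
      constructor <;> intro h <;> linear_combination h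
  · simp only [h0, false_and, if_false, zero_add]
    have h1 : ∀ l : F, (l * conjHom hq l * α + (conjHom hq l * β + l * conjHom hq β) + γ = 0 ↔
        (l + β * α⁻¹) * conjHom hq (l + β * α⁻¹) = (β * conjHom hq β - α * γ) * α⁻¹ ^ 2) := by
      intro l
      rw [map_add, map_mul, map_inv₀, hα]
      constructor
      · intro h
        field_simp
        linear_combination α * h
      · intro h
        field_simp at h
        refine mul_left_cancel₀ h0 ?_
        linear_combination h
    simp only [h1]
    -- Translation by β/α leaves a pure norm equation.
    rw [← (Equiv.subRight (β * α⁻¹)).sum_comp]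
    simp only [Equiv.subRight_apply, sub_add_cancel]
    rw [← Finset.card_filter]
    split_ifs with h2
    · rw [← h2, sub_self, zero_mul]
      refine (Finset.card_eq_one.2 ?_).symm
      refine ⟨0, ?_⟩
      ext x
      simp
    · rw [card_norm_fiber hq]
      · simp only [map_mul, map_sub, conjHom_conjHom, map_pow, map_inv₀, hα, hγ]
        ring
      · refine mul_ne_zero (fun h => h2 ?_) (pow_ne_zero _ (inv_ne_zero h0))
        linear_combination -h

/-- The condition that `(b, -a)` is an isotropic vector of a Hermitian matrix. -/
def isoPerp (q : ℕ) (a b α β γ : F) : ℕ :=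
  if b ^ q * b * α + a ^ q * a * γ = b ^ q * a * β + a ^ q * b * β ^ q then 1 else 0

/-- The indicator of the zero Hermitian matrix. -/
def isZeroH (α β γ : F) : ℕ := if α = 0 ∧ β = 0 ∧ γ = 0 then 1 else 0

/-! ### Sums of the invariants of Hermitian matrices over a column -/

/-- For odd m the first coordinate stands alone and contributes a dyad. The zero column gives all
q²+1 points; each of the q⁴-1 others gives a matrix of rank one, with a single isotropic point. -/
theorem sum_isoPts_dyad (hq : Fintype.card F = q ^ 2) :
    ∑ u : F, ∑ v : F, isoPts q (u ^ q * u) (u ^ q * v) (v ^ q * v) = q ^ 2 + 1 + (q ^ 4 - 1) := by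
  have h1 := one_lt_of_card hq
  have h : ∀ u v : F, isoPts q (u ^ q * u) (u ^ q * v) (v ^ q * v) =
      1 + if u = 0 ∧ v = 0 then q ^ 2 else 0 := by
    intro u v
    unfold isoPts
    have h2 : u ^ q * u * (v ^ q * v) = u ^ q * v * (u ^ q * v) ^ q := by
      simp only [← conjHom_apply hq, map_mul, conjHom_conjHom]; ring
    rw [if_pos h2]
    have : q ≠ 0 := by omega
    by_cases hu : u = 0 <;> by_cases hv : v = 0 <;> simp [hu, hv, this, add_comm]
  simp only [h, Finset.sum_add_distrib, Finset.sum_const, Finset.card_univ, hq, ite_and]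
  have : 1 ≤ q ^ 4 := Nat.one_le_pow _ _ (by omega)
  simp
  ring_nf
  omega

theorem sum_isZeroH_dyad (hq : Fintype.card F = q ^ 2) :
    ∑ u : F, ∑ v : F, isZeroH (u ^ q * u) (u ^ q * v) (v ^ q * v) = 1 := by
  have h1 := one_lt_of_card hq
  have h : ∀ u v : F, isZeroH (u ^ q * u) (u ^ q * v) (v ^ q * v) =
      if u = 0 ∧ v = 0 then 1 else 0 := by
    intro u v
    unfold isZeroH
    have : q ≠ 0 := by omega
    by_cases hu : u = 0 <;> by_cases hv : v = 0 <;> simp [hu, hv, this]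
  simp only [h, ite_and]
  simp

/-- Each isotropic point carries q²-1 nonzero vectors (b, -a), and the zero column adds 1. -/
theorem sum_isoPerp (hq : Fintype.card F = q ^ 2) (α β γ : F) (hα : conjHom hq α = α)
    (hγ : conjHom hq γ = γ) :
    ∑ a : F, ∑ b : F, isoPerp q a b α β γ = (q ^ 2 - 1) * isoPts q α β γ + 1 := by
  have h1 := one_lt_of_card hq
  rw [isoPts_eq hq α β γ hα hγ]
  unfold isoPerp
  simp only [← conjHom_apply hq]
  rw [← Finset.add_sum_erase _ _ (Finset.mem_univ (0 : F))]
  have h2 : ∀ a ∈ Finset.univ.erase (0 : F), (∑ b : F,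
      if conjHom hq b * b * α + conjHom hq a * a * γ =
        conjHom hq b * a * β + conjHom hq a * b * conjHom hq β then 1 else 0) =
      ∑ l : F, if l * conjHom hq l * α + (conjHom hq l * β + l * conjHom hq β) + γ = 0
        then 1 else 0 := by
    intro a ha
    have ha : a ≠ 0 := by simpa using ha
    have ha' : conjHom hq a ≠ 0 := by simpa using ha
    -- With b = -la the vector (b, -a) is -a(l, 1), so its isotropy is that of the point (l:1).
    rw [← Equiv.sum_comp (Equiv.mulRight₀ (-a) (neg_ne_zero.2 ha))]
    refine Finset.sum_congr rfl fun l _ => ?_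
    congr 1
    simp only [Equiv.mulRight₀_apply, map_mul, map_neg, eq_iff_iff]
    constructor
    · intro h
      refine mul_left_cancel₀ (mul_ne_zero ha ha') ?_
      linear_combination h
    · intro h
      linear_combination a * conjHom hq a * h
  rw [Finset.sum_congr rfl h2, Finset.sum_const, Finset.card_erase_of_mem (Finset.mem_univ _),
    Finset.card_univ, hq, smul_eq_mul]
  have h3 : (∑ b : F, if conjHom hq b * b * α + conjHom hq 0 * 0 * γ =
      conjHom hq b * 0 * β + conjHom hq 0 * b * conjHom hq β then 1 else 0) =
      (q ^ 2 - 1) * (if α = 0 then 1 else 0) + 1 := by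
    have : 1 ≤ q ^ 2 := Nat.one_le_pow _ _ (by omega)
    by_cases h0 : α = 0
    · simp [h0, hq]; omega
    · simp [h0]
  rw [h3]
  ring

/-- The number of `(u, v)` for which adding the dyads of a column `(a, b)` and `(u, v)` makes
the norm of `(l, 1)` vanish. -/
theorem sum_sum_norm_eq_zero (hq : Fintype.card F = q ^ 2) (κ l e : F) (hκ : κ ≠ 0)
    (he : conjHom hq e = e) :
    (∑ u : F, ∑ v : F, if e + ((κ * v + κ * l * u) + conjHom hq (κ * v + κ * l * u)) = 0
      then 1 else 0) = q ^ 3 := by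
  simp only [sum_trace_affine hq κ _ e hκ he, Finset.sum_const, Finset.card_univ, hq, smul_eq_mul]
  ring

/-- Exchange the summations: fix a point and count the columns (u, v) that make it isotropic. The
point (b:-a) is orthogonal to the column (a, b), so its norm does not change and it contributes q⁴
or 0. At each of the q² other points the norm changes by the trace of a nonzero linear form in (u,
v), which gives q³ columns. -/
theorem sum_isoPts_add (hq : Fintype.card F = q ^ 2) (a b α β γ : F) (hα : conjHom hq α = α)
    (hγ : conjHom hq γ = γ) (hab : ¬ (a = 0 ∧ b = 0)) :
    ∑ u : F, ∑ v : F, isoPts q (α + (a ^ q * u + u ^ q * a)) (β + (a ^ q * v + u ^ q * b))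
      (γ + (b ^ q * v + v ^ q * b)) = isoPerp q a b α β γ * q ^ 4 + q ^ 5 := by
  have h1 := one_lt_of_card hq
  have hfix : ∀ x y z : F, conjHom hq x = x →
      conjHom hq (x + (y ^ q * z + z ^ q * y)) = x + (y ^ q * z + z ^ q * y) := by
    intro x y z hx
    simp only [← conjHom_apply hq, map_add, map_mul, conjHom_conjHom, hx]
    ring
  simp only [isoPts_eq hq _ _ _ (hfix _ _ _ hα) (hfix _ _ _ hγ), Finset.sum_add_distrib]
  have hN : ∀ l : F, conjHom hq
      (l * conjHom hq l * α + (conjHom hq l * β + l * conjHom hq β) + γ) =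
      l * conjHom hq l * α + (conjHom hq l * β + l * conjHom hq β) + γ := by
    intro l
    simp only [map_add, map_mul, conjHom_conjHom, hα, hγ]
    ring
  -- The increment of the norm of (l, 1) is the trace of conj(la+b)·(v+lu), which vanishes
  -- identically exactly when la+b = 0.
  have hterm : ∀ l u v : F, (l * conjHom hq l * (α + (a ^ q * u + u ^ q * a)) +
        (conjHom hq l * (β + (a ^ q * v + u ^ q * b)) +
          l * conjHom hq (β + (a ^ q * v + u ^ q * b))) + (γ + (b ^ q * v + v ^ q * b))) =
      (l * conjHom hq l * α + (conjHom hq l * β + l * conjHom hq β) + γ) +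
        ((conjHom hq (l * a + b) * v + conjHom hq (l * a + b) * l * u) +
          conjHom hq (conjHom hq (l * a + b) * v + conjHom hq (l * a + b) * l * u)) := by
    intro l u v
    simp only [← conjHom_apply hq, map_add, map_mul, conjHom_conjHom]
    ring
  simp only [hterm]
  have hcomm : ∀ f : F → F → F → ℕ, ∑ u, ∑ v, ∑ l, f u v l = ∑ l, ∑ u, ∑ v, f u v l := by
    intro f
    rw [Finset.sum_comm]
    simp only [Finset.sum_comm (s := (Finset.univ : Finset F)) (t := Finset.univ) (f := fun u l => f u _ l)]
    rw [Finset.sum_comm]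
    refine Finset.sum_congr rfl fun l _ => Finset.sum_comm
  rw [hcomm]
  by_cases ha : a = 0
  · subst ha
    have hb : b ≠ 0 := fun h => hab ⟨rfl, h⟩
    have hb' : conjHom hq b ≠ 0 := by simpa using hb
    have h2 : ∀ l : F, _ := fun l => sum_sum_norm_eq_zero hq (conjHom hq (l * 0 + b)) l
      (l * conjHom hq l * α + (conjHom hq l * β + l * conjHom hq β) + γ)
      (by simpa using hb) (hN l)
    rw [Finset.sum_congr rfl fun l _ => h2 l]
    unfold isoPerp
    have hq0 : q ≠ 0 := by omega
    simp only [zero_pow hq0, zero_mul, mul_zero, add_zero, Finset.sum_const, Finset.card_univ, hq,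
      smul_eq_mul]
    simp only [mul_eq_zero, pow_eq_zero_iff hq0, hb, false_or, or_self]
    ring
  · have ha' : conjHom hq a ≠ 0 := by simpa using ha
    have hfirst : (∑ u : F, ∑ _v : F, if α + (a ^ q * u + u ^ q * a) = 0 then 1 else 0) =
        q ^ 3 := by
      rw [Finset.sum_comm]
      have h3 := sum_trace_affine hq (conjHom hq a) 0 α ha' hα
      simp only [add_zero, map_mul, conjHom_conjHom] at h3
      have h4 : ∀ u : F, α + (a ^ q * u + u ^ q * a) =
          α + (conjHom hq a * u + a * conjHom hq u) := by
        intro u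
        simp only [conjHom_apply hq]
        ring
      simp only [h4, h3, Finset.sum_const, Finset.card_univ, hq, smul_eq_mul]
      ring
    -- The exceptional point (b:-a) is (l:1) with l = -b/a.
    rw [hfirst, ← Finset.add_sum_erase _ _ (Finset.mem_univ (-b * a⁻¹))]
    have h2 : ∀ l ∈ Finset.univ.erase (-b * a⁻¹), _ := fun l hl =>
      sum_sum_norm_eq_zero hq (conjHom hq (l * a + b)) l
        (l * conjHom hq l * α + (conjHom hq l * β + l * conjHom hq β) + γ) (by
          have hl : l ≠ -b * a⁻¹ := by simpa using hl
          intro h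
          refine hl ?_
          have : l * a + b = 0 := (map_eq_zero (conjHom hq)).1 h
          field_simp
          linear_combination this) (hN l)
    rw [Finset.sum_congr rfl h2]
    have h5 : -b * a⁻¹ * a + b = 0 := by field_simp; ring
    simp only [h5, map_zero, zero_mul, add_zero, Finset.sum_const, Finset.card_univ, hq,
      smul_eq_mul]
    rw [Finset.card_erase_of_mem (Finset.mem_univ _), Finset.card_univ, hq]
    have h6 : (-b * a⁻¹ * conjHom hq (-b * a⁻¹) * α + (conjHom hq (-b * a⁻¹) * β +
        -b * a⁻¹ * conjHom hq β) + γ = 0) ↔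
        b ^ q * b * α + a ^ q * a * γ = b ^ q * a * β + a ^ q * b * β ^ q := by
      simp only [← conjHom_apply hq, map_mul, map_neg, map_inv₀]
      constructor
      · intro h
        field_simp at h
        linear_combination h
      · intro h
        field_simp
        linear_combination h
    simp only [h6]
    change _ + (_ * (_ * isoPerp q a b α β γ) + _) = _
    obtain ⟨r, hr⟩ : ∃ r, q ^ 2 = r + 1 := ⟨q ^ 2 - 1, by
      have : 1 ≤ q ^ 2 := Nat.one_le_pow _ _ (by omega)
      omega⟩
    rw [show q ^ 5 = q ^ 2 * q ^ 3 by ring, show q ^ 4 = q ^ 2 * q ^ 2 by ring, hr]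
    simp only [Nat.add_sub_cancel]
    ring

/-- For a ≠ 0 the off-diagonal equation determines v from u. Given the first diagonal equation, the
second one then becomes independent of u and says that (b, -a) is isotropic. What remains is a trace
equation for u with q solutions. For a = 0 the off-diagonal equation determines u, and the trace
equation is one for v. -/
theorem sum_isZeroH_add (hq : Fintype.card F = q ^ 2) (a b α β γ : F) (hα : conjHom hq α = α)
    (hγ : conjHom hq γ = γ) (hab : ¬ (a = 0 ∧ b = 0)) :
    ∑ u : F, ∑ v : F, isZeroH (α + (a ^ q * u + u ^ q * a)) (β + (a ^ q * v + u ^ q * b))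
      (γ + (b ^ q * v + v ^ q * b)) = isoPerp q a b α β γ * q := by
  have h1 := one_lt_of_card hq
  have hq0 : q ≠ 0 := by omega
  unfold isZeroH isoPerp
  simp only [← conjHom_apply hq]
  by_cases ha : a = 0
  · subst ha
    have hb : b ≠ 0 := fun h => hab ⟨rfl, h⟩
    have hb' : conjHom hq b ≠ 0 := by simpa using hb
    have h2 : ∀ u : F, β + conjHom hq u * b = 0 ↔ u = -conjHom hq (β * b⁻¹) := by
      intro u
      constructor
      · intro h
        have : conjHom hq u = - (β * b⁻¹) := by
          field_simp; linear_combination h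
        rw [← map_neg, ← this, conjHom_conjHom]
      · rintro rfl
        rw [map_neg, conjHom_conjHom]
        field_simp
        ring
    have h3 := sum_trace_affine hq (conjHom hq b) 0 γ hb' hγ
    simp only [add_zero, map_mul, conjHom_conjHom] at h3
    have h4 : ∀ v : F, γ + (conjHom hq b * v + conjHom hq v * b) =
        γ + (conjHom hq b * v + b * conjHom hq v) := by
      intro v; ring
    simp only [map_zero, zero_mul, mul_zero, add_zero, zero_add, h2, h4]
    by_cases h0 : α = 0
    · simp only [h0, true_and, mul_zero, if_true, one_mul, ite_and, Finset.sum_ite_irrel,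
        Finset.sum_const_zero]
      simp only [h3]
      simp
    · simp [h0, hb]
  · have ha' : conjHom hq a ≠ 0 := by simpa using ha
    have h2 : ∀ u v : F, β + (conjHom hq a * v + conjHom hq u * b) = 0 ↔
        v = -(β + conjHom hq u * b) * (conjHom hq a)⁻¹ := by
      intro u v
      constructor
      · intro h
        field_simp
        linear_combination h
      · rintro rfl
        field_simp
        ring
    have h3 := sum_trace_affine hq (conjHom hq a) 0 α ha' hα
    simp only [add_zero, map_mul, conjHom_conjHom] at h3
    have h5 : ∀ u : F, α + (conjHom hq a * u + a * conjHom hq u) = 0 →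
        (γ + (conjHom hq b * (-(β + conjHom hq u * b) * (conjHom hq a)⁻¹) +
          conjHom hq (-(β + conjHom hq u * b) * (conjHom hq a)⁻¹) * b) = 0 ↔
        conjHom hq b * b * α + conjHom hq a * a * γ =
          conjHom hq b * a * β + conjHom hq a * b * conjHom hq β) := by
      intro u hu
      simp only [map_mul, map_neg, map_add, map_inv₀, conjHom_conjHom]
      constructor
      · intro h
        field_simp at h
        linear_combination h + conjHom hq b * b * hu
      · intro h
        field_simp
        linear_combination h - conjHom hq b * b * hu
    have h6 : ∀ u : F, (∑ v : F, if α + (conjHom hq a * u + conjHom hq u * a) = 0 ∧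
        β + (conjHom hq a * v + conjHom hq u * b) = 0 ∧
        γ + (conjHom hq b * v + conjHom hq v * b) = 0 then 1 else 0) =
        if conjHom hq b * b * α + conjHom hq a * a * γ =
          conjHom hq b * a * β + conjHom hq a * b * conjHom hq β then
          (if α + (conjHom hq a * u + a * conjHom hq u) = 0 then 1 else 0) else 0 := by
      intro u
      rw [mul_comm (conjHom hq u) a]
      by_cases hu : α + (conjHom hq a * u + a * conjHom hq u) = 0
      · simp only [hu, true_and, h2, ite_and, Finset.sum_ite_eq', Finset.mem_univ, if_true, h5 u hu]
      · simp [hu]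
    simp only [h6]
    split_ifs with h7
    · rw [one_mul]; exact h3
    · simp

/-- The number of `v` for which adding the dyad of `(a)` and `(v)` makes the norm vanish. -/
theorem sum_norm_add (hq : Fintype.card F = q ^ 2) (a α : F) (hα : conjHom hq α = α)
    (ha : a ≠ 0) : (∑ v : F, if α + (a ^ q * v + v ^ q * a) = 0 then 1 else 0) = q := by
  have h3 := sum_trace_affine hq (conjHom hq a) 0 α (by simpa using ha) hα
  simp only [add_zero, map_mul, conjHom_conjHom] at h3
  simp only [← conjHom_apply hq, mul_comm _ a]
  simpa only [mul_comm _ a] using h3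

end Herm

end HermGr

namespace HermGr

/-! ### Counting words with a given prefix -/

section Words

variable {A : Type*} {m : ℕ}

/-- The number of words with the property `P` that agree with `a` in the first `t` places. -/
noncomputable def cnt (P : (Fin m → A) → Prop) (t : ℕ) (a : ℕ → A) : ℕ :=
  Nat.card {w : Fin m → A // P w ∧ ∀ i : Fin m, (i : ℕ) < t → w i = a i}

theorem cnt_step [Fintype A] (P : (Fin m → A) → Prop) {t : ℕ} (ht : t < m) (a : ℕ → A) :
    cnt P t a = ∑ c : A, cnt P (t + 1) (Function.update a t c) := by
  classical
  unfold cnt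
  simp only [Nat.card_eq_fintype_card, Fintype.card_subtype]
  rw [Finset.card_eq_sum_card_fiberwise (f := fun w => w ⟨t, ht⟩) (t := Finset.univ)
    (fun _ _ => Finset.mem_coe.2 (Finset.mem_univ _))]
  refine Finset.sum_congr rfl fun c _ => ?_
  congr 1
  ext w
  simp only [Finset.mem_filter, Finset.mem_univ, true_and]
  constructor
  · rintro ⟨⟨hP, h⟩, hc⟩
    refine ⟨hP, fun i hi => ?_⟩
    by_cases hit : (i : ℕ) = t
    · have : i = ⟨t, ht⟩ := Fin.ext hit
      subst this
      simpa using hc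
    · rw [Function.update_of_ne hit, h i (by omega)]
  · rintro ⟨hP, h⟩
    refine ⟨⟨hP, fun i hi => ?_⟩, ?_⟩
    · rw [h i (by omega), Function.update_of_ne (by omega)]
    · rw [h ⟨t, ht⟩ (by simp)]; simp

open Classical in
theorem cnt_full (P : (Fin m → A) → Prop) (a : ℕ → A) :
    cnt P m a = if P (fun i => a i) then 1 else 0 := by
  unfold cnt
  have h : ∀ w : Fin m → A, (∀ i : Fin m, (i : ℕ) < m → w i = a i) ↔ w = fun i : Fin m => a i :=
    fun w => ⟨fun h => funext fun i => h i i.2, fun h i _ => congrFun h i⟩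
  simp only [h]
  split_ifs with hP
  · rw [Nat.card_eq_one_iff_unique]
    refine ⟨⟨?_⟩, ⟨_, hP, rfl⟩⟩
    rintro ⟨w, -, hw⟩ ⟨w', -, hw'⟩
    exact Subtype.ext (hw.trans hw'.symm)
  · rw [Nat.card_eq_zero]
    left
    refine ⟨?_⟩
    rintro ⟨w, h1, rfl⟩
    exact hP h1

end Words

/-! ### The Hermitian form, column by column -/

section Form

variable {F : Type*} [Field F]

/-- The part of the Hermitian form of `F ^ m` that involves only the first `t` coordinates. -/
def partialForm (q m : ℕ) (x y : ℕ → F) : ℕ → F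
  | 0 => 0
  | t + 1 => partialForm q m x y t + if (m - t) % 2 = 1 then
      (if t = 0 then x 0 ^ q * y 0 else x (t - 1) ^ q * y t + x t ^ q * y (t - 1)) else 0

theorem partialForm_congr (q m : ℕ) {x y x' y' : ℕ → F} (t : ℕ) (hx : ∀ i < t, x i = x' i)
    (hy : ∀ i < t, y i = y' i) : partialForm q m x y t = partialForm q m x' y' t := by
  induction t with
  | zero => rfl
  | succ t ih =>
    simp only [partialForm]
    rw [ih (fun i hi => hx i (by omega)) (fun i hi => hy i (by omega)), hx t (by omega),
      hy t (by omega), hx (t - 1) (by omega), hy (t - 1) (by omega), hx 0 (by omega),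
      hy 0 (by omega)]

theorem eta_eq_partialForm (q m : ℕ) (x y : ℕ → F) :
    eta q (fun i : Fin m => x i) (fun i : Fin m => y i) = partialForm q m x y m := by
  have h : ∀ k, m % 2 + 2 * k ≤ m → partialForm q m x y (m % 2 + 2 * k) =
      (if m % 2 = 1 then x 0 ^ q * y 0 else 0) + ∑ i ∈ Finset.range k,
        (x (m % 2 + 2 * i) ^ q * y (m % 2 + 2 * i + 1) +
          x (m % 2 + 2 * i + 1) ^ q * y (m % 2 + 2 * i)) := by
    intro k
    induction k with
    | zero =>
      intro _
      rcases Nat.mod_two_eq_zero_or_one m with h | h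
      · simp [h, partialForm]
      · simp [h, partialForm]
    | succ k ih =>
      intro hk
      rw [show m % 2 + 2 * (k + 1) = (m % 2 + 2 * k + 1) + 1 by ring, partialForm, partialForm,
        ih (by omega), if_neg (show ¬ (m - (m % 2 + 2 * k)) % 2 = 1 by omega),
        if_pos (show (m - (m % 2 + 2 * k + 1)) % 2 = 1 by omega),
        if_neg (show ¬ m % 2 + 2 * k + 1 = 0 by omega),
        Finset.sum_range_succ, Nat.add_sub_cancel]
      ring
  have h2 := h (m / 2) (by omega)
  rw [show m % 2 + 2 * (m / 2) = m by omega] at h2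
  rw [h2]
  unfold eta
  congr 1
  exact Fin.sum_univ_eq_sum_range (fun i => x (m % 2 + 2 * i) ^ q * y (m % 2 + 2 * i + 1) +
          x (m % 2 + 2 * i + 1) ^ q * y (m % 2 + 2 * i)) (m / 2)

/-- It makes the diagonal Gram entries fixed under conjugation, which the counts of trace and norm
fibres require. -/
theorem partialForm_conj [Fintype F] {q : ℕ} (hq : Fintype.card F = q ^ 2) (m : ℕ) (x y : ℕ → F)
    (t : ℕ) : conjHom hq (partialForm q m x y t) = partialForm q m y x t := by
  induction t with
  | zero => simp [partialForm]
  | succ t ih =>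
    simp only [partialForm, map_add, ih]
    congr 1
    split_ifs
    · simp only [← conjHom_apply hq, map_mul, conjHom_conjHom, mul_comm]
    · simp only [← conjHom_apply hq, map_mul, map_add, conjHom_conjHom]; ring
    · simp

end Form

/-! ### Isotropic vectors with a given prefix -/

section Vectors

variable {F : Type*} [Field F] [Fintype F] [DecidableEq F] {q : ℕ}

/-- The number of vectors of a hyperbolic space with `Q` equal to the square root of the number of
all vectors, that have a given norm; `z` indicates that the norm is zero. -/
def vecFull (q Q z : ℕ) : ℕ := Q * ((Q - 1) + z * q) / q

/-- The division is exact: q divides Q when k > 0, and for k = 0 only zq/q is left. Over ℚ the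
recurrences become polynomial identities. -/
theorem cast_vecFull (hq : 1 < q) (k z : ℕ) :
    (vecFull q (q ^ (2 * k)) z : ℚ) = q ^ (2 * k) * ((q ^ (2 * k) - 1) + z * q) / q := by
  have h0 : (q : ℚ) ≠ 0 := by positivity
  have h1 : 1 ≤ q ^ (2 * k) := Nat.one_le_pow _ _ (by omega)
  unfold vecFull
  rw [Nat.cast_div]
  · push_cast [h1]; rfl
  · rcases k with - | k
    · simp
    · exact Dvd.dvd.mul_right (dvd_pow_self q (by omega)) _
  · exact h0

/-- The two alternating cases of the recurrence are proved together: prefixes ending at a boundary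
of hyperbolic pairs, and prefixes one column shorter, which end inside a pair. In the latter a
nonzero last entry makes the next step a trace equation, so the count no longer depends on the norm
reached so far. -/
theorem cnt_isotropic_even (hq : Fintype.card F = q ^ 2) (m k : ℕ) :
    ∀ (t : ℕ) (x : ℕ → F), t + 2 * k = m →
      cnt (fun w : Fin m → F => eta q w w = 0) t x =
        vecFull q (q ^ (2 * k)) (if partialForm q m x x t = 0 then 1 else 0) ∧
      ∀ t', t = t' + 1 → t' ≠ 0 →
        cnt (fun w : Fin m → F => eta q w w = 0) t' x =
          if x (t' - 1) = 0 then
            q ^ 2 * vecFull q (q ^ (2 * k)) (if partialForm q m x x t' = 0 then 1 else 0)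
          else q ^ (2 * k) * q ^ (2 * k) * q := by
  have hq1 := one_lt_of_card hq
  have hq0 : (q : ℚ) ≠ 0 := by positivity
  have hupd : ∀ (x : ℕ → F) t c, partialForm q m (Function.update x t c)
      (Function.update x t c) t = partialForm q m x x t := by
    intro x t c
    refine partialForm_congr q m t ?_ ?_ <;>
    · intro i hi
      rw [Function.update_of_ne (by omega)]
  -- One step back from a boundary; it uses only the boundary formula for the same k and hence
  -- serves both cases of the induction.
  have hhalf : ∀ (k t' : ℕ) (x : ℕ → F), t' + 1 + 2 * k = m → t' ≠ 0 →
      (∀ y : ℕ → F, cnt (fun w : Fin m → F => eta q w w = 0) (t' + 1) y =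
        vecFull q (q ^ (2 * k)) (if partialForm q m y y (t' + 1) = 0 then 1 else 0)) →
      cnt (fun w : Fin m → F => eta q w w = 0) t' x =
          if x (t' - 1) = 0 then
            q ^ 2 * vecFull q (q ^ (2 * k)) (if partialForm q m x x t' = 0 then 1 else 0)
          else q ^ (2 * k) * q ^ (2 * k) * q := by
    intro k t' x ht h0 h
    rw [cnt_step _ (by omega)]
    have hstep : ∀ c, partialForm q m (Function.update x t' c) (Function.update x t' c) (t' + 1) =
        partialForm q m x x t' + (x (t' - 1) ^ q * c + c ^ q * x (t' - 1)) := by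
      intro c
      rw [partialForm, if_pos (by omega), if_neg h0, hupd, Function.update_self,
        Function.update_of_ne (by omega)]
    simp only [h, hstep]
    split_ifs with hx hα
    · simp [hx, hα, hq, zero_pow (show q ≠ 0 by omega)]
    · simp [hx, hα, hq, zero_pow (show q ≠ 0 by omega)]
    · have h3 := sum_norm_add hq (x (t' - 1)) (partialForm q m x x t') (partialForm_conj hq _ _ _ _)
        hx
      rw [← Nat.cast_inj (R := ℚ), Nat.cast_sum]
      simp only [cast_vecFull hq1]
      rw [← Finset.sum_div, ← Finset.mul_sum, Finset.sum_add_distrib, ← Finset.sum_mul,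
        ← Nat.cast_sum, h3, Finset.sum_const, Finset.card_univ, hq]
      push_cast
      field_simp
      simp only [nsmul_eq_mul]
      push_cast
      ring
  induction k with
  | zero =>
    intro t x ht
    have hA : ∀ x : ℕ → F, cnt (fun w : Fin m → F => eta q w w = 0) t x =
        vecFull q (q ^ (2 * 0)) (if partialForm q m x x t = 0 then 1 else 0) := by
      intro x
      obtain rfl : t = m := by omega
      rw [cnt_full, eta_eq_partialForm]
      unfold vecFull
      split_ifs <;> simp [show 0 < q by omega]
    refine ⟨hA x, ?_⟩
    rintro t' rfl h0
    exact hhalf 0 t' x ht h0 hA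
  | succ k ih =>
    intro t x ht
    have hA : ∀ x : ℕ → F, cnt (fun w : Fin m → F => eta q w w = 0) t x =
        vecFull q (q ^ (2 * (k + 1))) (if partialForm q m x x t = 0 then 1 else 0) := by
      intro x
      rw [cnt_step _ (by omega)]
      by_cases h0 : t + 1 = 0
      · omega
      have h1 : ∀ c, cnt (fun w : Fin m → F => eta q w w = 0) (t + 1) (Function.update x t c) = _ :=
        fun c => (ih (t + 2) (Function.update x t c) (by omega)).2 (t + 1) rfl h0
      have hstep : ∀ c, partialForm q m (Function.update x t c) (Function.update x t c) (t + 1) =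
          partialForm q m x x t := by
        intro c
        rw [partialForm, if_neg (by omega), hupd, add_zero]
      simp only [h1, hstep, Nat.add_sub_cancel, Function.update_self]
      -- The zero entry is the only one to be singled out; the q²-1 others all contribute the same.
      rw [Finset.sum_ite]
      simp only [Finset.sum_const, Finset.filter_eq', Finset.mem_univ, if_true,
        Finset.card_singleton, Finset.filter_ne', smul_eq_mul,
        Finset.card_erase_of_mem, Finset.card_univ, hq]
      rw [← Nat.cast_inj (R := ℚ)]
      have h2 : 1 ≤ q ^ 2 := Nat.one_le_pow _ _ (by omega)
      push_cast [h2, cast_vecFull hq1]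
      field_simp
      ring
    refine ⟨hA x, ?_⟩
    rintro t' rfl h0
    exact hhalf (k + 1) t' x ht h0 hA

end Vectors

end HermGr

namespace HermGr

/-! ### Isotropic pairs of vectors with a given prefix -/

section Pairs

variable {F : Type*} [Field F]

/-- The Gram matrix of the two rows of a word is zero. -/
def IsotropicWord (q : ℕ) {m : ℕ} (w : Fin m → F × F) : Prop :=
  eta q (fun i => (w i).1) (fun i => (w i).1) = 0 ∧
    eta q (fun i => (w i).1) (fun i => (w i).2) = 0 ∧
      eta q (fun i => (w i).2) (fun i => (w i).2) = 0

/-- The entries of the Gram matrix of the first `t` columns. -/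
def gram (q m : ℕ) (a : ℕ → F × F) (t : ℕ) : F × F × F :=
  (partialForm q m (fun i => (a i).1) (fun i => (a i).1) t,
    partialForm q m (fun i => (a i).1) (fun i => (a i).2) t,
    partialForm q m (fun i => (a i).2) (fun i => (a i).2) t)

/-- The number of pairs of vectors of a hyperbolic space with `Q` equal to the square root of the
number of all vectors, that have a given Gram matrix; `s` is the number of isotropic points of
the Gram matrix and `z` indicates that it is zero. -/
def pairFull (q Q s z : ℕ) : ℕ :=
  Q * Q * ((Q - 1) * (Q - q * q) + s * q * (Q - 1) + z * q ^ 4) / q ^ 4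

/-- For k > 0 the factor Q² is divisible by q⁴ and q² ≤ Q, so neither division nor subtraction loses
anything. For k = 0 the factor Q-1 = 0 hides the truncated Q-q². -/
theorem cast_pairFull {q : ℕ} (hq : 1 < q) (k s z : ℕ) :
    (pairFull q (q ^ (2 * k)) s z : ℚ) = q ^ (2 * k) * q ^ (2 * k) *
      ((q ^ (2 * k) - 1) * (q ^ (2 * k) - q ^ 2) + s * q * (q ^ (2 * k) - 1) + z * q ^ 4) /
        q ^ 4 := by
  have h0 : (q ^ 4 : ℚ) ≠ 0 := by positivity
  have h1 : 1 ≤ q ^ (2 * k) := Nat.one_le_pow _ _ (by omega)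
  unfold pairFull
  rw [Nat.cast_div]
  · rcases k with - | k
    · simp
    · have h2 : q * q ≤ q ^ (2 * (k + 1)) := by
        rw [← sq]; exact Nat.pow_le_pow_right (by omega) (by omega)
      push_cast [h1, h2]
      ring
  · rcases k with - | k
    · simp
    · refine Dvd.dvd.mul_right ?_ _
      rw [← pow_add]
      exact pow_dvd_pow q (by omega)
  · exact_mod_cast h0

/-- The number of pairs of vectors with a given beginning that ends inside a hyperbolic pair of
coordinates, in terms of the last column and the Gram matrix. -/
def pairHalf (q Q : ℕ) [DecidableEq F] (c : F × F) (H : F × F × F) : ℕ :=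
  if c.1 = 0 ∧ c.2 = 0 then q ^ 4 * pairFull q Q (isoPts q H.1 H.2.1 H.2.2) (isZeroH H.1 H.2.1 H.2.2)
  else (Q * Q - Q) * (Q * Q) + isoPerp q c.1 c.2 H.1 H.2.1 H.2.2 * (Q * Q * Q * q)

theorem gram_update (q m : ℕ) (a : ℕ → F × F) (t : ℕ) (c : F × F) :
    gram q m (Function.update a t c) t = gram q m a t := by
  unfold gram
  congr 1
  · refine partialForm_congr q m t ?_ ?_ <;>
    · intro i hi
      rw [Function.update_of_ne (by omega)]
  congr 1 <;> refine partialForm_congr q m t ?_ ?_ <;>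
    · intro i hi
      rw [Function.update_of_ne (by omega)]

/-- Adding to a Hermitian matrix the dyads of two columns. -/
def addDyad (q : ℕ) (c d : F × F) (H : F × F × F) : F × F × F :=
  (H.1 + (c.1 ^ q * d.1 + d.1 ^ q * c.1), H.2.1 + (c.1 ^ q * d.2 + d.1 ^ q * c.2),
    H.2.2 + (c.2 ^ q * d.2 + d.2 ^ q * c.2))

theorem gram_succ_half (q : ℕ) {m : ℕ} (a : ℕ → F × F) {t : ℕ} (h : (m - t) % 2 = 1) (h0 : t ≠ 0) :
    gram q m a (t + 1) = addDyad q (a (t - 1)) (a t) (gram q m a t) := by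
  simp [gram, addDyad, partialForm, h, h0]

theorem gram_succ_full (q : ℕ) {m : ℕ} (a : ℕ → F × F) {t : ℕ} (h : (m - t) % 2 ≠ 1) :
    gram q m a (t + 1) = gram q m a t := by
  simp only [gram, partialForm, if_neg h, add_zero]

theorem gram_one (q : ℕ) {m : ℕ} (a : ℕ → F × F) (h : m % 2 = 1) :
    gram q m a 1 = ((a 0).1 ^ q * (a 0).1, (a 0).1 ^ q * (a 0).2, (a 0).2 ^ q * (a 0).2) := by
  simp [gram, partialForm, h]

theorem cast_pairHalf_ne [DecidableEq F] {q : ℕ} (hq : 1 < q) (k : ℕ) (c : F × F) (H : F × F × F)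
    (hc : ¬ (c.1 = 0 ∧ c.2 = 0)) : (pairHalf q (q ^ (2 * k)) c H : ℚ) =
      (q ^ (2 * k) * q ^ (2 * k) - q ^ (2 * k)) * (q ^ (2 * k) * q ^ (2 * k)) +
        isoPerp q c.1 c.2 H.1 H.2.1 H.2.2 * (q ^ (2 * k) * q ^ (2 * k) * q ^ (2 * k) * q) := by
  have h1 : 1 ≤ q ^ (2 * k) := Nat.one_le_pow _ _ (by omega)
  have h2 : q ^ (2 * k) ≤ q ^ (2 * k) * q ^ (2 * k) := Nat.le_mul_of_pos_left _ (by omega)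
  unfold pairHalf
  rw [if_neg hc]
  push_cast [h2]
  rfl

variable [Fintype F] {q : ℕ}

theorem gram_conj_fst (hq : Fintype.card F = q ^ 2) (m : ℕ) (a : ℕ → F × F) (t : ℕ) :
    conjHom hq (gram q m a t).1 = (gram q m a t).1 := partialForm_conj hq _ _ _ _

theorem gram_conj_snd (hq : Fintype.card F = q ^ 2) (m : ℕ) (a : ℕ → F × F) (t : ℕ) :
    conjHom hq (gram q m a t).2.2 = (gram q m a t).2.2 := partialForm_conj hq _ _ _ _

/-- `pairFull` is affine in its last two arguments, so a sum over columns requires only the sums of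
the numbers of isotropic points and of the zero indicators. -/
theorem sum_cast_pairFull (hq : Fintype.card F = q ^ 2) (k : ℕ) (s z : F → F → ℕ) :
    ((∑ u : F, ∑ v : F, pairFull q (q ^ (2 * k)) (s u v) (z u v) : ℕ) : ℚ) =
      q ^ (2 * k) * q ^ (2 * k) * (q ^ 4 * ((q ^ (2 * k) - 1) * (q ^ (2 * k) - q ^ 2)) +
        (∑ u : F, ∑ v : F, s u v : ℕ) * q * (q ^ (2 * k) - 1) +
          (∑ u : F, ∑ v : F, z u v : ℕ) * q ^ 4) / q ^ 4 := by
  have hq1 := one_lt_of_card hq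
  push_cast
  simp only [cast_pairFull hq1]
  simp only [← Finset.sum_div, ← Finset.mul_sum, Finset.sum_add_distrib, ← Finset.sum_mul,
    Finset.sum_const, Finset.card_univ, hq, nsmul_eq_mul]
  push_cast
  ring

variable [DecidableEq F]

theorem sum_pairFull_addDyad (hq : Fintype.card F = q ^ 2) (k : ℕ) (c : F × F) (H : F × F × F)
    (h1 : conjHom hq H.1 = H.1) (h2 : conjHom hq H.2.2 = H.2.2) :
    ∑ u : F, ∑ v : F, pairFull q (q ^ (2 * k))
      (isoPts q (addDyad q c (u, v) H).1 (addDyad q c (u, v) H).2.1 (addDyad q c (u, v) H).2.2)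
      (isZeroH (addDyad q c (u, v) H).1 (addDyad q c (u, v) H).2.1 (addDyad q c (u, v) H).2.2) =
      pairHalf q (q ^ (2 * k)) c H := by
  have hq1 := one_lt_of_card hq
  by_cases hc : c.1 = 0 ∧ c.2 = 0
  · have hq0 : q ≠ 0 := by omega
    simp only [pairHalf, and_self, if_true, addDyad, hc.1, hc.2, mul_zero, zero_pow hq0, zero_mul, add_zero,
      Finset.sum_const, Finset.card_univ, hq, smul_eq_mul]
    ring
  · rw [← Nat.cast_inj (R := ℚ), sum_cast_pairFull hq, cast_pairHalf_ne hq1 k c H hc]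
    unfold addDyad
    simp only
    rw [sum_isoPts_add hq _ _ _ _ _ h1 h2 hc, sum_isZeroH_add hq _ _ _ _ _ h1 h2 hc]
    have h0 : (q : ℚ) ≠ 0 := by positivity
    push_cast
    field_simp
    ring

/-- The first column of a hyperbolic pair leaves the Gram matrix unchanged. Over the nonzero columns
the term with `isoPerp` sums to (q²-1) times the number of isotropic points, and this turns Q into
q²Q. -/
theorem sum_pairHalf (hq : Fintype.card F = q ^ 2) (k : ℕ) (H : F × F × F)
    (h1 : conjHom hq H.1 = H.1) (h2 : conjHom hq H.2.2 = H.2.2) :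
    ∑ c : F × F, pairHalf q (q ^ (2 * k)) c H = pairFull q (q ^ (2 * (k + 1)))
      (isoPts q H.1 H.2.1 H.2.2) (isZeroH H.1 H.2.1 H.2.2) := by
  have hq1 := one_lt_of_card hq
  have h0 : (q : ℚ) ≠ 0 := by positivity
  have hS := sum_isoPerp hq H.1 H.2.1 H.2.2 h1 h2
  rw [← Fintype.sum_prod_type' (f := fun a b => isoPerp q a b H.1 H.2.1 H.2.2)] at hS
  rw [← Finset.add_sum_erase _ _ (Finset.mem_univ ((0 : F), (0 : F)))] at hS ⊢
  have h3 : isoPerp q (0 : F) 0 H.1 H.2.1 H.2.2 = 1 := by simp [isoPerp]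
  have hS' : ∑ c ∈ Finset.univ.erase ((0 : F), (0 : F)), isoPerp q c.1 c.2 H.1 H.2.1 H.2.2 =
      (q ^ 2 - 1) * isoPts q H.1 H.2.1 H.2.2 := by
    simp only [h3] at hS
    omega
  rw [← Nat.cast_inj (R := ℚ), Nat.cast_add, Nat.cast_sum]
  rw [Finset.sum_congr rfl fun c hc => cast_pairHalf_ne hq1 k c H (by
    intro h
    exact (Finset.mem_erase.1 hc).1 (Prod.ext h.1 h.2))]
  rw [Finset.sum_add_distrib, Finset.sum_const, ← Finset.sum_mul, ← Nat.cast_sum, hS',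
    Finset.card_erase_of_mem (Finset.mem_univ _), Finset.card_univ, Fintype.card_prod, hq]
  have h4 : 1 ≤ q ^ 2 * q ^ 2 := Nat.succ_le_of_lt (by positivity)
  have h5 : 1 ≤ q ^ 2 := Nat.succ_le_of_lt (by positivity)
  rw [nsmul_eq_mul]
  unfold pairHalf
  simp only [and_self, if_true]
  push_cast [h4, h5, cast_pairFull hq1]
  field_simp
  ring

/-- The number of isotropic words with a given beginning. -/
def pairCount (q m t : ℕ) (a : ℕ → F × F) : ℕ :=
  if (m - t) % 2 = 1 then
    if t = 0 then pairFull q (q ^ (2 * ((m - t) / 2))) (q ^ 2 + 1) 1 +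
      (q ^ 4 - 1) * pairFull q (q ^ (2 * ((m - t) / 2))) 1 0
    else pairHalf q (q ^ (2 * ((m - t) / 2))) (a (t - 1)) (gram q m a t)
  else pairFull q (q ^ (2 * ((m - t) / 2)))
    (isoPts q (gram q m a t).1 (gram q m a t).2.1 (gram q m a t).2.2)
    (isZeroH (gram q m a t).1 (gram q m a t).2.1 (gram q m a t).2.2)

/-- Induction on the number of missing columns. The recurrence alternates between opening a
hyperbolic pair (`sum_pairHalf`) and closing one (`sum_pairFull_addDyad`), except for the isolated
first coordinate when m is odd. -/
theorem cnt_isotropicWord (hq : Fintype.card F = q ^ 2) (m n : ℕ) :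
    ∀ (t : ℕ) (a : ℕ → F × F), t + n = m →
      cnt (fun w : Fin m → F × F => IsotropicWord q w) t a = pairCount q m t a := by
  have hq1 := one_lt_of_card hq
  induction n with
  | zero =>
    rintro t a rfl
    rw [add_zero, cnt_full]
    unfold IsotropicWord pairCount
    rw [if_neg (show ¬ (t - t) % 2 = 1 by simp), eta_eq_partialForm q t (fun i => (a i).1) (fun i => (a i).1),
      eta_eq_partialForm q t (fun i => (a i).1) (fun i => (a i).2),
      eta_eq_partialForm q t (fun i => (a i).2) (fun i => (a i).2)]
    -- With no column left Q = 1, and `pairFull` reduces to the indicator of a zero Gram matrix.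
    simp only [gram, pairFull, isZeroH]
    split_ifs with h <;> simp [h, show 0 < q by omega]
  | succ n ih =>
    intro t a ht
    rw [cnt_step _ (by omega)]
    have h1 : ∀ c : F × F, _ := fun c => ih (t + 1) (Function.update a t c) (by omega)
    simp only [h1]
    unfold pairCount
    by_cases hp : (m - t) % 2 = 1
    · have hp' : ¬ (m - (t + 1)) % 2 = 1 := by omega
      have hk : (m - (t + 1)) / 2 = (m - t) / 2 := by omega
      simp only [if_pos hp, if_neg hp', hk]
      by_cases h0 : t = 0
      · subst h0
        simp only [if_true, zero_add, gram_one q _ (show m % 2 = 1 from hp), Function.update_self]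
        rw [Fintype.sum_prod_type]
        rw [← Nat.cast_inj (R := ℚ), sum_cast_pairFull hq, sum_isoPts_dyad hq, sum_isZeroH_dyad hq]
        have h4 : 1 ≤ q ^ 4 := Nat.succ_le_of_lt (by positivity)
        push_cast [h4, cast_pairFull hq1]
        ring
      · simp only [if_neg h0, gram_succ_half q _ hp h0, gram_update, Function.update_self]
        simp only [Function.update_of_ne (show t - 1 ≠ t by omega)]
        rw [Fintype.sum_prod_type]
        exact sum_pairFull_addDyad hq _ _ _ (gram_conj_fst hq _ _ _) (gram_conj_snd hq _ _ _)
    · have hp' : (m - (t + 1)) % 2 = 1 := by omega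
      have hk : (m - t) / 2 = (m - (t + 1)) / 2 + 1 := by omega
      simp only [if_neg hp, if_pos hp', hk, gram_succ_full q _ hp, gram_update,
        Nat.add_sub_cancel, Function.update_self, Nat.add_eq_zero_iff, one_ne_zero, and_false,
        if_false]
      exact sum_pairHalf hq _ _ (gram_conj_fst hq _ _ _) (gram_conj_snd hq _ _ _)

/-- The number of isotropic vectors with a given beginning. -/
def vecCount (q m t : ℕ) (x : ℕ → F) : ℕ :=
  if (m - t) % 2 = 1 then
    if t = 0 then vecFull q (q ^ (2 * ((m - t) / 2))) 1 +
      (q ^ 2 - 1) * vecFull q (q ^ (2 * ((m - t) / 2))) 0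
    else if x (t - 1) = 0 then q ^ 2 * vecFull q (q ^ (2 * ((m - t) / 2)))
        (if partialForm q m x x t = 0 then 1 else 0)
      else q ^ (2 * ((m - t) / 2)) * q ^ (2 * ((m - t) / 2)) * q
  else vecFull q (q ^ (2 * ((m - t) / 2))) (if partialForm q m x x t = 0 then 1 else 0)

theorem cnt_isotropic (hq : Fintype.card F = q ^ 2) {m t : ℕ} (ht : t ≤ m) (x : ℕ → F) :
    cnt (fun w : Fin m → F => eta q w w = 0) t x = vecCount q m t x := by
  have hq1 := one_lt_of_card hq
  unfold vecCount
  by_cases hp : (m - t) % 2 = 1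
  · have hE := cnt_isotropic_even hq m ((m - t) / 2) (t + 1)
    by_cases h0 : t = 0
    · subst h0
      rw [if_pos hp, if_pos rfl, cnt_step _ (by omega)]
      have h1 : ∀ c : F, _ := fun c => (hE (Function.update x 0 c) (by omega)).1
      simp only [h1]
      -- The isolated coordinate is anisotropic, so the first entry has norm zero only if it is
      -- zero.
      have h2 : ∀ c : F, (partialForm q m (Function.update x 0 c) (Function.update x 0 c) (0 + 1) = 0
          ↔ c = 0) := by
        intro c
        have : m % 2 = 1 := by omega
        have : q ≠ 0 := by omega
        simp [partialForm, *]
      simp only [h2]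
      rw [← Finset.add_sum_erase _ _ (Finset.mem_univ (0 : F)), if_pos rfl]
      congr 1
      rw [Finset.sum_congr rfl fun c hc => by rw [if_neg (Finset.mem_erase.1 hc).1],
        Finset.sum_const, Finset.card_erase_of_mem (Finset.mem_univ _), Finset.card_univ, hq,
        smul_eq_mul]
    · rw [if_pos hp, if_neg h0]
      exact (hE x (by omega)).2 t rfl h0
  · rw [if_neg hp]
    exact (cnt_isotropic_even hq m ((m - t) / 2) t x (by omega)).1

end Pairs

end HermGr

namespace HermGr

/-! ### Row reduced echelon forms of rank `2` -/

section Echelon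

variable {F : Type*} [Field F] {m : ℕ}

/-- `G` is in row reduced echelon form, with leading entries in the columns `j₀ < j₁`. -/
structure IsEchelon (G : Matrix (Fin 2) (Fin m) F) (j₀ j₁ : Fin m) : Prop where
  lt : j₀ < j₁
  zero_left : ∀ j < j₀, G 0 j = 0
  one_left : G 0 j₀ = 1
  zero_right : ∀ j < j₁, G 1 j = 0
  one_right : G 1 j₁ = 1
  zero_above : G 0 j₁ = 0

theorem IsLead.unique {k : ℕ} {G : Matrix (Fin k) (Fin m) F} {i : Fin k} {j j' : Fin m}
    (h : IsLead G i j) (h' : IsLead G i j') : j = j' := by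
  rcases lt_trichotomy j j' with hl | hl | hl
  · exact absurd (h'.2 j hl) h.1
  · exact hl
  · exact absurd (h.2 j' hl) h'.1

theorem exists_isLead {k : ℕ} (G : Matrix (Fin k) (Fin m) F) (i : Fin k) (h : ∃ j, G i j ≠ 0) :
    ∃ j, IsLead G i j := by
  classical
  obtain ⟨j, hj⟩ := h
  obtain ⟨j', hj', hmin⟩ := (Finset.univ.filter fun j => G i j ≠ 0).exists_minimal ⟨j, by simpa⟩
  simp only [Finset.mem_filter, Finset.mem_univ, true_and] at hj' hmin
  refine ⟨j', hj', fun l hl => ?_⟩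
  by_contra hne
  exact absurd (hmin hne hl.le) (not_le.2 hl)

theorem IsRREF.exists_isEchelon {G : Matrix (Fin 2) (Fin m) F} (h : IsRREF G)
    (h1 : ∃ j, G 1 j ≠ 0) : ∃ j₀ j₁, IsEchelon G j₀ j₁ := by
  obtain ⟨j₁, hj₁⟩ := exists_isLead G 1 h1
  obtain ⟨j₀, hlt, hj₀⟩ := h.1 0 1 j₁ Fin.zero_lt_one hj₁
  exact ⟨j₀, j₁, hlt, hj₀.2, (h.2 0 j₀ hj₀).1, hj₁.2, (h.2 1 j₁ hj₁).1,
    (h.2 1 j₁ hj₁).2 0 Fin.zero_lt_one⟩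

theorem IsEchelon.isLead_left {G : Matrix (Fin 2) (Fin m) F} {j₀ j₁ : Fin m}
    (h : IsEchelon G j₀ j₁) : IsLead G 0 j₀ :=
  ⟨by rw [h.one_left]; exact one_ne_zero, h.zero_left⟩

theorem IsEchelon.isLead_right {G : Matrix (Fin 2) (Fin m) F} {j₀ j₁ : Fin m}
    (h : IsEchelon G j₀ j₁) : IsLead G 1 j₁ :=
  ⟨by rw [h.one_right]; exact one_ne_zero, h.zero_right⟩

theorem IsEchelon.isRREF {G : Matrix (Fin 2) (Fin m) F} {j₀ j₁ : Fin m}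
    (h : IsEchelon G j₀ j₁) : IsRREF G := by
  constructor
  · intro i i' j' hi hj'
    obtain ⟨rfl, rfl⟩ : i = 0 ∧ i' = 1 := by omega
    obtain rfl := h.isLead_right.unique hj'
    exact ⟨j₀, h.lt, h.isLead_left⟩
  · intro i j hj
    fin_cases i
    · obtain rfl := h.isLead_left.unique hj
      exact ⟨h.one_left, fun i' hi' => absurd hi' (Fin.not_lt_zero i')⟩
    · obtain rfl := h.isLead_right.unique hj
      refine ⟨h.one_right, fun i' hi' => ?_⟩
      obtain rfl : i' = 0 := by
        have : i' < 1 := hi'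
        omega
      exact h.zero_above

theorem mem_span_rows {G : Matrix (Fin 2) (Fin m) F} {v : Fin m → F} :
    v ∈ Submodule.span F (Set.range G.row) ↔ ∃ x y : F, v = fun j => x * G 0 j + y * G 1 j := by
  have : Set.range G.row = {G 0, G 1} := by
    ext w
    simp only [Set.mem_range, Set.mem_insert_iff, Set.mem_singleton_iff, Fin.exists_fin_two]
    constructor <;> rintro (h | h) <;> [left; right; left; right] <;> exact h.symm
  rw [this, Submodule.mem_span_pair]
  constructor
  · rintro ⟨x, y, rfl⟩; exact ⟨x, y, rfl⟩
  · rintro ⟨x, y, rfl⟩; exact ⟨x, y, rfl⟩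

theorem IsEchelon.linearIndependent {G : Matrix (Fin 2) (Fin m) F} {j₀ j₁ : Fin m}
    (h : IsEchelon G j₀ j₁) : LinearIndependent F G.row := by
  rw [Fintype.linearIndependent_iff]
  intro g hg
  have h1 := congrFun hg j₀
  have h2 := congrFun hg j₁
  simp [Matrix.row, h.one_left, h.zero_right _ h.lt, h.one_right, h.zero_above] at h1 h2
  intro i
  fin_cases i
  · exact h1
  · exact h2

theorem IsEchelon.finrank_span {G : Matrix (Fin 2) (Fin m) F} {j₀ j₁ : Fin m}
    (h : IsEchelon G j₀ j₁) : Module.finrank F (Submodule.span F (Set.range G.row)) = 2 := by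
  rw [finrank_span_eq_card h.linearIndependent, Fintype.card_fin]

theorem Represents.exists_isEchelon {G : Matrix (Fin 2) (Fin m) F}
    {L : Submodule F (Fin m → F)} (h : Represents G L) (hL : Module.finrank F L = 2) :
    ∃ j₀ j₁, IsEchelon G j₀ j₁ := by
  refine h.1.exists_isEchelon ?_
  by_contra! h0
  have : L ≤ Submodule.span F {G 0} := by
    rw [← h.2]
    intro v hv
    obtain ⟨x, y, rfl⟩ := mem_span_rows.1 hv
    refine Submodule.mem_span_singleton.2 ⟨x, ?_⟩
    ext j
    simp [h0 j]
  have h1 := Submodule.finrank_mono this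
  have h2 := finrank_span_le_card (R := F) ({G 0} : Set (Fin m → F))
  simp only [Set.toFinset_singleton, Finset.card_singleton] at h2
  omega

/-- The rows of G' are combinations of the rows of G, and the coefficients can be read off in the
pivot columns of G, where G is the identity. Comparing pivots forces the coefficient matrix to be
the identity. -/
theorem Represents.unique {G G' : Matrix (Fin 2) (Fin m) F} {L : Submodule F (Fin m → F)}
    (h : Represents G L) (h' : Represents G' L) (hL : Module.finrank F L = 2) : G = G' := by
  obtain ⟨j₀, j₁, hG⟩ := h.exists_isEchelon hL
  obtain ⟨i₀, i₁, hG'⟩ := h'.exists_isEchelon hL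
  have hmem : ∀ r, G' r ∈ Submodule.span F (Set.range G.row) := by
    intro r
    rw [h.2, ← h'.2]
    exact Submodule.subset_span ⟨r, rfl⟩
  obtain ⟨x, y, h0⟩ := mem_span_rows.1 (hmem 0)
  obtain ⟨z, w, h1⟩ := mem_span_rows.1 (hmem 1)
  have e0 : ∀ j, G' 0 j = x * G 0 j + y * G 1 j := congrFun h0
  have e1 : ∀ j, G' 1 j = z * G 0 j + w * G 1 j := congrFun h1
  have a0 : G' 0 j₀ = x := by rw [e0, hG.one_left, hG.zero_right _ hG.lt]; ring
  have a1 : G' 0 j₁ = y := by rw [e0, hG.one_right, hG.zero_above]; ring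
  have b0 : G' 1 j₀ = z := by rw [e1, hG.one_left, hG.zero_right _ hG.lt]; ring
  have b1 : G' 1 j₁ = w := by rw [e1, hG.one_right, hG.zero_above]; ring
  have hlow : ∀ (x y : F) (j : Fin m), j < j₀ → x * G 0 j + y * G 1 j = 0 := by
    intro x y j hj
    rw [hG.zero_left j hj, hG.zero_right j (hj.trans hG.lt)]; ring
  -- Otherwise the second pivot of G' is at most j₀, its first pivot lies before j₀, and there every
  -- vector of the span vanishes.
  have hz : z = 0 := by
    by_contra hz
    have hi : i₁ ≤ j₀ := by
      by_contra! hlt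
      exact hz (b0 ▸ hG'.zero_right j₀ hlt)
    have h2 := hG'.one_left
    rw [e0, hlow x y i₀ (lt_of_lt_of_le hG'.lt hi)] at h2
    exact zero_ne_one h2
  have hi1 : i₁ = j₁ := by
    have hw : w ≠ 0 := by
      rintro rfl
      have h2 := hG'.one_right
      rw [e1, hz] at h2
      simp at h2
    have hle : i₁ ≤ j₁ := by
      by_contra! hlt
      exact hw (b1 ▸ hG'.zero_right j₁ hlt)
    refine le_antisymm hle ?_
    by_contra! hlt
    have h2 := hG'.one_right
    rw [e1, hz, hG.zero_right _ hlt] at h2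
    simp at h2
  subst hi1
  have hw : w = 1 := by rw [← b1, hG'.one_right]
  have hy : y = 0 := by rw [← a1, hG'.zero_above]
  have hx0 : x ≠ 0 := by
    rintro rfl
    have h2 := hG'.one_left
    rw [e0, hy] at h2
    simp at h2
  have hi0 : i₀ = j₀ := by
    refine le_antisymm ?_ ?_
    · by_contra! hlt
      exact hx0 (a0 ▸ hG'.zero_left j₀ hlt)
    · by_contra! hlt
      have h2 := hG'.one_left
      rw [e0, hlow x y _ hlt] at h2
      exact zero_ne_one h2
  subst hi0
  have hx : x = 1 := by rw [← a0, hG'.one_left]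
  ext r j
  fin_cases r
  · change G 0 j = G' 0 j
    rw [e0, hx, hy]; ring
  · change G 1 j = G' 1 j
    rw [e1, hz, hw]; ring

/-- Take a vector of L with leftmost possible pivot j₀, then one with leftmost pivot among the
vectors of L that vanish at j₀, and clear the entry above the second pivot. -/
theorem exists_represents (L : Submodule F (Fin m → F)) (hL : Module.finrank F L = 2) :
    ∃ G, Represents G L := by
  classical
  have hmin : ∀ L' : Submodule F (Fin m → F), L' ≠ ⊥ →
      ∃ v ∈ L', ∃ j, v j = 1 ∧ ∀ w ∈ L', ∀ i < j, w i = 0 := by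
    intro L' hL'
    obtain ⟨v, hv, hv0⟩ := Submodule.exists_mem_ne_zero_of_ne_bot hL'
    obtain ⟨j, hj⟩ := Function.ne_iff.1 hv0
    obtain ⟨j', hj', hmin⟩ := (Finset.univ.filter fun j => ∃ v ∈ L', v j ≠ 0).exists_minimal
      ⟨j, by simpa using ⟨v, hv, hj⟩⟩
    simp only [Finset.mem_filter, Finset.mem_univ, true_and] at hj' hmin
    obtain ⟨u, hu, huj⟩ := hj'
    refine ⟨(u j')⁻¹ • u, L'.smul_mem _ hu, j', by simp [huj], fun w hw i hi => ?_⟩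
    by_contra hne
    exact absurd (hmin ⟨w, hw, hne⟩ hi.le) (not_le.2 hi)
  obtain ⟨v₀, hv₀, j₀, h₀, hz₀⟩ := hmin L (by rintro rfl; simp at hL)
  -- If only 0 vanished at j₀, then v would equal v j₀ • v₀ for every v in L, and L would be a line.
  obtain ⟨v₁, hv₁, j₁, h₁, hz₁⟩ := hmin (L ⊓ LinearMap.ker (LinearMap.proj (R := F) j₀)) (by
    intro hbot
    have : L ≤ Submodule.span F {v₀} := by
      intro v hv
      refine Submodule.mem_span_singleton.2 ⟨v j₀, ?_⟩
      have : v - v j₀ • v₀ ∈ L ⊓ LinearMap.ker (LinearMap.proj (R := F) j₀) :=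
        ⟨L.sub_mem hv (L.smul_mem _ hv₀), by simp [h₀]⟩
      rw [hbot, Submodule.mem_bot, sub_eq_zero] at this
      exact this.symm
    have h1 := Submodule.finrank_mono this
    have h2 := finrank_span_le_card (R := F) ({v₀} : Set (Fin m → F))
    simp only [Set.toFinset_singleton, Finset.card_singleton] at h2
    omega)
  have hv₁0 : v₁ j₀ = 0 := by simpa using hv₁.2
  have hlt : j₀ < j₁ := by
    by_contra! hle
    rcases hle.lt_or_eq with h | h
    · have := hz₀ v₁ hv₁.1 j₁ h
      rw [h₁] at this
      exact one_ne_zero this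
    · rw [h, hv₁0] at h₁
      exact zero_ne_one h₁
  let G : Matrix (Fin 2) (Fin m) F := Matrix.of ![v₀ - v₀ j₁ • v₁, v₁]
  have hG : IsEchelon G j₀ j₁ := by
    refine ⟨hlt, fun j hj => ?_, ?_, fun j hj => ?_, h₁, ?_⟩
    · simp [G, hz₀ v₀ hv₀ j hj, hz₀ v₁ hv₁.1 j hj]
    · simp [G, h₀, hv₁0]
    · exact hz₁ v₁ hv₁ j hj
    · simp [G, h₁]
  refine ⟨G, hG.isRREF, ?_⟩
  refine Submodule.eq_of_le_of_finrank_eq ?_ (by rw [hG.finrank_span, hL])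
  rw [Submodule.span_le]
  rintro _ ⟨r, rfl⟩
  fin_cases r
  · exact L.sub_mem hv₀ (L.smul_mem _ hv₁.1)
  · exact hv₁.1

end Echelon

/-! ### Representations as words -/

section Reps

variable {F : Type*}

/-- The matrix with the columns `w i`. -/
def wordMat {m : ℕ} (w : Fin m → F × F) : Matrix (Fin 2) (Fin m) F :=
  fun r i => if r = 0 then (w i).1 else (w i).2

/-- The matrix with the columns `a 0, …, a (t - 1)`. -/
def seqMat (a : ℕ → F × F) (t : ℕ) : Matrix (Fin 2) (Fin t) F := wordMat fun i => a i

theorem wordMat_injective {m : ℕ} : Function.Injective (wordMat (F := F) (m := m)) := by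
  intro w w' h
  funext i
  have h0 := congrFun (congrFun h 0) i
  have h1 := congrFun (congrFun h 1) i
  simp only [wordMat, if_true, one_ne_zero, if_false] at h0 h1
  exact Prod.ext h0 h1

theorem exists_wordMat {m : ℕ} (G : Matrix (Fin 2) (Fin m) F) : ∃ w, wordMat w = G := by
  refine ⟨fun i => (G 0 i, G 1 i), ?_⟩
  ext r i
  fin_cases r <;> rfl

theorem takeCols_wordMat {m t : ℕ} (ht : t ≤ m) (w : Fin m → F × F) (a : ℕ → F × F) :
    takeCols (wordMat w) t ht = seqMat a t ↔ ∀ i : Fin m, (i : ℕ) < t → w i = a i := by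
  constructor
  · intro h i hi
    have h0 := congrFun (congrFun h 0) ⟨i, hi⟩
    have h1 := congrFun (congrFun h 1) ⟨i, hi⟩
    simp only [takeCols, wordMat, seqMat, if_true, one_ne_zero, if_false] at h0 h1
    exact Prod.ext h0 h1
  · intro h
    ext r i
    simp only [takeCols, wordMat, seqMat]
    rw [h (Fin.castLE ht i) i.2]
    rfl

variable [Field F]

/-- `w` is the representation of a point, as a word. -/
def IsRepWord (q : ℕ) {m : ℕ} (w : Fin m → F × F) : Prop := wordMat w ∈ reps F q m

/-- A point and its reduced word determine each other, so subspaces may be replaced by words from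
here on. -/
theorem psi_eq_cnt (q : ℕ) {m t : ℕ} (ht : t ≤ m) (a : ℕ → F × F) :
    psi q ht (seqMat a t) = cnt (fun w : Fin m → F × F => IsRepWord q w) t a := by
  unfold psi cnt
  symm
  have hrep : ∀ w : {w : Fin m → F × F // IsRepWord q w ∧ ∀ i : Fin m, (i : ℕ) < t → w i = a i},
      IsPoint q (Submodule.span F (Set.range (wordMat w.1).row)) ∧
        Represents (wordMat w.1) (Submodule.span F (Set.range (wordMat w.1).row)) := by
    rintro ⟨w, ⟨L, hL, hw⟩, -⟩
    exact ⟨hw.2.symm ▸ hL, hw.1, rfl⟩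
  refine Nat.card_congr (Equiv.ofBijective (fun w =>
    ⟨Submodule.span F (Set.range (wordMat w.1).row), (hrep w).1, wordMat w.1, (hrep w).2,
      (takeCols_wordMat ht _ _).2 w.2.2⟩) ⟨?_, ?_⟩)
  · intro w w' h
    have h' := congrArg Subtype.val h
    simp only at h'
    have h1 := hrep w
    have h2 := hrep w'
    rw [← h'] at h2
    exact Subtype.ext (wordMat_injective (h1.2.unique h2.2 h1.1.1))
  · rintro ⟨L, hL, G, hG, hGa⟩
    obtain ⟨w, rfl⟩ := exists_wordMat G
    refine ⟨⟨w, ⟨L, hL, hG⟩, (takeCols_wordMat ht _ _).1 hGa⟩, ?_⟩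
    exact Subtype.ext hG.2

theorem numPoints_eq_psi (q m : ℕ) (a : ℕ → F × F) :
    numPoints F q m = psi q (Nat.zero_le m) (seqMat a 0) := by
  unfold numPoints psi
  refine Nat.card_congr (Equiv.subtypeEquivRight fun L => ⟨fun h => ⟨h, ?_⟩, fun h => h.1⟩)
  obtain ⟨G, hG⟩ := exists_represents L h.1
  exact ⟨G, hG, funext fun r => funext fun i => i.elim0⟩

theorem eta_combination [Fintype F] {q : ℕ} (hq : Fintype.card F = q ^ 2) {m : ℕ}
    (X Y : Fin m → F) (x y z w : F) :
    eta q (fun j => x * X j + y * Y j) (fun j => z * X j + w * Y j) =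
      x ^ q * z * eta q X X + x ^ q * w * eta q X Y +
        (y ^ q * z * conjHom hq (eta q X Y) + y ^ q * w * eta q Y Y) := by
  unfold eta
  simp only [map_add, map_sum, ← conjHom_apply hq, map_mul, conjHom_conjHom, mul_add,
    Finset.mul_sum, apply_dite (conjHom hq), map_zero]
  have h : ∀ a b c d a' b' c' d' e e' : F, e = a + b + (c + d) → e' = a' + b' + (c' + d') →
      e + e' = a + a' + (b + b') + (c + c' + (d + d')) := by
    rintro a b c d a' b' c' d' e e' rfl rfl; ring
  have h2 : ∀ (a b c d e : Fin (m / 2) → F), (∀ i, e i = a i + b i + (c i + d i)) →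
      ∑ i, e i = ∑ i, a i + ∑ i, b i + (∑ i, c i + ∑ i, d i) := by
    intro a b c d e h
    simp only [h, Finset.sum_add_distrib]
  refine h _ _ _ _ _ _ _ _ _ _ ?_ (h2 _ _ _ _ _ fun i => ?_)
  · split_ifs
    · ring
    · ring
  · ring

theorem IsotropicWord.combination [Fintype F] {q : ℕ} (hq : Fintype.card F = q ^ 2) {m : ℕ}
    {w : Fin m → F × F} (h : IsotropicWord q w) (x y x' y' : F) :
    eta q (fun j => x * (w j).1 + y * (w j).2) (fun j => x' * (w j).1 + y' * (w j).2) = 0 := by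
  rw [eta_combination hq (fun j => (w j).1) (fun j => (w j).2), h.1, h.2.1, h.2.2]
  simp

theorem isRepWord_iff [Fintype F] {q : ℕ} (hq : Fintype.card F = q ^ 2) {m : ℕ}
    (w : Fin m → F × F) :
    IsRepWord q w ↔ (∃ j₀ j₁, IsEchelon (wordMat w) j₀ j₁) ∧ IsotropicWord q w := by
  constructor
  · rintro ⟨L, hL, hw⟩
    have h : ∀ r r', eta q (wordMat w r) (wordMat w r') = 0 := fun r r' =>
      hL.2 _ (hw.2 ▸ Submodule.subset_span ⟨r, rfl⟩) _ (hw.2 ▸ Submodule.subset_span ⟨r', rfl⟩)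
    exact ⟨hw.exists_isEchelon hL.1, h 0 0, h 0 1, h 1 1⟩
  · rintro ⟨⟨j₀, j₁, h⟩, hI⟩
    refine ⟨_, ⟨h.finrank_span, fun v hv v' hv' => ?_⟩, h.isRREF, rfl⟩
    obtain ⟨x, y, rfl⟩ := mem_span_rows.1 hv
    obtain ⟨x', y', rfl⟩ := mem_span_rows.1 hv'
    exact hI.combination hq x y x' y'

end Reps

end HermGr

namespace HermGr

/-! ### The number of points whose representation has a given prefix -/

section Psi

variable {F : Type*} [Field F]

/-- The state of a scanner of columns that recognizes the row reduced echelon forms: `0`, `1`, `2`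
is the rank of the columns read so far, and `3` means that they are not in echelon form. -/
def rankStep [DecidableEq F] (ρ : ℕ) (c : F × F) : ℕ :=
  if ρ = 0 then
    if c.2 = 0 then if c.1 = 0 then 0 else if c.1 = 1 then 1 else 3 else 3
  else if ρ = 1 then
    if c.2 = 0 then 1 else if c.2 = 1 ∧ c.1 = 0 then 2 else 3
  else ρ

/-- The state of the scanner after `t` columns. -/
def scanRank [DecidableEq F] (a : ℕ → F × F) : ℕ → ℕ
  | 0 => 0
  | t + 1 => rankStep (scanRank a t) (a t)

/-- State 3 is absorbing and carries no information; each of the other states yields exactly the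
pivots that the later counts need. -/
theorem scanRank_spec [DecidableEq F] (a : ℕ → F × F) (t : ℕ) :
    (scanRank a t = 0 ∧ ∀ i < t, a i = (0, 0)) ∨
    (scanRank a t = 1 ∧ (∀ i < t, (a i).2 = 0) ∧
      ∃ j₀ < t, (∀ i < j₀, (a i).1 = 0) ∧ (a j₀).1 = 1) ∨
    (scanRank a t = 2 ∧ ∃ j₀ j₁, j₀ < j₁ ∧ j₁ < t ∧ (∀ i < j₀, (a i).1 = 0) ∧ (a j₀).1 = 1 ∧
      (∀ i < j₁, (a i).2 = 0) ∧ (a j₁).2 = 1 ∧ (a j₁).1 = 0) ∨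
    scanRank a t = 3 := by
  induction t with
  | zero => simp [scanRank]
  | succ t ih =>
    rcases ih with ⟨h, h0⟩ | ⟨h, h1, j₀, hj₀, h2, h3⟩ | ⟨h, j₀, j₁, hlt, hj₁, h2⟩ | h
    · simp only [scanRank, rankStep, h, if_true]
      split_ifs with hb ha ha'
      · left
        refine ⟨rfl, fun i hi => ?_⟩
        rcases Nat.lt_succ_iff_lt_or_eq.1 hi with hi | rfl
        · exact h0 i hi
        · exact Prod.ext ha hb
      · right; left
        refine ⟨rfl, fun i hi => ?_, t, by omega, fun i hi => by rw [h0 i hi], ha'⟩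
        rcases Nat.lt_succ_iff_lt_or_eq.1 hi with hi | rfl
        · rw [h0 i hi]
        · exact hb
      · simp
      · simp
    · simp only [scanRank, rankStep, h, one_ne_zero, if_true, if_false]
      split_ifs with hb ha
      · right; left
        refine ⟨rfl, fun i hi => ?_, j₀, by omega, h2, h3⟩
        rcases Nat.lt_succ_iff_lt_or_eq.1 hi with hi | rfl
        · exact h1 i hi
        · exact hb
      · right; right; left
        exact ⟨rfl, j₀, t, hj₀, by omega, h2, h3, h1, ha.1, ha.2⟩
      · simp
    · right; right; left
      refine ⟨by simp [scanRank, rankStep, h], j₀, j₁, hlt, by omega, h2⟩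
    · right; right; right
      simp [scanRank, rankStep, h]

/-- In particular a prefix in state 3 has no reduced completion of rank two. -/
theorem IsEchelon.scanRank_eq [DecidableEq F] {m : ℕ} {w : Fin m → F × F} {j₀ j₁ : Fin m}
    (h : IsEchelon (wordMat w) j₀ j₁) (a : ℕ → F × F) {t : ℕ} (ht : t ≤ m)
    (hw : ∀ i : Fin m, (i : ℕ) < t → w i = a i) :
    scanRank a t = if t ≤ j₀ then 0 else if t ≤ j₁ then 1 else 2 := by
  have hlt : (j₀ : ℕ) < j₁ := h.lt
  induction t with
  | zero => simp [scanRank]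
  | succ t ih =>
    have hat := hw ⟨t, by omega⟩ (by simp)
    have h1 : ∀ j : Fin m, wordMat w 0 j = (w j).1 := fun j => rfl
    have h2 : ∀ j : Fin m, wordMat w 1 j = (w j).2 := fun j => rfl
    rw [scanRank, ih (by omega) (fun i hi => hw i (by omega)), ← hat]
    rcases lt_trichotomy t (j₀ : ℕ) with hl | hl | hl
    · have e1 := h.zero_left ⟨t, by omega⟩ hl
      have e2 := h.zero_right ⟨t, by omega⟩ (show t < (j₁ : ℕ) by omega)
      rw [h1] at e1
      rw [h2] at e2
      simp [rankStep, e1, e2, hl.le, Nat.succ_le_of_lt hl]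
    · have e1 := h.one_left
      have e2 := h.zero_right j₀ h.lt
      rw [h1] at e1
      rw [h2] at e2
      have : (⟨t, by omega⟩ : Fin m) = j₀ := Fin.ext hl
      rw [this]
      simp [rankStep, e1, e2, hl, hlt]
    · rcases lt_trichotomy t (j₁ : ℕ) with hk | hk | hk
      · have e2 := h.zero_right ⟨t, by omega⟩ hk
        rw [h2] at e2
        simp only [if_neg (not_le.2 hl), if_pos hk.le, if_neg (show ¬ t + 1 ≤ (j₀ : ℕ) by omega),
          if_pos (show t + 1 ≤ (j₁ : ℕ) by omega)]
        simp [rankStep, e2]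
      · have e1 := h.zero_above
        have e2 := h.one_right
        rw [h1] at e1
        rw [h2] at e2
        have : (⟨t, by omega⟩ : Fin m) = j₁ := Fin.ext hk
        rw [this]
        simp only [if_neg (not_le.2 hl), if_pos hk.le, if_neg (show ¬ t + 1 ≤ (j₀ : ℕ) by omega),
          if_neg (show ¬ t + 1 ≤ (j₁ : ℕ) by omega)]
        simp [rankStep, e1, e2]
      · simp only [if_neg (not_le.2 hl), if_neg (not_le.2 hk),
          if_neg (show ¬ t + 1 ≤ (j₀ : ℕ) by omega), if_neg (show ¬ t + 1 ≤ (j₁ : ℕ) by omega)]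
        simp [rankStep]

/-- The isotropic words with a given beginning, whose second row is zero. -/
theorem card_snd_eq_zero (q : ℕ) {m t : ℕ} (a : ℕ → F × F)
    (ha : ∀ i < t, (a i).2 = 0) :
    Nat.card {w : Fin m → F × F // (IsotropicWord q w ∧ ∀ i : Fin m, (i : ℕ) < t → w i = a i) ∧
      ∀ i, (w i).2 = 0} = cnt (fun w : Fin m → F => eta q w w = 0) t (fun i => (a i).1) := by
  unfold cnt
  have h0 : ∀ X : Fin m → F, eta q X (fun _ => 0) = 0 := by
    intro X; simp [eta]
  refine Nat.card_congr ⟨fun w => ⟨fun i => (w.1 i).1, w.2.1.1.1, fun i hi =>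
    congrArg Prod.fst (w.2.1.2 i hi)⟩, fun w => ⟨fun i => (w.1 i, 0), ⟨⟨w.2.1, h0 _, h0 _⟩, fun i hi =>
      Prod.ext (w.2.2 i hi) (ha i hi).symm⟩, fun i => rfl⟩, ?_, ?_⟩
  · rintro ⟨w, h1, h2⟩
    refine Subtype.ext (funext fun i => Prod.ext rfl (h2 i).symm)
  · rintro ⟨w, h⟩
    rfl

theorem takeCols_eq_zero_iff {m t : ℕ} (ht : t ≤ m) (a : ℕ → F × F) (ha : ∀ i < t, a i = (0, 0))
    {L : Submodule F (Fin m → F)} (hL : Module.finrank F L = 2) :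
    (∃ G, Represents G L ∧ takeCols G t ht = seqMat a t) ↔
      ∀ v ∈ L, ∀ i : Fin m, (i : ℕ) < t → v i = 0 := by
  have hz : seqMat a t = 0 := by
    ext r i
    simp [seqMat, wordMat, ha i i.2]
  rw [hz]
  constructor
  · rintro ⟨G, hG, hGt⟩ v hv i hi
    rw [← hG.2] at hv
    obtain ⟨x, y, rfl⟩ := mem_span_rows.1 hv
    have h0 : G 0 i = 0 := congrFun (congrFun hGt 0) ⟨i, hi⟩
    have h1 : G 1 i = 0 := congrFun (congrFun hGt 1) ⟨i, hi⟩
    simp [h0, h1]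
  · intro h
    obtain ⟨G, hG⟩ := exists_represents L hL
    refine ⟨G, hG, ?_⟩
    ext r i
    exact h (G r) (hG.2 ▸ Submodule.subset_span ⟨r, rfl⟩) (Fin.castLE ht i) i.2

theorem isPoint_span_rows [Fintype F] {q : ℕ} (hq : Fintype.card F = q ^ 2) {m : ℕ} {w : Fin m → F × F}
    (hI : IsotropicWord q w) (hw : LinearIndependent F (wordMat w).row) :
    IsPoint q (Submodule.span F (Set.range (wordMat w).row)) := by
  refine ⟨by rw [finrank_span_eq_card hw, Fintype.card_fin], fun v hv v' hv' => ?_⟩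
  obtain ⟨x, y, rfl⟩ := mem_span_rows.1 hv
  obtain ⟨x', y', rfl⟩ := mem_span_rows.1 hv'
  exact hI.combination hq x y x' y'

theorem card_linearIndependent_pairs [Fintype F] {q : ℕ} (hq : Fintype.card F = q ^ 2) {m : ℕ}
    (L : Submodule F (Fin m → F)) (hL : Module.finrank F L = 2) :
    Nat.card {s : Fin 2 → L // LinearIndependent F s} = (q ^ 4 - 1) * (q ^ 4 - q ^ 2) := by
  rw [card_linearIndependent (K := F) (V := L) hL.ge, hL, hq]
  simp [Fin.prod_univ_two, ← pow_mul]

/-- The isotropic words of rank `2` that begin with zeros are the ordered bases of the points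
whose representation begins with zeros. -/
theorem card_linearIndependent_words [Fintype F] {q : ℕ} (hq : Fintype.card F = q ^ 2) {m t : ℕ} (ht : t ≤ m)
    (a : ℕ → F × F) (ha : ∀ i < t, a i = (0, 0)) :
    Nat.card {w : Fin m → F × F // (IsotropicWord q w ∧ ∀ i : Fin m, (i : ℕ) < t → w i = a i) ∧
      LinearIndependent F (wordMat w).row} =
      psi q ht (seqMat a t) * ((q ^ 4 - 1) * (q ^ 4 - q ^ 2)) := by
  unfold psi
  have : Finite (Submodule F (Fin m → F)) := Finite.of_injective _ SetLike.coe_injective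
  let S := {w : Fin m → F × F // (IsotropicWord q w ∧ ∀ i : Fin m, (i : ℕ) < t → w i = a i) ∧
      LinearIndependent F (wordMat w).row}
  let T := {L : Submodule F (Fin m → F) //
    IsPoint q L ∧ ∃ G, Represents G L ∧ takeCols G t ht = seqMat a t}
  have hrow : ∀ w : Fin m → F × F, (∀ i : Fin m, (i : ℕ) < t → w i = a i) ↔
      ∀ v ∈ Submodule.span F (Set.range (wordMat w).row), ∀ i : Fin m, (i : ℕ) < t → v i = 0 := by
    intro w
    constructor
    · intro h v hv i hi
      obtain ⟨x, y, rfl⟩ := mem_span_rows.1 hv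
      simp [wordMat, h i hi, ha i hi]
    · intro h i hi
      rw [ha i hi]
      exact Prod.ext (h _ (Submodule.subset_span ⟨0, rfl⟩) i hi)
        (h _ (Submodule.subset_span ⟨1, rfl⟩) i hi)
  let f : S → T := fun w => ⟨Submodule.span F (Set.range (wordMat w.1).row),
    isPoint_span_rows hq w.2.1.1 w.2.2, (takeCols_eq_zero_iff ht a ha
      (isPoint_span_rows hq w.2.1.1 w.2.2).1).2 ((hrow w.1).1 w.2.1.2)⟩
  -- The fibre over L is the set of ordered bases of L; the zero prefix and isotropy are inherited
  -- from L.
  have hfib : ∀ L : T, Nat.card {w : S // f w = L} = (q ^ 4 - 1) * (q ^ 4 - q ^ 2) := by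
    intro L
    rw [← card_linearIndependent_pairs hq L.1 L.2.1.1]
    have hrange : ∀ w : S, f w = L → ∀ r, (wordMat w.1).row r ∈ L.1 := by
      rintro w rfl r
      exact Submodule.subset_span ⟨r, rfl⟩
    refine Nat.card_congr (Equiv.ofBijective (fun w =>
      ⟨fun r => ⟨(wordMat w.1.1).row r, hrange w.1 w.2 r⟩, ?_⟩) ⟨?_, ?_⟩)
    · exact LinearIndependent.of_comp L.1.subtype w.1.2.2
    · intro w w' h
      have h1 := congrArg Subtype.val h
      refine Subtype.ext (Subtype.ext (wordMat_injective ?_))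
      ext r i
      exact congrFun (congrArg Subtype.val (congrFun h1 r)) i
    · rintro ⟨s, hs⟩
      obtain ⟨w, hw⟩ := exists_wordMat (Matrix.of fun r => (s r : Fin m → F))
      have hw' : (wordMat w).row = fun r => (s r : Fin m → F) := by rw [hw]; rfl
      have hli : LinearIndependent F (wordMat w).row := by
        rw [hw']
        exact hs.map' L.1.subtype (Submodule.ker_subtype _)
      have hspan : Submodule.span F (Set.range (wordMat w).row) = L.1 := by
        refine Submodule.eq_of_le_of_finrank_eq ?_ ?_
        · rw [Submodule.span_le, hw']
          rintro _ ⟨r, rfl⟩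
          exact (s r).2
        · rw [finrank_span_eq_card hli, Fintype.card_fin, L.2.1.1]
      have hI : IsotropicWord q w := by
        have h : ∀ r r', eta q (wordMat w r) (wordMat w r') = 0 := fun r r' =>
          L.2.1.2 _ (hspan ▸ Submodule.subset_span ⟨r, rfl⟩) _
            (hspan ▸ Submodule.subset_span ⟨r', rfl⟩)
        exact ⟨h 0 0, h 0 1, h 1 1⟩
      have hwa : ∀ i : Fin m, (i : ℕ) < t → w i = a i := by
        rw [hrow, hspan]
        exact (takeCols_eq_zero_iff ht a ha L.2.1.1).1 L.2.2
      refine ⟨⟨⟨w, ⟨hI, hwa⟩, hli⟩, Subtype.ext hspan⟩, ?_⟩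
      exact Subtype.ext (funext fun r => Subtype.ext (congrFun hw' r))
  have := Fintype.ofFinite T
  change Nat.card S = Nat.card T * _
  rw [← Nat.card_congr (Equiv.sigmaFiberEquiv f), Nat.card_sigma, Finset.sum_congr rfl fun L _ =>
    hfib L, Finset.sum_const, Finset.card_univ, Nat.card_eq_fintype_card, smul_eq_mul]

/-! ### Comparison of points with isotropic pairs, by the rank of the prefix -/

variable [Fintype F] [DecidableEq F] {q : ℕ}

/-- Being reduced of rank two is a condition on the columns up to the second pivot only, so it holds
for all completions. -/
theorem cnt_isRepWord_of_rank_two (hq : Fintype.card F = q ^ 2) {m t : ℕ} (ht : t ≤ m)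
    (a : ℕ → F × F) (h : scanRank a t = 2) :
    cnt (fun w : Fin m → F × F => IsRepWord q w) t a =
      cnt (fun w : Fin m → F × F => IsotropicWord q w) t a := by
  obtain ⟨h', -⟩ | ⟨h', -⟩ | ⟨-, j₀, j₁, hlt, hj₁, h1, h2, h3, h4, h5⟩ | h' := scanRank_spec a t
  · omega
  · omega
  · refine Nat.card_congr (Equiv.subtypeEquivRight fun w => ?_)
    simp only [isRepWord_iff hq]
    refine ⟨fun h => ⟨h.1.2, h.2⟩, fun h => ⟨⟨⟨⟨j₀, by omega⟩, ⟨j₁, by omega⟩, ?_⟩, h.1⟩, h.2⟩⟩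
    have hw : ∀ (i : Fin m) (r : Fin 2), (i : ℕ) < t → wordMat w r i =
        if r = 0 then (a i).1 else (a i).2 := by
      intro i r hi
      rw [wordMat, h.2 i hi]
    refine ⟨hlt, fun j hj => ?_, ?_, fun j hj => ?_, ?_, ?_⟩
    · have hj : (j : ℕ) < j₀ := hj
      rw [hw _ _ (by omega), if_pos rfl, h1 _ hj]
    · rw [hw _ _ (show j₀ < t by omega), if_pos rfl, h2]
    · have hj : (j : ℕ) < j₁ := hj
      rw [hw _ _ (by omega), if_neg one_ne_zero, h3 _ hj]
    · rw [hw _ _ hj₁, if_neg one_ne_zero, h4]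
    · rw [hw _ _ hj₁, if_pos rfl, h5]
  · omega

theorem cnt_isRepWord_of_rank_three (hq : Fintype.card F = q ^ 2) {m t : ℕ} (ht : t ≤ m)
    (a : ℕ → F × F) (h : scanRank a t = 3) :
    cnt (fun w : Fin m → F × F => IsRepWord q w) t a = 0 := by
  unfold cnt
  rw [Nat.card_eq_zero]
  left
  refine ⟨?_⟩
  rintro ⟨w, hw, hwa⟩
  obtain ⟨⟨j₀, j₁, hE⟩, -⟩ := (isRepWord_iff hq w).1 hw
  have := hE.scanRank_eq a ht hwa
  split_ifs at this <;> omega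

theorem cnt_eq_add {A : Type*} [Finite A] {m : ℕ} (P R : (Fin m → A) → Prop) (t : ℕ) (a : ℕ → A) :
    cnt P t a =
      Nat.card {w : Fin m → A // (P w ∧ ∀ i : Fin m, (i : ℕ) < t → w i = a i) ∧ R w} +
      Nat.card {w : Fin m → A // (P w ∧ ∀ i : Fin m, (i : ℕ) < t → w i = a i) ∧ ¬ R w} := by
  classical
  have := Fintype.ofFinite A
  unfold cnt
  simp only [Nat.card_eq_fintype_card, Fintype.card_subtype]
  rw [← Finset.card_filter_add_card_filter_not (fun w => R w), Finset.filter_filter,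
    Finset.filter_filter]

theorem card_nonzero (hq : Fintype.card F = q ^ 2) : Nat.card {x : F // x ≠ 0} = q ^ 2 - 1 := by
  rw [Nat.card_eq_fintype_card, Fintype.card_subtype_compl, hq]
  simp

/-- Pairs with second row zero are isotropic vectors. Any other pair is (X + μY, λY) for exactly one
reduced word (X, Y), one λ ≠ 0 and one μ. As Y vanishes on the prefix, these row operations do not
affect it. -/
theorem cnt_isRepWord_of_rank_one (hq : Fintype.card F = q ^ 2) {m t : ℕ}
    (a : ℕ → F × F) (h : scanRank a t = 1) :
    cnt (fun w : Fin m → F × F => IsotropicWord q w) t a =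
      cnt (fun w : Fin m → F => eta q w w = 0) t (fun i => (a i).1) +
      cnt (fun w : Fin m → F × F => IsRepWord q w) t a * ((q ^ 2 - 1) * q ^ 2) := by
  obtain ⟨h', -⟩ | ⟨-, hz, j₀, hj₀, h1, h2⟩ | ⟨h', -⟩ | h' := scanRank_spec a t
  · omega
  · rw [cnt_eq_add _ (fun w : Fin m → F × F => ∀ i, (w i).2 = 0), card_snd_eq_zero q a hz]
    congr 1
    have hF : Nat.card F = q ^ 2 := by rw [Nat.card_eq_fintype_card, hq]
    rw [← card_nonzero hq, ← hF]
    unfold cnt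
    rw [← Nat.card_prod, ← Nat.card_prod]
    symm
    have hmat : ∀ (w : Fin m → F × F) (i : Fin m),
        wordMat w 0 i = (w i).1 ∧ wordMat w 1 i = (w i).2 := fun _ _ => ⟨rfl, rfl⟩
    refine Nat.card_congr (Equiv.ofBijective (fun p =>
      ⟨fun i => (1 * (p.1.1 i).1 + p.2.2 * (p.1.1 i).2, 0 * (p.1.1 i).1 + p.2.1.1 * (p.1.1 i).2),
        ⟨?_, ?_⟩, ?_⟩) ⟨?_, ?_⟩)
    · have hI := ((isRepWord_iff hq _).1 p.1.2.1).2
      exact ⟨hI.combination hq _ _ _ _, hI.combination hq _ _ _ _, hI.combination hq _ _ _ _⟩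
    · intro i hi
      have := p.1.2.2 i hi
      simp only [this, hz i hi]
      exact Prod.ext (by simp) (by simp [hz i hi])
    · obtain ⟨⟨i₀, i₁, hE⟩, -⟩ := (isRepWord_iff hq _).1 p.1.2.1
      intro h0
      have e := hE.one_right
      rw [(hmat _ _).2] at e
      have := h0 i₁
      simp only [e] at this
      exact p.2.1.2 (by simpa using this)
    · rintro ⟨⟨w, hw, hwa⟩, ⟨l, hl⟩, μ⟩ ⟨⟨w', hw', hwa'⟩, ⟨l', hl'⟩, μ'⟩ heq
      obtain ⟨⟨i₀, i₁, hE⟩, -⟩ := (isRepWord_iff hq _).1 hw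
      obtain ⟨⟨i₀', i₁', hE'⟩, -⟩ := (isRepWord_iff hq _).1 hw'
      have heq' := congrArg Subtype.val heq
      simp only at heq'
      have e1 : ∀ i, (w i).1 + μ * (w i).2 = (w' i).1 + μ' * (w' i).2 := by
        intro i
        simpa using congrArg Prod.fst (congrFun heq' i)
      have e2 : ∀ i, l * (w i).2 = l' * (w' i).2 := by
        intro i
        simpa using congrArg Prod.snd (congrFun heq' i)
      -- The second rows are proportional, so their pivots agree; evaluating both rows at this
      -- pivot, where the column is (0, 1), recovers μ and λ.
      have hi : i₁ = i₁' := by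
        refine hE.isLead_right.unique ⟨?_, fun j hj => ?_⟩
        · intro h0
          have h3 := e2 i₁'
          have h4 : (w i₁').2 = 0 := h0
          have h5 : (w' i₁').2 = 1 := hE'.one_right
          rw [h4, h5] at h3
          simp at h3
          exact hl' h3.symm
        · have h3 := e2 j
          have h5 : (w' j).2 = 0 := hE'.zero_right j hj
          rw [h5] at h3
          rw [(hmat _ _).2]
          simpa [hl] using h3
      subst hi
      have f1 : (w i₁).2 = 1 := hE.one_right
      have f1' : (w' i₁).2 = 1 := hE'.one_right
      have f0 : (w i₁).1 = 0 := hE.zero_above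
      have f0' : (w' i₁).1 = 0 := hE'.zero_above
      have hll : l = l' := by
        have := e2 i₁
        rw [f1, f1'] at this
        simpa using this
      have hμ : μ = μ' := by
        have := e1 i₁
        rw [f1, f1', f0, f0'] at this
        simpa using this
      subst hll hμ
      have e3 : ∀ i, (w i).2 = (w' i).2 := fun i => mul_left_cancel₀ hl (e2 i)
      have : w = w' := by
        funext i
        refine Prod.ext ?_ (e3 i)
        have := e1 i
        rw [e3] at this
        exact add_right_cancel this
      subst this
      rfl
    · rintro ⟨v, ⟨hI, hva⟩, hv⟩
      obtain ⟨j₁, hj₁⟩ := exists_isLead (wordMat v) 1 (not_forall.1 hv)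
      have hne : (v j₁).2 ≠ 0 := hj₁.1
      have hz1 : ∀ j < j₁, (v j).2 = 0 := hj₁.2
      -- The second pivot lies beyond the prefix, hence to the right of j₀.
      have htj : t ≤ (j₁ : ℕ) := by
        by_contra! hlt
        exact hne (by rw [hva j₁ hlt, hz _ hlt])
      let w : Fin m → F × F := fun i =>
        (1 * (v i).1 + (-(v j₁).1 * (v j₁).2⁻¹) * (v i).2, 0 * (v i).1 + (v j₁).2⁻¹ * (v i).2)
      have hwI : IsotropicWord q w :=
        ⟨hI.combination hq _ _ _ _, hI.combination hq _ _ _ _, hI.combination hq _ _ _ _⟩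
      have hwa : ∀ i : Fin m, (i : ℕ) < t → w i = a i := by
        intro i hi
        simp only [w, hva i hi, hz i hi]
        exact Prod.ext (by simp) (by simp [hz i hi])
      have hE : IsEchelon (wordMat w) ⟨j₀, by omega⟩ j₁ := by
        refine ⟨?_, fun j hj => ?_, ?_, fun j hj => ?_, ?_, ?_⟩
        · exact Fin.lt_def.2 (lt_of_lt_of_le hj₀ htj)
        · have hj : (j : ℕ) < j₀ := hj
          rw [(hmat _ _).1, hwa j (by omega), h1 _ hj]
        · rw [(hmat _ _).1, hwa _ hj₀, h2]
        · simp [wordMat, w, hz1 j hj]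
        · simp [wordMat, w, hne]
        · simp [wordMat, w, hne]
      refine ⟨⟨⟨w, (isRepWord_iff hq w).2 ⟨⟨_, _, hE⟩, hwI⟩, hwa⟩, ⟨(v j₁).2, hne⟩, (v j₁).1⟩, ?_⟩
      refine Subtype.ext (funext fun i => Prod.ext ?_ ?_)
      · simp only [w]
        ring
      · simp only [w]
        field_simp
        ring
  · omega
  · omega

/-- Independent pairs are ordered bases of points. With v isotropic vectors, the dependent pairs are
v with Y = 0 and (v-1)q² of the form (μY, Y) with Y ≠ 0, together v(q²+1) - q². The q² is moved to
the left to avoid subtraction. -/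
theorem cnt_isRepWord_of_rank_zero (hq : Fintype.card F = q ^ 2) {m t : ℕ} (ht : t ≤ m)
    (a : ℕ → F × F) (h : scanRank a t = 0) :
    cnt (fun w : Fin m → F × F => IsotropicWord q w) t a + q ^ 2 =
      cnt (fun w : Fin m → F => eta q w w = 0) t (fun i => (a i).1) * (q ^ 2 + 1) +
      cnt (fun w : Fin m → F × F => IsRepWord q w) t a * ((q ^ 4 - 1) * (q ^ 4 - q ^ 2)) := by
  have hq0 : q ≠ 0 := by have := one_lt_of_card hq; omega
  obtain ⟨-, hz⟩ | ⟨h', -⟩ | ⟨h', -⟩ | h' := scanRank_spec a t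
  · rw [← psi_eq_cnt q ht, ← card_linearIndependent_words hq ht a hz,
      cnt_eq_add _ (fun w : Fin m → F × F => LinearIndependent F (wordMat w).row)]
    have hsplit : Nat.card {w : Fin m → F × F // (IsotropicWord q w ∧
          ∀ i : Fin m, (i : ℕ) < t → w i = a i) ∧ ¬ LinearIndependent F (wordMat w).row} =
        cnt (fun w : Fin m → F × F => IsotropicWord q w ∧
          ¬ LinearIndependent F (wordMat w).row) t a := by
      unfold cnt
      refine Nat.card_congr (Equiv.subtypeEquivRight fun w => ?_)
      tauto
    have hli : ∀ w : Fin m → F × F, (∀ i, (w i).2 = 0) →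
        ¬ LinearIndependent F (wordMat w).row := by
      intro w h0 hw
      exact hw.ne_zero 1 (funext h0)
    have h1 : Nat.card {w : Fin m → F × F // ((IsotropicWord q w ∧
        ¬ LinearIndependent F (wordMat w).row) ∧ ∀ i : Fin m, (i : ℕ) < t → w i = a i) ∧
        ∀ i, (w i).2 = 0} =
        cnt (fun w : Fin m → F => eta q w w = 0) t (fun i => (a i).1) := by
      rw [← card_snd_eq_zero q a (fun i hi => by rw [hz i hi])]
      refine Nat.card_congr (Equiv.subtypeEquivRight fun w => ?_)
      have := hli w
      tauto
    have h2 : Nat.card {w : Fin m → F × F // ((IsotropicWord q w ∧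
        ¬ LinearIndependent F (wordMat w).row) ∧ ∀ i : Fin m, (i : ℕ) < t → w i = a i) ∧
        ¬ ∀ i, (w i).2 = 0} =
        Nat.card {v : Fin m → F // (eta q v v = 0 ∧ ∀ i : Fin m, (i : ℕ) < t → v i = (a i).1) ∧
          ¬ v = 0} * q ^ 2 := by
      have hF : Nat.card F = q ^ 2 := by rw [Nat.card_eq_fintype_card, hq]
      rw [← hF, ← Nat.card_prod]
      symm
      refine Nat.card_congr (Equiv.ofBijective (fun p =>
        ⟨fun i => (p.2 * p.1.1 i, p.1.1 i), ⟨⟨?_, ?_⟩, ?_⟩, ?_⟩) ⟨?_, ?_⟩)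
      · have hc : ∀ x y : F, eta q (fun i => x * p.1.1 i) (fun i => y * p.1.1 i) = 0 := by
          intro x y
          have h3 := eta_combination hq p.1.1 p.1.1 x 0 y 0
          rw [p.1.2.1.1] at h3
          simpa using h3
        exact ⟨hc _ _, by simpa using hc p.2 1, p.1.2.1.1⟩
      · intro hw
        rw [Fintype.linearIndependent_iff] at hw
        have := hw ![1, -p.2] (by
          rw [Fin.sum_univ_two]
          ext i
          simp [wordMat, Matrix.row]) 0
        exact one_ne_zero this
      · intro i hi
        have h3 := p.1.2.1.2 i hi
        rw [hz i hi] at h3 ⊢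
        exact Prod.ext (by simp [h3]) h3
      · exact fun h0 => p.1.2.2 (funext h0)
      · rintro ⟨⟨v, h3, hv⟩, μ⟩ ⟨⟨v', h3', hv'⟩, μ'⟩ heq
        have heq' := congrArg Subtype.val heq
        have hvv : v = v' := funext fun i => congrArg Prod.snd (congrFun heq' i)
        subst hvv
        obtain ⟨i, hi⟩ := Function.ne_iff.1 hv
        have : μ * v i = μ' * v i := congrArg Prod.fst (congrFun heq' i)
        rw [mul_right_cancel₀ hi this]
      · rintro ⟨w, ⟨⟨hI, hw⟩, hwa⟩, h0⟩
        have hdep : ∃ μ : F, ∀ i, (w i).1 = μ * (w i).2 := by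
          rw [Fintype.not_linearIndependent_iff] at hw
          obtain ⟨g, hg, hg0⟩ := hw
          have hg' : ∀ i, g 0 * (w i).1 + g 1 * (w i).2 = 0 := by
            intro i
            have := congrFun hg i
            rw [Fin.sum_univ_two] at this
            simpa [wordMat, Matrix.row] using this
          have hg00 : g 0 ≠ 0 := by
            intro h00
            rw [Fin.exists_fin_two] at hg0
            have hg1 : g 1 ≠ 0 := hg0.resolve_left (fun h => h h00)
            refine h0 fun i => ?_
            have := hg' i
            rw [h00] at this
            simpa [hg1] using this
          refine ⟨-(g 1) * (g 0)⁻¹, fun i => ?_⟩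
          field_simp
          linear_combination hg' i
        obtain ⟨μ, hμ⟩ := hdep
        refine ⟨⟨⟨fun i => (w i).2, ⟨hI.2.2, fun i hi => ?_⟩, fun h => h0 (congrFun h)⟩, μ⟩, ?_⟩
        · simp only [hwa i hi, hz i hi]
        · exact Subtype.ext (funext fun i => Prod.ext (hμ i).symm rfl)
    have h3 := cnt_eq_add (fun w : Fin m → F => eta q w w = 0) (fun v => v = 0) t
      (fun i => (a i).1)
    have h4 : Nat.card {v : Fin m → F // (eta q v v = 0 ∧
        ∀ i : Fin m, (i : ℕ) < t → v i = (a i).1) ∧ v = 0} = 1 := by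
      rw [Nat.card_eq_one_iff_unique]
      refine ⟨⟨fun v v' => Subtype.ext (v.2.2.trans v'.2.2.symm)⟩,
        ⟨0, ⟨?_, fun i hi => ?_⟩, rfl⟩⟩
      · simp [eta]
      · rw [hz i hi]; rfl
    rw [hsplit, cnt_eq_add _ (fun w : Fin m → F × F => ∀ i, (w i).2 = 0), h1, h2]
    rw [h4] at h3
    rw [h3]
    ring
  · omega
  · omega
  · omega

/-- The number of points whose representation begins with `a 0, …, a (t - 1)`. -/
def psiCount (q m t : ℕ) (a : ℕ → F × F) : ℕ :=
  if scanRank a t = 0 then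
    (pairCount q m t a + q ^ 2 - vecCount q m t (fun i => (a i).1) * (q ^ 2 + 1)) /
      ((q ^ 4 - 1) * (q ^ 4 - q ^ 2))
  else if scanRank a t = 1 then
    (pairCount q m t a - vecCount q m t (fun i => (a i).1)) / ((q ^ 2 - 1) * q ^ 2)
  else if scanRank a t = 2 then pairCount q m t a
  else 0

/-- The three rank relations show that the truncated subtractions and the divisions in `psiCount`
are exact. -/
theorem psi_eq_psiCount (hq : Fintype.card F = q ^ 2) {m t : ℕ} (ht : t ≤ m) (a : ℕ → F × F) :
    psi q ht (seqMat a t) = psiCount q m t a := by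
  have hq1 := one_lt_of_card hq
  have h2 : 1 < q ^ 2 := Nat.one_lt_pow two_ne_zero hq1
  have h4 : q ^ 2 < q ^ 4 := Nat.pow_lt_pow_right hq1 (by norm_num)
  unfold psiCount
  rw [psi_eq_cnt, ← cnt_isotropicWord hq m (m - t) t a (by omega), ← cnt_isotropic hq ht]
  split_ifs with h h' h''
  · rw [cnt_isRepWord_of_rank_zero hq ht a h, Nat.add_sub_cancel_left, Nat.mul_div_cancel]
    exact Nat.mul_pos (by omega) (by omega)
  · rw [cnt_isRepWord_of_rank_one hq a h', Nat.add_sub_cancel_left, Nat.mul_div_cancel]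
    exact Nat.mul_pos (by omega) (by omega)
  · rw [cnt_isRepWord_of_rank_two hq ht a h'']
  · refine cnt_isRepWord_of_rank_three hq ht a ?_
    have := scanRank_spec a t
    tauto

end Psi

end HermGr

namespace HermGr

/-! ### Enumerating words by their prefixes -/

section Enumeration

variable {A : Type*} {m : ℕ}

theorem cnt_congr (P : (Fin m → A) → Prop) {t : ℕ} {a a' : ℕ → A} (h : ∀ i < t, a i = a' i) :
    cnt P t a = cnt P t a' := by
  refine Nat.card_congr (Equiv.subtypeEquivRight fun w => and_congr_right fun _ => ?_)
  refine forall_congr' fun i => forall_congr' fun hi => ?_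
  rw [h i hi]

/-- `letter` lists the elements of `A`, and `idx` gives the position of an element. -/
structure IsListing (K : ℕ) (letter : ℕ → A) (idx : A → ℕ) : Prop where
  idx_lt : ∀ c, idx c < K
  letter_idx : ∀ c, letter (idx c) = c
  idx_letter : ∀ e < K, idx (letter e) = e

theorem IsListing.sum_eq [Fintype A] {K : ℕ} {letter : ℕ → A} {idx : A → ℕ}
    (h : IsListing K letter idx) (g : A → ℕ) :
    ∑ c, g c = ∑ e ∈ Finset.range K, g (letter e) := by
  refine Finset.sum_bij' (fun c _ => idx c) (fun e _ => letter e) ?_ ?_ ?_ ?_ ?_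
  · intro c _; simpa using h.idx_lt c
  · intro e _; exact Finset.mem_univ _
  · intro c _; exact h.letter_idx c
  · intro e he; exact h.idx_letter e (by simpa using he)
  · intro c _; rw [h.letter_idx]

theorem IsListing.sum_filter_eq [Fintype A] {K : ℕ} {letter : ℕ → A} {idx : A → ℕ}
    (h : IsListing K letter idx) (n : ℕ) (hn : n ≤ K) (g : A → ℕ) :
    ∑ c with idx c < n, g c = ∑ e ∈ Finset.range n, g (letter e) := by
  rw [Finset.sum_filter, h.sum_eq, ← Finset.sum_filter]
  refine Finset.sum_congr ?_ fun _ _ => rfl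
  ext e
  simp only [Finset.mem_filter, Finset.mem_range]
  constructor
  · rintro ⟨h1, h2⟩
    rwa [h.idx_letter e h1] at h2
  · intro h1
    exact ⟨h1.trans_le hn, by rwa [h.idx_letter e (h1.trans_le hn)]⟩

/-- The number of words with the property `P` and the beginning `a 0, …, a (j - 1)`, whose next
letter is one of the first `n`. -/
noncomputable def prefixSum (P : (Fin m → A) → Prop) (letter : ℕ → A) (a : ℕ → A) (j n : ℕ) : ℕ :=
  ∑ e ∈ Finset.range n, cnt P (j + 1) (Function.update a j (letter e))

theorem prefixSum_mono (P : (Fin m → A) → Prop) (letter : ℕ → A) (a : ℕ → A) (j : ℕ) {n n' : ℕ}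
    (h : n ≤ n') : prefixSum P letter a j n ≤ prefixSum P letter a j n' :=
  Finset.sum_le_sum_of_subset (Finset.range_mono h)

theorem prefixSum_congr (P : (Fin m → A) → Prop) (letter : ℕ → A) {a a' : ℕ → A} (j n : ℕ)
    (h : ∀ i < j, a i = a' i) : prefixSum P letter a j n = prefixSum P letter a' j n := by
  refine Finset.sum_congr rfl fun e _ => cnt_congr P fun i hi => ?_
  by_cases hij : i = j
  · subst hij; simp
  · rw [Function.update_of_ne hij, Function.update_of_ne hij, h i (by omega)]

/-- The part of the prefix enumerator that comes from the places from `j` on. -/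
noncomputable def enumTail (P : (Fin m → A) → Prop) (letter : ℕ → A) (idx : A → ℕ) (a : ℕ → A)
    (j : ℕ) : ℕ :=
  ∑ i ∈ Finset.Ico j m, prefixSum P letter a i (idx (a i))

theorem enumTail_step (P : (Fin m → A) → Prop) (letter : ℕ → A) (idx : A → ℕ) (a : ℕ → A)
    {j : ℕ} (hj : j < m) : enumTail P letter idx a j =
      prefixSum P letter a j (idx (a j)) + enumTail P letter idx a (j + 1) :=
  Finset.sum_eq_sum_Ico_succ_bot hj _

variable {K : ℕ} {letter : ℕ → A} {idx : A → ℕ}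

theorem prefixSum_succ_idx (h : IsListing K letter idx) (P : (Fin m → A) → Prop) (a : ℕ → A)
    (j : ℕ) : prefixSum P letter a j (idx (a j) + 1) =
      prefixSum P letter a j (idx (a j)) + cnt P (j + 1) a := by
  unfold prefixSum
  rw [Finset.sum_range_succ, h.letter_idx, Function.update_eq_self]

variable [Fintype A]

theorem prefixSum_eq_cnt (h : IsListing K letter idx) (P : (Fin m → A) → Prop) (a : ℕ → A)
    {j : ℕ} (hj : j < m) : prefixSum P letter a j K = cnt P j a := by
  rw [cnt_step P hj, h.sum_eq]
  rfl

/-- By backward induction the tail after place j is less than the number of words that share the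
letter at j. Adding the counts of all smaller letters stays below the total over all letters. -/
theorem enumTail_lt (h : IsListing K letter idx) (P : (Fin m → A) → Prop) (a : ℕ → A)
    (ha : P fun i => a i) (n : ℕ) : ∀ j, j + n = m → enumTail P letter idx a j < cnt P j a := by
  induction n with
  | zero =>
    intro j hj
    obtain rfl : j = m := hj
    rw [cnt_full, if_pos ha]
    simp [enumTail]
  | succ n ih =>
    intro j hj
    rw [enumTail_step _ _ _ _ (by omega), ← prefixSum_eq_cnt h P a (show j < m by omega)]
    refine lt_of_lt_of_le (Nat.add_lt_add_left (ih (j + 1) (by omega)) _) ?_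
    rw [← prefixSum_succ_idx h]
    exact prefixSum_mono P letter a j (Nat.succ_le_of_lt (h.idx_lt _))

/-- At the first difference, the letter of `a` is among those already summed for `a'`, and its whole
block exceeds what `a` can still collect. -/
theorem enumTail_lt_of_lt (h : IsListing K letter idx) (P : (Fin m → A) → Prop) (a a' : ℕ → A)
    (ha : P fun i => a i) {j : ℕ} (hj : j < m) (haa : ∀ i < j, a i = a' i)
    (hlt : idx (a j) < idx (a' j)) : enumTail P letter idx a j < enumTail P letter idx a' j := by
  rw [enumTail_step _ _ _ _ hj, enumTail_step _ _ _ _ hj]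
  refine lt_of_lt_of_le (Nat.add_lt_add_left (enumTail_lt h P a ha (m - (j + 1)) (j + 1)
    (by omega)) _) (le_trans ?_ (Nat.le_add_right _ _))
  rw [← prefixSum_succ_idx h, prefixSum_congr P letter j _ haa]
  exact prefixSum_mono P letter a' j (Nat.succ_le_of_lt hlt)

theorem enumTail_injective (h : IsListing K letter idx) (P : (Fin m → A) → Prop) (a a' : ℕ → A)
    (ha : P fun i => a i) (ha' : P fun i => a' i)
    (heq : enumTail P letter idx a 0 = enumTail P letter idx a' 0) : ∀ j < m, a j = a' j := by
  have key : ∀ n ≤ m, (∀ i < n, a i = a' i) ∧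
      enumTail P letter idx a n = enumTail P letter idx a' n := by
    intro n
    induction n with
    | zero => intro _; exact ⟨fun i hi => absurd hi (Nat.not_lt_zero i), heq⟩
    | succ n ih =>
      intro hn
      obtain ⟨h1, h2⟩ := ih (by omega)
      have h3 : idx (a n) = idx (a' n) := by
        rcases lt_trichotomy (idx (a n)) (idx (a' n)) with hl | hl | hl
        · exact absurd h2 (enumTail_lt_of_lt h P a a' ha (by omega) h1 hl).ne
        · exact hl
        · exact absurd h2 (enumTail_lt_of_lt h P a' a ha' (by omega)
            (fun i hi => (h1 i hi).symm) hl).ne'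
      have h4 : a n = a' n := by rw [← h.letter_idx (a n), h3, h.letter_idx]
      refine ⟨fun i hi => ?_, ?_⟩
      · rcases Nat.lt_succ_iff_lt_or_eq.1 hi with hi | rfl
        · exact h1 i hi
        · exact h4
      · rw [enumTail_step _ _ _ _ (show n < m by omega),
          enumTail_step _ _ _ _ (show n < m by omega), prefixSum_congr P letter n _ h1, h3] at h2
        exact Nat.add_left_cancel h2
  exact (key m le_rfl).1

end Enumeration

/-! ### The prefix enumerator of the line Hermitian Grassmannian -/

section Iota

theorem snocCol_takeCols_seqMat {F : Type*} {m : ℕ} (a : ℕ → F × F) (j : Fin m) (x : Fin 2 → F) :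
    snocCol (takeCols (seqMat a m) j j.isLt.le) x =
      seqMat (Function.update a j (x 0, x 1)) (j + 1) := by
  ext r i
  unfold snocCol seqMat wordMat
  refine Fin.lastCases ?_ (fun i => ?_) i
  · rw [Fin.snoc_last]
    fin_cases r <;> simp
  · rw [Fin.snoc_castSucc]
    simp only [Fin.val_castSucc, Function.update_of_ne i.isLt.ne]
    rfl

theorem exists_seqMat {F : Type*} [Zero F] {m : ℕ} (G : Matrix (Fin 2) (Fin m) F) :
    ∃ a, seqMat a m = G := by
  refine ⟨fun i => if h : i < m then (G 0 ⟨i, h⟩, G 1 ⟨i, h⟩) else 0, ?_⟩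
  ext r i
  fin_cases r <;> simp [seqMat, wordMat]

theorem ncard_reps {F : Type*} [Field F] (q m : ℕ) (a : ℕ → F × F) : (reps F q m).ncard =
    cnt (fun w : Fin m → F × F => IsRepWord q w) 0 a := by
  unfold cnt
  rw [← Nat.card_coe_set_eq]
  refine (Nat.card_congr (Equiv.ofBijective (fun w => ⟨wordMat w.1, w.2.1⟩) ⟨?_, ?_⟩)).symm
  · intro w w' h
    exact Subtype.ext (wordMat_injective (congrArg Subtype.val h))
  · rintro ⟨G, hG⟩
    obtain ⟨w, rfl⟩ := exists_wordMat G
    exact ⟨⟨w, hG, fun i hi => absurd hi (Nat.not_lt_zero _)⟩, rfl⟩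

variable {F : Type*} [Field F] [Fintype F] [LinearOrder F] {q : ℕ}

/-- The letters in lexicographic order. -/
def letter (F : Type*) [Field F] [Fintype F] [LinearOrder F] (q e : ℕ) : F × F :=
  (alphabet (e / q ^ 2), alphabet (e % q ^ 2))

theorem exists_isListing_alphabet (hq : Fintype.card F = q ^ 2) :
    ∃ f : F → ℕ, IsListing (q ^ 2) alphabet f ∧ StrictMono f := by
  have hc : (Finset.univ : Finset F).card = q ^ 2 := by rw [Finset.card_univ, hq]
  let φ := Finset.univ.orderIsoOfFin hc
  have hφ : ∀ i : Fin (q ^ 2), (φ i : F) = alphabet (i : ℕ) := by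
    intro i
    rw [Finset.coe_orderIsoOfFin_apply, Finset.orderEmbOfFin_apply]
    unfold alphabet
    rw [List.getD_eq_getElem _ _ (by rw [Finset.length_sort, hc]; exact i.2)]
    rfl
  refine ⟨fun y => φ.symm ⟨y, Finset.mem_univ y⟩, ⟨fun c => Fin.is_lt _, fun c => ?_,
    fun e he => ?_⟩, fun y z h => ?_⟩
  · rw [← hφ]; simp
  · have h1 : (⟨alphabet e, Finset.mem_univ _⟩ : {x // x ∈ (Finset.univ : Finset F)}) =
        φ ⟨e, he⟩ := Subtype.ext (hφ ⟨e, he⟩).symm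
    rw [h1]; simp
  · exact φ.symm.strictMono (show (⟨y, _⟩ : {x // x ∈ (Finset.univ : Finset F)}) < ⟨z, _⟩ from h)

/-- The lexicographic order of pairs is the numerical order of numbers with two digits in base q².
-/
theorem exists_isListing_letter (hq : Fintype.card F = q ^ 2) :
    ∃ idx : F × F → ℕ, IsListing (q ^ 4) (letter F q) idx ∧
      ∀ x y : Fin 2 → F, colLT x y ↔ idx (x 0, x 1) < idx (y 0, y 1) := by
  obtain ⟨f, hf, hmono⟩ := exists_isListing_alphabet hq
  have hpos : 0 < q ^ 2 := lt_of_le_of_lt (Nat.zero_le _) (hf.idx_lt 0)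
  have h4 : q ^ 4 = q ^ 2 * q ^ 2 := by ring
  refine ⟨fun c => f c.1 * q ^ 2 + f c.2, ⟨fun c => ?_, fun c => ?_, fun e he => ?_⟩,
    fun x y => ?_⟩
  · have h1 := hf.idx_lt c.1
    have h2 := hf.idx_lt c.2
    rw [h4]
    nlinarith
  · have h2 := hf.idx_lt c.2
    unfold letter
    rw [mul_comm, Nat.mul_add_div hpos, Nat.div_eq_of_lt h2, add_zero, Nat.mul_add_mod,
      Nat.mod_eq_of_lt h2, hf.letter_idx, hf.letter_idx]
  · rw [h4] at he
    simp only [letter]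
    rw [hf.idx_letter _ ((Nat.div_lt_iff_lt_mul hpos).2 he), hf.idx_letter _ (Nat.mod_lt _ hpos)]
    exact Nat.div_add_mod' e (q ^ 2)
  · have h2 := hf.idx_lt (x 1)
    have h2' := hf.idx_lt (y 1)
    simp only [colLT]
    constructor
    · rintro (h | ⟨h, h'⟩)
      · have := hmono h
        nlinarith
      · rw [h]
        exact Nat.add_lt_add_left (hmono h') _
    · intro h
      rcases lt_trichotomy (x 0) (y 0) with hl | hl | hl
      · exact Or.inl hl
      · rw [hl] at h
        exact Or.inr ⟨hl, hmono.lt_iff_lt.1 (Nat.lt_of_add_lt_add_left h)⟩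
      · have := hmono hl
        nlinarith

theorem iota_seqMat {idx : F × F → ℕ} (hidx : IsListing (q ^ 4) (letter F q) idx)
    (hlt : ∀ x y : Fin 2 → F, colLT x y ↔ idx (x 0, x 1) < idx (y 0, y 1)) {m : ℕ}
    (a : ℕ → F × F) : iota q (seqMat a m) =
      enumTail (fun w : Fin m → F × F => IsRepWord q w) (letter F q) idx a 0 := by
  unfold iota enumTail
  rw [Nat.Ico_zero_eq_range, ← Fin.sum_univ_eq_sum_range]
  refine Finset.sum_congr rfl fun j _ => ?_
  unfold prefixSum
  rw [← hidx.sum_filter_eq (idx (a j)) (hidx.idx_lt _).le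
    (fun c => cnt (fun w : Fin m → F × F => IsRepWord q w) (j + 1) (Function.update a j c))]
  refine Finset.sum_bij' (fun x _ => (x 0, x 1)) (fun c _ => ![c.1, c.2]) ?_ ?_ ?_ ?_ ?_
  · intro x hx
    simpa [hlt, seqMat, wordMat] using hx
  · intro c hc
    simpa [hlt, seqMat, wordMat] using hc
  · intro x _
    ext r
    fin_cases r <;> rfl
  · intro c _; rfl
  · intro x _
    rw [snocCol_takeCols_seqMat, psi_eq_cnt]

/-- An injection into {0, …, N-1} from a set of N elements; no inverse has to be constructed. -/
theorem bijOn_iota (hq : Fintype.card F = q ^ 2) (m : ℕ) :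
    Set.BijOn (iota q) (reps F q m) (Set.Iio (numPoints F q m)) := by
  obtain ⟨idx, hidx, hlt⟩ := exists_isListing_letter hq
  have hN : numPoints F q m = (reps F q m).ncard := by
    rw [numPoints_eq_psi q m 0, psi_eq_cnt, ← ncard_reps]
  have hmaps : Set.MapsTo (iota q) (reps F q m) (Set.Iio (numPoints F q m)) := by
    intro G hG
    obtain ⟨a, rfl⟩ := exists_seqMat G
    rw [Set.mem_Iio, iota_seqMat hidx hlt, hN, ncard_reps q m a]
    exact enumTail_lt hidx _ a hG m 0 (zero_add m)
  have hinj : Set.InjOn (iota q) (reps F q m) := by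
    intro G hG G' hG' h
    obtain ⟨a, rfl⟩ := exists_seqMat G
    obtain ⟨a', rfl⟩ := exists_seqMat G'
    rw [iota_seqMat hidx hlt, iota_seqMat hidx hlt] at h
    have := enumTail_injective hidx _ a a' hG hG' h
    unfold seqMat
    congr 1
    funext i
    exact this i i.isLt
  refine ⟨hmaps, hinj, ?_⟩
  have : iota q '' reps F q m = Set.Iio (numPoints F q m) := by
    refine Set.eq_of_subset_of_ncard_le hmaps.image_subset ?_ (Set.finite_Iio _)
    rw [hinj.ncard_image, ← hN, Set.ncard_eq_toFinset_card']
    simp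
  exact this.ge

end Iota

end HermGr

namespace HermGr

/-! ### Execution of programs -/

section Machine

variable {F : Type*} [Field F]

/-- The final memory. -/
noncomputable def Prog.exec (q : ℕ) (p : Prog) (s : Mem F) : Mem F := (p.run q s).1

/-- The number of steps. -/
noncomputable def Prog.time (q : ℕ) (p : Prog) (s : Mem F) : ℕ := (p.run q s).2

theorem exec_skip (q : ℕ) (s : Mem F) : Prog.skip.exec q s = s := rfl

theorem exec_setN (q : ℕ) (s : Mem F) (v : ℕ) (a : NExp) : (Prog.setN v a).exec q s =
    { s with num := Function.update s.num v (a.eval s) } := rfl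

theorem exec_setF (q : ℕ) (s : Mem F) (v : ℕ) (x : FExp) : (Prog.setF v x).exec q s =
    { s with fld := Function.update s.fld v (x.eval q s) } := rfl

theorem exec_store (q : ℕ) (s : Mem F) (b : ℕ) (i : NExp) (x : FExp) :
    (Prog.store b i x).exec q s = { s with
      arr := Function.update s.arr b (Function.update (s.arr b) (i.eval s) (x.eval q s)) } := rfl

theorem exec_seq (q : ℕ) (s : Mem F) (p p' : Prog) :
    (Prog.seq p p').exec q s = p'.exec q (p.exec q s) := rfl

theorem time_seq (q : ℕ) (s : Mem F) (p p' : Prog) :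
    (Prog.seq p p').time q s = p.time q s + p'.time q (p.exec q s) := rfl

open Classical in
theorem exec_ite (q : ℕ) (s : Mem F) (c : Cond) (p p' : Prog) : (Prog.ite c p p').exec q s =
    if c.holds q s then p.exec q s else p'.exec q s := by
  unfold Prog.exec
  rw [Prog.run]
  split_ifs <;> rfl

theorem run_loop_iterate (q : ℕ) (p : Prog) (s : Mem F) (c n : ℕ) :
    ((fun r : Mem F × ℕ => ((p.run q r.1).1, r.2 + (p.run q r.1).2 + 1))^[n] (s, c)).1 =
      (p.exec q)^[n] s := by
  induction n with
  | zero => rfl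
  | succ n ih => rw [Function.iterate_succ_apply', Function.iterate_succ_apply', ← ih]; rfl

theorem exec_loop (q : ℕ) (s : Mem F) (a : NExp) (p : Prog) :
    (Prog.loop a p).exec q s = (p.exec q)^[a.eval s] s := run_loop_iterate q p s _ _

/-- The invariant and the time bound are handled together because the bound for one pass may use the
invariant. -/
theorem loop_induction (q : ℕ) (s : Mem F) (a : NExp) (p : Prog) (n c : ℕ) (hn : a.eval s = n)
    (I : ℕ → Mem F → Prop) (h0 : I 0 s)
    (hstep : ∀ i < n, ∀ s, I i s → I (i + 1) (p.exec q s) ∧ p.time q s ≤ c) :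
    I n ((Prog.loop a p).exec q s) ∧ (Prog.loop a p).time q s ≤ a.cost + 1 + n * (c + 1) := by
  have key : ∀ i ≤ n, I i ((p.exec q)^[i] s) ∧
      ((fun r : Mem F × ℕ => ((p.run q r.1).1, r.2 + (p.run q r.1).2 + 1))^[i]
        (s, a.cost + 1)).2 ≤ a.cost + 1 + i * (c + 1) := by
    intro i
    induction i with
    | zero => intro _; exact ⟨h0, by simp⟩
    | succ i ih =>
      intro hi
      obtain ⟨h1, h2⟩ := ih (by omega)
      obtain ⟨h3, h4⟩ := hstep i (by omega) _ h1
      rw [Function.iterate_succ_apply', Function.iterate_succ_apply']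
      refine ⟨h3, ?_⟩
      simp only [run_loop_iterate]
      unfold Prog.time at h4
      rw [add_mul, one_mul]
      omega
  rw [exec_loop, hn]
  refine ⟨(key n le_rfl).1, ?_⟩
  have := (key n le_rfl).2
  unfold Prog.time
  rw [Prog.run, hn]
  exact this

/-- The program has no loops. -/
def Prog.loopFree : Prog → Prop
  | .seq p p' => p.loopFree ∧ p'.loopFree
  | .ite _ p p' => p.loopFree ∧ p'.loopFree
  | .loop _ _ => False
  | _ => True

/-- A bound for the number of steps of a program without loops. -/
def Prog.maxTime : Prog → ℕ
  | .skip => 1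
  | .setN _ a => a.cost + 1
  | .setF _ x => x.cost + 1
  | .store _ i x => i.cost + x.cost + 1
  | .seq p p' => p.maxTime + p'.maxTime
  | .ite c p p' => c.cost + (p.maxTime + p'.maxTime) + 1
  -- A dummy value: loops are excluded by `Prog.loopFree` wherever this bound is used.
  | .loop _ _ => 0

theorem time_le_maxTime (q : ℕ) (p : Prog) (hp : p.loopFree) (s : Mem F) :
    p.time q s ≤ p.maxTime := by
  induction p generalizing s with
  | skip => exact le_rfl
  | setN v a => exact le_rfl
  | setF v x => exact le_rfl
  | store b i x => exact le_rfl
  | seq p p' ih ih' =>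
    rw [time_seq]
    exact Nat.add_le_add (ih hp.1 s) (ih' hp.2 _)
  | ite c p p' ih ih' =>
    have h1 := ih hp.1 s
    have h2 := ih' hp.2 s
    unfold Prog.time at *
    rw [Prog.run, Prog.maxTime]
    split_ifs
    · simp only; omega
    · simp only; omega
  | loop a p => exact hp.elim

/-- No elementary step of the program changes the value of `f`. -/
def Prog.Keeps {β : Type*} (q : ℕ) (f : Mem F → β) : Prog → Prop
  | .skip => True
  | .setN v a => ∀ s, f ((Prog.setN v a).exec q s) = f s
  | .setF v x => ∀ s, f ((Prog.setF v x).exec q s) = f s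
  | .store b i x => ∀ s, f ((Prog.store b i x).exec q s) = f s
  | .seq p p' => p.Keeps q f ∧ p'.Keeps q f
  | .ite _ p p' => p.Keeps q f ∧ p'.Keeps q f
  | .loop _ p => p.Keeps q f

/-- The frame rule: what no elementary step alters survives the whole program, loops included.
Taking tuples for `f` treats several memory cells at once. -/
theorem exec_of_keeps {β : Type*} (q : ℕ) (f : Mem F → β) (p : Prog) (hp : p.Keeps q f)
    (s : Mem F) : f (p.exec q s) = f s := by
  induction p generalizing s with
  | skip => rfl
  | setN v a => exact hp s
  | setF v x => exact hp s
  | store b i x => exact hp s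
  | seq p p' ih ih' => rw [exec_seq, ih' hp.2, ih hp.1]
  | ite c p p' ih ih' =>
    rw [exec_ite]
    split_ifs
    · exact ih hp.1 s
    · exact ih' hp.2 s
  | loop a p ih =>
    rw [exec_loop]
    generalize a.eval s = n
    induction n with
    | zero => rfl
    | succ n ihn => rw [Function.iterate_succ_apply', ih hp, ihn]

end Machine

end HermGr

namespace HermGr

/-! ### A program that counts the points with a prescribed beginning -/

section PsiProgram

/-- The product `q ^ 2`, where `q` is the content of the numerical variable `0`. -/
def expQ2 : NExp := .mul (.var 0) (.var 0)

/-- The product `q ^ 4`, where `q` is the content of the numerical variable `0`. -/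
def expQ4 : NExp := .mul expQ2 expQ2

/-- The value of `pairFull`, with `q` and `Q` in the numerical variables `0` and `7`. -/
def expPair (s z : NExp) : NExp :=
  .div (.mul (.mul (.var 7) (.var 7))
    (.add (.add (.mul (.sub (.var 7) (.const 1)) (.sub (.var 7) expQ2))
      (.mul (.mul s (.var 0)) (.sub (.var 7) (.const 1)))) (.mul z expQ4))) expQ4

/-- The value of `vecFull`, with `q` and `Q` in the numerical variables `0` and `7`. -/
def expVec (z : NExp) : NExp :=
  .div (.mul (.var 7) (.add (.sub (.var 7) (.const 1)) (.mul z (.var 0)))) (.var 0)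

/-- Adding the dyad of the column in the field variables `3, 4` and, except for the first column,
of the one in the field variables `5, 6` to the Gram matrix in the field variables `0, 1, 2`. -/
def progGram : Prog :=
  .ite (.le (.const 1) (.var 6))
    (.seq
      (.ite (.le (.var 4) (.const 0))
        (.seq (.setF 0 (.add (.var 0) (.mul (.conj (.var 3)) (.var 3))))
        (.seq (.setF 1 (.add (.var 1) (.mul (.conj (.var 3)) (.var 4))))
          (.setF 2 (.add (.var 2) (.mul (.conj (.var 4)) (.var 4))))))
        (.seq (.setF 0 (.add (.var 0) (.add (.mul (.conj (.var 5)) (.var 3))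
          (.mul (.conj (.var 3)) (.var 5)))))
        (.seq (.setF 1 (.add (.var 1) (.add (.mul (.conj (.var 5)) (.var 4))
          (.mul (.conj (.var 3)) (.var 6)))))
          (.setF 2 (.add (.var 2) (.add (.mul (.conj (.var 6)) (.var 4))
            (.mul (.conj (.var 4)) (.var 6))))))))
      (.setN 6 (.const 0)))
    (.setN 6 (.const 1))

/-- The function `rankStep`, applied to the numerical variable `5` and the column in the field
variables `3, 4`. -/
def progRank : Prog :=
  .ite (.le (.var 5) (.const 0))
    (.ite (.feq (.var 4) .zero)
      (.ite (.feq (.var 3) .zero) .skip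
        (.ite (.feq (.var 3) .one) (.setN 5 (.const 1)) (.setN 5 (.const 3))))
      (.setN 5 (.const 3)))
    (.ite (.le (.var 5) (.const 1))
      (.ite (.feq (.var 4) .zero) .skip
        (.ite (.and (.feq (.var 4) .one) (.feq (.var 3) .zero)) (.setN 5 (.const 2))
          (.setN 5 (.const 3))))
      .skip)

/-- Reading one column. -/
def progColumn : Prog :=
  .seq (.setF 3 (.get 0 (.var 4)))
  (.seq (.setF 4 (.get 1 (.var 4)))
  (.seq progGram
  (.seq progRank
  (.seq (.setF 5 (.var 3))
  (.seq (.setF 6 (.var 4))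
    (.setN 4 (.add (.var 4) (.const 1))))))))

/-- Reading all columns. -/
def progScan : Prog :=
  .seq (.setN 4 (.const 0))
  (.seq (.setN 5 (.const 0))
  (.seq (.setN 6 (.sub (.var 1) (.mul (.div (.var 1) (.const 2)) (.const 2))))
  (.seq (.setF 0 .zero)
  (.seq (.setF 1 .zero)
  (.seq (.setF 2 .zero)
    (.loop (.var 2) progColumn))))))

/-- The number `Q`. -/
def progPower : Prog :=
  .seq (.setN 7 (.const 1))
    (.loop (.div (.sub (.var 1) (.var 2)) (.const 2)) (.setN 7 (.mul (.var 7) expQ2)))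

/-- The values of `isoPts` and `isZeroH`. -/
def progIso : Prog :=
  .ite (.and (.feq (.var 0) .zero) (.and (.feq (.var 1) .zero) (.feq (.var 2) .zero)))
    (.seq (.setN 8 (.add expQ2 (.const 1))) (.setN 9 (.const 1)))
    (.seq (.setN 9 (.const 0))
      (.ite (.feq (.mul (.var 0) (.var 2)) (.mul (.var 1) (.conj (.var 1))))
        (.setN 8 (.const 1)) (.setN 8 (.add (.var 0) (.const 1)))))

/-- The value of `isoPerp`. -/
def progPerp : Prog :=
  .ite (.feq
    (.add (.mul (.mul (.conj (.var 6)) (.var 6)) (.var 0))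
      (.mul (.mul (.conj (.var 5)) (.var 5)) (.var 2)))
    (.add (.mul (.mul (.conj (.var 6)) (.var 5)) (.var 1))
      (.mul (.mul (.conj (.var 5)) (.var 6)) (.conj (.var 1)))))
    (.setN 10 (.const 1)) (.setN 10 (.const 0))

/-- The indicator of an isotropic first row. -/
def progZero : Prog :=
  .ite (.feq (.var 0) .zero) (.setN 13 (.const 1)) (.setN 13 (.const 0))

/-- The values of `isoPts`, `isZeroH`, `isoPerp` and the indicator of an isotropic first row. -/
def progIndicators : Prog := .seq progIso (.seq progPerp progZero)

/-- The value of `pairHalf`. -/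
def progPairHalf : Prog :=
  .ite (.and (.feq (.var 5) .zero) (.feq (.var 6) .zero))
    (.setN 11 (.mul expQ4 (expPair (.var 8) (.var 9))))
    (.setN 11 (.add (.mul (.sub (.mul (.var 7) (.var 7)) (.var 7)) (.mul (.var 7) (.var 7)))
      (.mul (.var 10) (.mul (.mul (.mul (.var 7) (.var 7)) (.var 7)) (.var 0)))))

/-- The value of `vecCount` if the last column is the first one of a hyperbolic pair. -/
def progVecHalf : Prog :=
  .ite (.feq (.var 5) .zero)
    (.setN 12 (.mul expQ2 (expVec (.var 13))))
    (.setN 12 (.mul (.mul (.var 7) (.var 7)) (.var 0)))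

/-- The values of `pairCount` and `vecCount`. -/
def progCounts : Prog :=
  .ite (.le (.const 1) (.var 6))
    (.ite (.le (.var 2) (.const 0))
      (.seq
        (.setN 11 (.add (expPair (.add expQ2 (.const 1)) (.const 1))
          (.mul (.sub expQ4 (.const 1)) (expPair (.const 1) (.const 0)))))
        (.setN 12 (.add (expVec (.const 1))
          (.mul (.sub expQ2 (.const 1)) (expVec (.const 0))))))
      (.seq progPairHalf progVecHalf))
    (.seq (.setN 11 (expPair (.var 8) (.var 9))) (.setN 12 (expVec (.var 13))))

/-- The value of `psiCount`. -/
def progResult : Prog :=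
  .ite (.le (.var 5) (.const 0))
    (.setN 3 (.div (.sub (.add (.var 11) expQ2) (.mul (.var 12) (.add expQ2 (.const 1))))
      (.mul (.sub expQ4 (.const 1)) (.sub expQ4 expQ2))))
    (.ite (.le (.var 5) (.const 1))
      (.setN 3 (.div (.sub (.var 11) (.var 12)) (.mul (.sub expQ2 (.const 1)) expQ2)))
      (.ite (.le (.var 5) (.const 2)) (.setN 3 (.var 11)) (.setN 3 (.const 0))))

/-- With `q`, `m`, `t` in the numerical variables `0, 1, 2` and a word in the arrays `0, 1`, the
number of points whose representation begins with the first `t` columns is put into the numerical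
variable `3`. -/
def progPsi : Prog :=
  .seq progScan (.seq progPower (.seq progIndicators (.seq progCounts progResult)))

/-! ### Correctness and running time of the counting program -/

variable {F : Type*} [Field F]

/-- The word in the arrays `0` and `1`. -/
def Mem.word (s : Mem F) (i : ℕ) : F × F := (s.arr 0 i, s.arr 1 i)

theorem exec_progRank [DecidableEq F] (q : ℕ) (s : Mem F) :
    (progRank.exec q s).num 5 = rankStep (s.num 5) (s.fld 3, s.fld 4) := by
  simp only [progRank, exec_ite, exec_setN, exec_skip, rankStep]
  split_ifs <;> simp_all [Cond.holds, NExp.eval, FExp.eval] <;> omega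

theorem exec_progGram (q : ℕ) (s : Mem F) (h6 : s.num 6 ≤ 1) :
    (progGram.exec q s).num 6 = 1 - s.num 6 ∧
    ((progGram.exec q s).fld 0, (progGram.exec q s).fld 1, (progGram.exec q s).fld 2) =
      if s.num 6 = 1 then
        if s.num 4 = 0 then (s.fld 0 + s.fld 3 ^ q * s.fld 3, s.fld 1 + s.fld 3 ^ q * s.fld 4,
          s.fld 2 + s.fld 4 ^ q * s.fld 4)
        else addDyad q (s.fld 5, s.fld 6) (s.fld 3, s.fld 4) (s.fld 0, s.fld 1, s.fld 2)
      else (s.fld 0, s.fld 1, s.fld 2) := by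
  have h : 1 ≤ s.num 6 ↔ s.num 6 = 1 := by omega
  simp only [progGram, exec_ite, exec_setN, exec_setF, exec_seq, Cond.holds, NExp.eval, FExp.eval,
    Nat.le_zero, h, addDyad]
  split_ifs with h1 h2
  · simp [h1]
  · simp [h1]
  · have : s.num 6 = 0 := by omega
    simp [this]

theorem keeps_progScan_body (q : ℕ) : (progColumn.Keeps q
    (fun s : Mem F => (s.num 0, s.num 1, s.num 2, s.arr))) := by
  simp [progColumn, progGram, progRank, Prog.Keeps, exec_setN, exec_setF]

theorem gram_succ (q m : ℕ) (a : ℕ → F × F) (t : ℕ) :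
    gram q m a (t + 1) = if (m - t) % 2 = 1 then
      if t = 0 then ((gram q m a t).1 + (a t).1 ^ q * (a t).1,
        (gram q m a t).2.1 + (a t).1 ^ q * (a t).2, (gram q m a t).2.2 + (a t).2 ^ q * (a t).2)
      else addDyad q (a (t - 1)) (a t) (gram q m a t) else gram q m a t := by
  split_ifs with h h0
  · subst h0
    simp only [gram, partialForm, if_pos h, if_true]
  · exact gram_succ_half q a h h0
  · exact gram_succ_full q a h

/-- The state of the memory after reading `i` columns of the word `a`. -/
structure ScanState [DecidableEq F] (q m t : ℕ) (arr : ℕ → ℕ → F) (i : ℕ) (s : Mem F) :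
    Prop where
  frame : (s.num 0, s.num 1, s.num 2, s.arr) = (q, m, t, arr)
  num4 : s.num 4 = i
  num5 : s.num 5 = scanRank s.word i
  num6 : s.num 6 = (m - i) % 2
  gram : (s.fld 0, s.fld 1, s.fld 2) = gram q m s.word i
  last : i ≠ 0 → (s.fld 5, s.fld 6) = s.word (i - 1)

theorem word_eq_of_arr_eq {F : Type*} {s s' : Mem F} (h : s.arr = s'.arr) : s.word = s'.word := by
  unfold Mem.word; rw [h]

/-- Numerical variable 6 holds the parity of the number of columns still to be read, so it tells
whether the current column closes a pair; the previous column is then in the field variables 5, 6.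
-/
theorem ScanState.step [DecidableEq F] {q m t : ℕ} {arr : ℕ → ℕ → F} {i : ℕ} {s : Mem F}
    (h : ScanState q m t arr i s) (hi : i < m) :
    ScanState q m t arr (i + 1) (progColumn.exec q s) := by
  have hfr := exec_of_keeps q _ _ (keeps_progScan_body (F := F) q) s
  have hw : (progColumn.exec q s).word = s.word :=
    word_eq_of_arr_eq (congrArg (fun x => x.2.2.2) hfr)
  have hp := h.num6
  have h4 := h.num4
  obtain ⟨s₂, hs₂⟩ : ∃ s₂, s₂ = (Prog.setF 4 (.get 1 (.var 4))).exec q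
    ((Prog.setF 3 (.get 0 (.var 4))).exec q s) := ⟨_, rfl⟩
  have a3 : s₂.fld 3 = (s.word i).1 := by simp [hs₂, exec_setF, FExp.eval, NExp.eval, h4, Mem.word]
  have a4 : s₂.fld 4 = (s.word i).2 := by simp [hs₂, exec_setF, FExp.eval, NExp.eval, h4, Mem.word]
  have anum : s₂.num = s.num := by rw [hs₂]; rfl
  have afld : ∀ v, v ≠ 3 → v ≠ 4 → s₂.fld v = s.fld v := by
    intro v h3 h4
    simp [hs₂, exec_setF, h3, h4]
  have b34 : ((progGram.exec q s₂).num 4, (progGram.exec q s₂).num 5, (progGram.exec q s₂).fld 3,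
      (progGram.exec q s₂).fld 4) = (s₂.num 4, s₂.num 5, s₂.fld 3, s₂.fld 4) :=
    exec_of_keeps q (fun s : Mem F => (s.num 4, s.num 5, s.fld 3, s.fld 4)) _
      (by simp [progGram, Prog.Keeps, exec_setN, exec_setF]) s₂
  obtain ⟨g6, gf⟩ := exec_progGram q s₂ (by rw [anum, hp]; omega)
  obtain ⟨s₃, hs₃⟩ : ∃ s₃, s₃ = progGram.exec q s₂ := ⟨_, rfl⟩
  have r5 := exec_progRank q s₃
  have c34 : ((progRank.exec q s₃).num 4, (progRank.exec q s₃).num 6, (progRank.exec q s₃).fld) =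
      (s₃.num 4, s₃.num 6, s₃.fld) :=
    exec_of_keeps q (fun s : Mem F => (s.num 4, s.num 6, s.fld)) _
      (by simp [progRank, Prog.Keeps, exec_setN]) s₃
  obtain ⟨s₄, hs₄⟩ : ∃ s₄, s₄ = progRank.exec q s₃ := ⟨_, rfl⟩
  have hfin : progColumn.exec q s = (Prog.setN 4 (.add (.var 4) (.const 1))).exec q
    ((Prog.setF 6 (.var 4)).exec q ((Prog.setF 5 (.var 3)).exec q s₄)) := by
    rw [hs₄, hs₃, hs₂]; rfl
  rw [← hs₃] at b34 g6 gf
  rw [← hs₄] at c34 r5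
  simp only [Prod.mk.injEq] at b34 c34
  obtain ⟨b4, b5, bf3, bf4⟩ := b34
  obtain ⟨c4, c6, cf⟩ := c34
  refine ⟨hfr.trans h.frame, ?_, ?_, ?_, ?_, fun _ => ?_⟩
  · rw [hfin]
    simp [exec_setN, exec_setF, NExp.eval, c4, b4, anum, h4]
  · rw [hw, scanRank, ← h.num5, hfin]
    simp only [exec_setN, exec_setF]
    rw [Function.update_of_ne (by norm_num), r5, b5, anum, bf3, bf4, a3, a4]
  · rw [hfin]
    simp only [exec_setN, exec_setF]
    rw [Function.update_of_ne (by norm_num), c6, g6, anum, hp]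
    omega
  · rw [hw, gram_succ, hfin]
    simp only [exec_setN, exec_setF, ← h.gram]
    simp only [ne_eq, OfNat.zero_ne_ofNat, OfNat.one_ne_ofNat, not_false_eq_true,
      Function.update_of_ne, Nat.reduceEqDiff, cf]
    rw [gf, anum, hp, h4, a3, a4, afld 0 (by norm_num) (by norm_num),
      afld 1 (by norm_num) (by norm_num), afld 2 (by norm_num) (by norm_num),
      afld 5 (by norm_num) (by norm_num), afld 6 (by norm_num) (by norm_num)]
    split_ifs with h1 h2
    · rfl
    · rw [h.last h2]
    · rfl
  · rw [hw, hfin]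
    simp [exec_setN, exec_setF, FExp.eval, cf, bf3, bf4, a3, a4]

/-- A bound for the number of steps of `progPsi` per column. -/
def psiTime : ℕ :=
  progColumn.maxTime + (Prog.setN 7 (.mul (.var 7) expQ2)).maxTime + progIndicators.maxTime +
    progCounts.maxTime + progResult.maxTime + 62

theorem le_psiTime (m : ℕ) : 40 + m * (progColumn.maxTime + 1) +
    (20 + m * ((Prog.setN 7 (.mul (.var 7) expQ2)).maxTime + 1) + (progIndicators.maxTime +
      (progCounts.maxTime + progResult.maxTime))) ≤ psiTime * (m + 1) := by
  unfold psiTime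
  generalize progColumn.maxTime = x₁, (Prog.setN 7 (.mul (.var 7) expQ2)).maxTime = x₂,
    progIndicators.maxTime = x₃, progCounts.maxTime = x₄, progResult.maxTime = x₅
  -- The added term is exactly the difference of the two sides.
  refine le_trans (Nat.le_add_right _ (60 * m + x₁ + x₂ + m * (x₃ + x₄ + x₅) + 2)) (le_of_eq ?_)
  ring

theorem exec_progScan [DecidableEq F] {q m t : ℕ} {s : Mem F}
    (h : (s.num 0, s.num 1, s.num 2) = (q, m, t)) (ht : t ≤ m) :
    ScanState q m t s.arr t (progScan.exec q s) ∧
      progScan.time q s ≤ 40 + t * (progColumn.maxTime + 1) := by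
  simp only [Prod.mk.injEq] at h
  obtain ⟨h0, h1, h2⟩ := h
  simp only [progScan, exec_seq, time_seq]
  obtain ⟨s', hs'⟩ : ∃ s', s' = (Prog.setF 2 .zero).exec q ((Prog.setF 1 .zero).exec q
    ((Prog.setF 0 .zero).exec q ((Prog.setN 6 (.sub (.var 1) (.mul (.div (.var 1) (.const 2))
      (.const 2)))).exec q ((Prog.setN 5 (.const 0)).exec q
        ((Prog.setN 4 (.const 0)).exec q s))))) := ⟨_, rfl⟩
  rw [← hs']
  have hI : ScanState q m t s.arr 0 s' := by
    rw [hs']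
    simp only [exec_setN, exec_setF]
    refine ⟨?_, ?_, ?_, ?_, ?_, fun h => absurd rfl h⟩
    · simp [h0, h1, h2]
    · simp [NExp.eval]
    · simp [NExp.eval, scanRank]
    · simp [NExp.eval, h1]
      omega
    · simp [FExp.eval, gram, partialForm]
  have hl := loop_induction q s' (.var 2) progColumn t progColumn.maxTime (by
    have := hI.frame
    simp only [Prod.mk.injEq] at this
    exact this.2.2.1) (ScanState q m t s.arr) hI (fun i hi s hs => ⟨hs.step (by omega),
      time_le_maxTime q _ (by simp [progColumn, progGram, progRank, Prog.loopFree]) s⟩)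
  refine ⟨hl.1, ?_⟩
  have hl2 := hl.2
  have e1 : ∀ s : Mem F, (Prog.setN 4 (.const 0)).time q s = 2 := fun _ => rfl
  have e2 : ∀ s : Mem F, (Prog.setN 5 (.const 0)).time q s = 2 := fun _ => rfl
  have e3 : ∀ s : Mem F, (Prog.setN 6 (.sub (.var 1) (.mul (.div (.var 1) (.const 2))
      (.const 2)))).time q s = 8 := fun _ => rfl
  have e4 : ∀ (v : ℕ) (s : Mem F), (Prog.setF v .zero).time q s = 2 := fun _ _ => rfl
  have e5 : (NExp.var 2).cost = 1 := rfl
  rw [e1, e2, e3, e4, e4, e4]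
  rw [e5] at hl2
  omega

theorem exec_progPower {q m t : ℕ} {s : Mem F} (h : (s.num 0, s.num 1, s.num 2) = (q, m, t)) :
    (progPower.exec q s).num 7 = q ^ (2 * ((m - t) / 2)) ∧
      progPower.time q s ≤
        20 + (m - t) / 2 * ((Prog.setN 7 (.mul (.var 7) expQ2)).maxTime + 1) := by
  simp only [Prod.mk.injEq] at h
  obtain ⟨h0, h1, h2⟩ := h
  simp only [progPower, exec_seq, time_seq]
  have hl := loop_induction q ((Prog.setN 7 (.const 1)).exec q s)
    (.div (.sub (.var 1) (.var 2)) (.const 2)) (Prog.setN 7 (.mul (.var 7) expQ2)) ((m - t) / 2)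
    (Prog.setN 7 (.mul (.var 7) expQ2)).maxTime
    (by simp [NExp.eval, exec_setN, h1, h2])
    (fun i s => s.num 7 = q ^ (2 * i) ∧ s.num 0 = q)
    (by simp [NExp.eval, exec_setN, h0])
    (fun i _ s hs => ⟨by
      simp only [exec_setN, expQ2, NExp.eval]
      simp only [Function.update_self, hs.1, hs.2]
      simp only [ne_eq, OfNat.zero_ne_ofNat, not_false_eq_true, Function.update_of_ne, hs.2,
        and_true]
      ring, le_rfl⟩)
  refine ⟨hl.1.1, ?_⟩
  have hl2 := hl.2
  have e1 : (Prog.setN 7 (.const 1)).time q s = 2 := rfl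
  have e2 : (NExp.div (.sub (.var 1) (.var 2)) (.const 2)).cost = 5 := rfl
  rw [e1]
  rw [e2] at hl2
  omega

theorem exec_progIso [DecidableEq F] (q : ℕ) (s : Mem F) (h0 : s.num 0 = q) :
    ((progIso.exec q s).num 8, (progIso.exec q s).num 9) =
      (isoPts q (s.fld 0) (s.fld 1) (s.fld 2), isZeroH (s.fld 0) (s.fld 1) (s.fld 2)) := by
  simp only [progIso, exec_ite, exec_setN, exec_seq, isoPts, isZeroH]
  split_ifs <;> simp_all [Cond.holds, NExp.eval, FExp.eval, expQ2, sq]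

theorem exec_progPerp [DecidableEq F] (q : ℕ) (s : Mem F) : (progPerp.exec q s).num 10 =
    isoPerp q (s.fld 5) (s.fld 6) (s.fld 0) (s.fld 1) (s.fld 2) := by
  simp only [progPerp, exec_ite, exec_setN, isoPerp]
  split_ifs <;> simp_all [Cond.holds, NExp.eval, FExp.eval]

theorem exec_progZero [DecidableEq F] (q : ℕ) (s : Mem F) : (progZero.exec q s).num 13 =
    if s.fld 0 = 0 then 1 else 0 := by
  simp only [progZero, exec_ite, exec_setN]
  split_ifs <;> simp_all [Cond.holds, NExp.eval, FExp.eval]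

theorem exec_progIndicators [DecidableEq F] (q : ℕ) (s : Mem F) (h0 : s.num 0 = q) :
    ((progIndicators.exec q s).num 8, (progIndicators.exec q s).num 9,
      (progIndicators.exec q s).num 10, (progIndicators.exec q s).num 13) =
      (isoPts q (s.fld 0) (s.fld 1) (s.fld 2), isZeroH (s.fld 0) (s.fld 1) (s.fld 2),
        isoPerp q (s.fld 5) (s.fld 6) (s.fld 0) (s.fld 1) (s.fld 2),
        if s.fld 0 = 0 then 1 else 0) := by
  simp only [progIndicators, exec_seq]
  have h1 := exec_progIso q s h0
  have f1 := exec_of_keeps q (fun s : Mem F => s.fld) progIso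
    (by simp [progIso, Prog.Keeps, exec_setN]) s
  generalize progIso.exec q s = s₁ at h1 f1 ⊢
  have h2 := exec_progPerp q s₁
  have f2 := exec_of_keeps q (fun s : Mem F => (s.num 8, s.num 9, s.fld)) progPerp
    (by simp [progPerp, Prog.Keeps, exec_setN]) s₁
  generalize progPerp.exec q s₁ = s₂ at h2 f2 ⊢
  have h3 := exec_progZero q s₂
  have f3 := exec_of_keeps q (fun s : Mem F => (s.num 8, s.num 9, s.num 10)) progZero
    (by simp [progZero, Prog.Keeps, exec_setN]) s₂
  simp only [Prod.mk.injEq] at *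
  rw [f3.1, f3.2.1, f3.2.2, h3, f2.1, f2.2.1, h1.1, h1.2, h2, f2.2.2, f1]
  exact ⟨rfl, rfl, rfl, rfl⟩

theorem eval_expPair {F : Type*} (s : Mem F) (a b : NExp) :
    (expPair a b).eval s = pairFull (s.num 0) (s.num 7) (a.eval s) (b.eval s) := by
  have h : s.num 0 * s.num 0 * (s.num 0 * s.num 0) = s.num 0 ^ 4 := by ring
  simp only [expPair, expQ4, expQ2, NExp.eval, pairFull, h]

theorem eval_expVec {F : Type*} (s : Mem F) (a : NExp) :
    (expVec a).eval s = vecFull (s.num 0) (s.num 7) (a.eval s) := rfl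

theorem eval_expQ2 {F : Type*} (s : Mem F) : expQ2.eval s = s.num 0 ^ 2 := by
  simp only [expQ2, NExp.eval, sq]

theorem eval_expQ4 {F : Type*} (s : Mem F) : expQ4.eval s = s.num 0 ^ 4 := by
  simp only [expQ4, expQ2, NExp.eval]; ring

theorem exec_progPairHalf [DecidableEq F] (q : ℕ) (s : Mem F) (h0 : s.num 0 = q)
    (h8 : s.num 8 = isoPts q (s.fld 0) (s.fld 1) (s.fld 2))
    (h9 : s.num 9 = isZeroH (s.fld 0) (s.fld 1) (s.fld 2))
    (h10 : s.num 10 = isoPerp q (s.fld 5) (s.fld 6) (s.fld 0) (s.fld 1) (s.fld 2)) :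
    (progPairHalf.exec q s).num 11 =
      pairHalf q (s.num 7) (s.fld 5, s.fld 6) (s.fld 0, s.fld 1, s.fld 2) := by
  have h : Cond.holds q s (.and (.feq (.var 5) .zero) (.feq (.var 6) .zero)) ↔
      s.fld 5 = 0 ∧ s.fld 6 = 0 := Iff.rfl
  simp only [progPairHalf, exec_ite, exec_setN, pairHalf, ← h8, ← h9, ← h10]
  by_cases hc : s.fld 5 = 0 ∧ s.fld 6 = 0
  · rw [if_pos (h.2 hc), if_pos hc]
    simp [NExp.eval, eval_expPair, eval_expQ4, h0]
  · rw [if_neg (fun h' => hc (h.1 h')), if_neg hc]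
    simp [NExp.eval, h0]

theorem exec_progVecHalf [DecidableEq F] (q : ℕ) (s : Mem F) (h0 : s.num 0 = q) :
    (progVecHalf.exec q s).num 12 = if s.fld 5 = 0 then q ^ 2 * vecFull q (s.num 7) (s.num 13)
      else s.num 7 * s.num 7 * q := by
  have h : Cond.holds q s (.feq (.var 5) .zero) ↔ s.fld 5 = 0 := Iff.rfl
  simp only [progVecHalf, exec_ite, exec_setN]
  by_cases hc : s.fld 5 = 0
  · rw [if_pos (h.2 hc), if_pos hc]
    simp [NExp.eval, eval_expVec, eval_expQ2, h0]
  · rw [if_neg (fun h' => hc (h.1 h')), if_neg hc]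
    simp [NExp.eval, h0]

theorem exec_progCounts [DecidableEq F] {q m t : ℕ} {s : Mem F} {a : ℕ → F × F}
    (h0 : s.num 0 = q) (h2 : s.num 2 = t) (h6 : s.num 6 = (m - t) % 2)
    (h7 : s.num 7 = q ^ (2 * ((m - t) / 2))) (hg : (s.fld 0, s.fld 1, s.fld 2) = gram q m a t)
    (hl : t ≠ 0 → (s.fld 5, s.fld 6) = a (t - 1))
    (hi : (s.num 8, s.num 9, s.num 10, s.num 13) =
      (isoPts q (s.fld 0) (s.fld 1) (s.fld 2), isZeroH (s.fld 0) (s.fld 1) (s.fld 2),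
        isoPerp q (s.fld 5) (s.fld 6) (s.fld 0) (s.fld 1) (s.fld 2),
        if s.fld 0 = 0 then 1 else 0)) :
    ((progCounts.exec q s).num 11, (progCounts.exec q s).num 12) =
      (pairCount q m t a, vecCount q m t (fun i => (a i).1)) := by
  have hg0 : partialForm q m (fun i => (a i).1) (fun i => (a i).1) t = s.fld 0 :=
    (congrArg Prod.fst hg).symm
  simp only [Prod.mk.injEq] at hi
  obtain ⟨i8, i9, i10, i13⟩ := hi
  simp only [pairCount, vecCount, hg0, ← hg, ← h7, ← h6, ← i8, ← i9, ← i13]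
  rw [progCounts, exec_ite]
  by_cases hp : s.num 6 = 1
  · rw [if_pos (show Cond.holds q s (.le (.const 1) (.var 6)) from hp.ge), if_pos hp, if_pos hp,
      exec_ite]
    by_cases ht : t = 0
    · rw [if_pos (show Cond.holds q s (.le (.var 2) (.const 0)) from (h2.trans ht).le), if_pos ht,
        if_pos ht]
      simp [exec_seq, exec_setN, NExp.eval, eval_expPair, eval_expVec, eval_expQ2, eval_expQ4, h0]
    · rw [if_neg (show ¬ Cond.holds q s (.le (.var 2) (.const 0)) from
        fun h => ht (h2.symm.trans (Nat.le_zero.1 h))), if_neg ht, if_neg ht, exec_seq, ← hl ht]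
      have e1 := exec_progPairHalf q s h0 i8 i9 i10
      have f1 := exec_of_keeps q (fun s : Mem F => (s.num 0, s.num 7, s.num 13, s.fld)) progPairHalf
        (by simp [progPairHalf, Prog.Keeps, exec_setN]) s
      generalize progPairHalf.exec q s = s₁ at e1 f1 ⊢
      simp only [Prod.mk.injEq] at f1
      have e2 := exec_progVecHalf q s₁ (f1.1.trans h0)
      have f2 := exec_of_keeps q (fun s : Mem F => s.num 11) progVecHalf
        (by simp [progVecHalf, Prog.Keeps, exec_setN]) s₁
      rw [f2, e1, e2, f1.2.1, f1.2.2.1, f1.2.2.2]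
  · rw [if_neg (show ¬ Cond.holds q s (.le (.const 1) (.var 6)) from fun h => hp (by
      have h : 1 ≤ s.num 6 := h
      omega)), if_neg hp, if_neg hp]
    simp [exec_seq, exec_setN, NExp.eval, eval_expPair, eval_expVec, h0]

theorem exec_progResult [DecidableEq F] {q m t : ℕ} {s : Mem F} {a : ℕ → F × F}
    (h0 : s.num 0 = q) (h5 : s.num 5 = scanRank a t)
    (h : (s.num 11, s.num 12) = (pairCount q m t a, vecCount q m t (fun i => (a i).1))) :
    (progResult.exec q s).num 3 = psiCount q m t a := by
  simp only [Prod.mk.injEq] at h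
  have h1 : Cond.holds q s (.le (.var 5) (.const 0)) ↔ s.num 5 ≤ 0 := Iff.rfl
  have h2 : Cond.holds q s (.le (.var 5) (.const 1)) ↔ s.num 5 ≤ 1 := Iff.rfl
  have h3 : Cond.holds q s (.le (.var 5) (.const 2)) ↔ s.num 5 ≤ 2 := Iff.rfl
  simp only [progResult, exec_ite, exec_setN, psiCount, ← h.1, ← h.2, ← h5]
  by_cases c0 : s.num 5 = 0
  · rw [if_pos (h1.2 c0.le), if_pos c0]
    simp [NExp.eval, eval_expQ2, eval_expQ4, h0]
  rw [if_neg (fun hc => c0 (Nat.le_zero.1 (h1.1 hc))), if_neg c0]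
  by_cases c1 : s.num 5 = 1
  · rw [if_pos (h2.2 c1.le), if_pos c1]
    simp [NExp.eval, eval_expQ2, h0]
  rw [if_neg (fun hc => by have := h2.1 hc; omega), if_neg c1]
  by_cases c2 : s.num 5 = 2
  · rw [if_pos (h3.2 c2.le), if_pos c2]
    simp [NExp.eval]
  · rw [if_neg (fun hc => by have := h3.1 hc; omega), if_neg c2]
    simp [NExp.eval]

/-- One pass over t columns and one loop for the power Q; everything else takes bounded time. -/
theorem exec_progPsi [DecidableEq F] {q m t : ℕ} {s : Mem F}
    (h : (s.num 0, s.num 1, s.num 2) = (q, m, t)) (ht : t ≤ m) :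
    (progPsi.exec q s).num 3 = psiCount q m t s.word ∧
      progPsi.time q s ≤ psiTime * (m + 1) := by
  obtain ⟨hS, hT⟩ := exec_progScan h ht
  simp only [progPsi, exec_seq, time_seq]
  generalize progScan.exec q s = s₁ at hS ⊢
  have hw : s₁.word = s.word := word_eq_of_arr_eq (congrArg (fun x => x.2.2.2) hS.frame)
  have h₁ : (s₁.num 0, s₁.num 1, s₁.num 2) = (q, m, t) := by
    have := hS.frame
    simp only [Prod.mk.injEq] at this ⊢
    tauto
  obtain ⟨hP, hPT⟩ := exec_progPower h₁
  have fP := exec_of_keeps q (fun s : Mem F => (s.num 0, s.num 2, s.num 5, s.num 6, s.fld))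
    progPower (by simp [progPower, Prog.Keeps, exec_setN]) s₁
  generalize progPower.exec q s₁ = s₂ at hP fP ⊢
  simp only [Prod.mk.injEq] at fP h₁
  obtain ⟨p0, p2, p5, p6, pf⟩ := fP
  have hI := exec_progIndicators q s₂ (p0.trans h₁.1)
  have fI := exec_of_keeps q (fun s : Mem F => (s.num 0, s.num 2, s.num 5, s.num 6, s.num 7, s.fld))
    progIndicators (by simp [progIndicators, progIso, progPerp, progZero, Prog.Keeps, exec_setN]) s₂
  have tI := time_le_maxTime q progIndicators (by simp [progIndicators, progIso, progPerp, progZero, Prog.loopFree]) s₂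
  generalize progIndicators.exec q s₂ = s₃ at hI fI ⊢
  simp only [Prod.mk.injEq] at fI
  obtain ⟨i0, i2, i5, i6, i7, if_⟩ := fI
  have hC := exec_progCounts (m := m) (t := t) (a := s.word) (i0.trans (p0.trans h₁.1))
    (i2.trans (p2.trans h₁.2.2)) (i6.trans (p6.trans hS.num6)) (i7.trans hP)
    (by rw [if_, pf, hS.gram, hw]) (by rw [if_, pf, ← hw]; exact hS.last) (by rw [hI, if_])
  have fC := exec_of_keeps q (fun s : Mem F => (s.num 0, s.num 5))
    progCounts (by simp [progCounts, progPairHalf, progVecHalf, Prog.Keeps, exec_setN]) s₃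
  have tC := time_le_maxTime q progCounts (by simp [progCounts, progPairHalf, progVecHalf, Prog.loopFree]) s₃
  generalize progCounts.exec q s₃ = s₄ at hC fC ⊢
  simp only [Prod.mk.injEq] at fC
  have tR := time_le_maxTime q progResult (by simp [progResult, Prog.loopFree]) s₄
  refine ⟨exec_progResult (fC.1.trans (i0.trans (p0.trans h₁.1)))
    (by rw [fC.2, i5, p5, hS.num5, hw]) hC, ?_⟩
  have b1 : t * (progColumn.maxTime + 1) ≤ m * (progColumn.maxTime + 1) :=
    Nat.mul_le_mul_right _ ht
  have b2 : (m - t) / 2 * ((Prog.setN 7 (.mul (.var 7) expQ2)).maxTime + 1) ≤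
      m * ((Prog.setN 7 (.mul (.var 7) expQ2)).maxTime + 1) := Nat.mul_le_mul_right _ (by omega)
  exact le_trans (Nat.add_le_add (hT.trans (Nat.add_le_add_left b1 _))
    (Nat.add_le_add (hPT.trans (Nat.add_le_add_left b2 _))
      (Nat.add_le_add tI (Nat.add_le_add tC tR)))) (le_psiTime m)

/-- The part of the memory that `progPsi` does not use for its computations. -/
def Mem.outer (s : Mem F) : (ℕ × ℕ × ℕ × ℕ × ℕ × ℕ × ℕ) × (F × F) × (ℕ → ℕ → F) :=
  ((s.num 0, s.num 1, s.num 2, s.num 20, s.num 21, s.num 22, s.num 23), (s.fld 20, s.fld 21), s.arr)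

theorem outer_exec_progPsi (q : ℕ) (s : Mem F) : (progPsi.exec q s).outer = s.outer := by
  refine exec_of_keeps q Mem.outer progPsi ?_ s
  simp [progPsi, progScan, progColumn, progGram, progRank, progPower, progIndicators, progIso,
    progPerp, progZero, progCounts, progPairHalf, progVecHalf, progResult, Prog.Keeps, Mem.outer,
    exec_setN, exec_setF]

end PsiProgram

end HermGr

namespace HermGr

/-! ### Programs for the prefix enumerator and its inverse -/

section Programs

/-- Assigning the content of the numerical variable `3` to the output variable after counting. -/
def progCount : Prog := .seq progPsi (.setN 0 (.var 3))

/-- Writing the letter with the number in the numerical variable `21` to the place in the numerical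
variable `20`. -/
def progLetter : Prog :=
  .seq (.store 0 (.var 20) (.get 2 (.div (.var 21) expQ2)))
    (.store 1 (.var 20) (.get 2 (.sub (.var 21) (.mul (.div (.var 21) expQ2) expQ2))))

/-- Testing whether the letter in the field variables `20, 21` is reached. -/
def progTest : Prog :=
  .ite (.and (.feq (.get 0 (.var 20)) (.var 20)) (.feq (.get 1 (.var 20)) (.var 21)))
    (.setN 22 (.const 1)) .skip

/-- Adding the number of words with the current beginning, unless the letter is reached. -/
def progAdd : Prog :=
  .ite (.le (.const 1) (.var 22)) .skip (.seq progPsi (.setN 23 (.add (.var 23) (.var 3))))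

/-- One letter in the computation of the prefix enumerator. -/
def progIotaLetter : Prog :=
  .seq progLetter (.seq progTest (.seq progAdd (.setN 21 (.add (.var 21) (.const 1)))))

/-- The preparations for one place in the computation of the prefix enumerator. -/
def progIotaStart : Prog :=
  .seq (.setF 20 (.get 0 (.var 20)))
  (.seq (.setF 21 (.get 1 (.var 20)))
  (.seq (.setN 22 (.const 0))
  (.seq (.setN 21 (.const 0))
    (.setN 2 (.add (.var 20) (.const 1))))))

/-- The end of the computations for one place. -/
def progIotaFinish : Prog :=
  .seq (.store 0 (.var 20) (.var 20))
  (.seq (.store 1 (.var 20) (.var 21))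
    (.setN 20 (.add (.var 20) (.const 1))))

/-- One place in the computation of the prefix enumerator. -/
def progIotaPlace : Prog :=
  .seq progIotaStart (.seq (.loop expQ4 progIotaLetter) progIotaFinish)

/-- The computation of the prefix enumerator. -/
def progIota : Prog := .seq (.loop (.var 1) progIotaPlace) (.setN 0 (.var 23))

/-- The decision whether the current letter is the right one. -/
def progDecide : Prog :=
  .ite (.le (.var 3) (.var 23)) (.setN 23 (.sub (.var 23) (.var 3))) (.setN 22 (.const 1))

/-- One letter in the computation of the inverse of the prefix enumerator. -/
def progUnrankLetter : Prog :=
  .seq (.ite (.le (.const 1) (.var 22)) .skip (.seq progLetter (.seq progPsi progDecide)))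
    (.setN 21 (.add (.var 21) (.const 1)))

/-- The preparations for one place in the computation of the inverse. -/
def progUnrankStart : Prog :=
  .seq (.setN 22 (.const 0)) (.seq (.setN 21 (.const 0)) (.setN 2 (.add (.var 20) (.const 1))))

/-- One place in the computation of the inverse of the prefix enumerator. -/
def progUnrankPlace : Prog :=
  .seq progUnrankStart
    (.seq (.loop expQ4 progUnrankLetter) (.setN 20 (.add (.var 20) (.const 1))))

/-- The computation of the inverse of the prefix enumerator. -/
def progUnrank : Prog := .seq (.setN 23 (.var 2)) (.loop (.var 1) progUnrankPlace)

variable {F : Type*} [Field F]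

theorem time_ite_le (q : ℕ) (s : Mem F) (c : Cond) (p p' : Prog) :
    (Prog.ite c p p').time q s ≤ c.cost + (p.time q s + p'.time q s) + 1 := by
  unfold Prog.time
  rw [Prog.run]
  split_ifs
  · simp only; omega
  · simp only; omega

theorem seqMat_word_initMem (q m n : ℕ) {t : ℕ} (D : Matrix (Fin 2) (Fin t) F) (E : ℕ → F) :
    seqMat (initMem q m n D E).word t = D := by
  ext r i
  fin_cases r <;> simp [seqMat, wordMat, Mem.word, initMem, rowArray]

theorem matOut_eq {F : Type*} (m : ℕ) (s : Mem F) : matOut m s = seqMat s.word m := by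
  ext r i
  fin_cases r <;> rfl

theorem progCount_spec [Fintype F] {q m t : ℕ} (hq : Fintype.card F = q ^ 2) (hm : 4 ≤ m)
    (ht : t ≤ m) (D : Matrix (Fin 2) (Fin t) F) (E : ℕ → F) :
    numOut (progCount.exec q (initMem q m t D E)) = psi q ht D ∧
      progCount.time q (initMem q m t D E) ≤ (psiTime + 2) * m ^ 2 := by
  classical
  obtain ⟨h1, h2⟩ := exec_progPsi (q := q) (m := m) (t := t) (s := initMem q m t D E) rfl ht
  constructor
  · conv_rhs => rw [← seqMat_word_initMem q m t D E, psi_eq_psiCount hq, ← h1]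
    rfl
  · have h3 : progCount.time q (initMem q m t D E) = progPsi.time q (initMem q m t D E) + 2 := rfl
    rw [h3]
    refine le_trans (Nat.add_le_add_right h2 2) ?_
    generalize psiTime = c
    -- The linear bound is weakened to the quadratic one required.
    have h4 : m + 1 ≤ m ^ 2 := by nlinarith
    calc c * (m + 1) + 2 ≤ c * m ^ 2 + 2 * m ^ 2 :=
          Nat.add_le_add (Nat.mul_le_mul_left c h4) (by omega)
      _ = (c + 2) * m ^ 2 := by ring

theorem exec_progLetter_word (q : ℕ) (s : Mem F) : (progLetter.exec q s).word =
    Function.update s.word (s.num 20)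
      (s.arr 2 (s.num 21 / s.num 0 ^ 2), s.arr 2 (s.num 21 % s.num 0 ^ 2)) := by
  have hmod : s.num 21 - s.num 21 / s.num 0 ^ 2 * s.num 0 ^ 2 = s.num 21 % s.num 0 ^ 2 := by
    rw [mul_comm, Nat.mod_eq_sub]
  funext i
  simp only [Mem.word, progLetter, exec_seq, exec_store, NExp.eval, FExp.eval, eval_expQ2]
  by_cases hi : i = s.num 20
  · subst hi
    simp [hmod]
  · simp only [Function.update_self, Function.update_of_ne hi, ne_eq, one_ne_zero, zero_ne_one,
      not_false_eq_true, Function.update_of_ne]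
    rfl

theorem exec_progLetter_keeps (q : ℕ) (s : Mem F) : ((progLetter.exec q s).num,
    (progLetter.exec q s).fld, (progLetter.exec q s).arr 2) = (s.num, s.fld, s.arr 2) :=
  exec_of_keeps q (fun s : Mem F => (s.num, s.fld, s.arr 2)) progLetter
    (by simp [progLetter, Prog.Keeps, exec_store]) s

open Classical in
theorem exec_progTest (q : ℕ) (s : Mem F) : (progTest.exec q s).num 22 =
    if s.word (s.num 20) = (s.fld 20, s.fld 21) then 1 else s.num 22 := by
  have h : Cond.holds q s (.and (.feq (.get 0 (.var 20)) (.var 20))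
      (.feq (.get 1 (.var 20)) (.var 21))) ↔ s.word (s.num 20) = (s.fld 20, s.fld 21) := by
    rw [Prod.ext_iff]; exact Iff.rfl
  rw [progTest, exec_ite]
  by_cases hc : s.word (s.num 20) = (s.fld 20, s.fld 21)
  · rw [if_pos (h.2 hc), if_pos hc]; rfl
  · rw [if_neg (fun h' => hc (h.1 h')), if_neg hc]; rfl

variable [Fintype F] [LinearOrder F]

theorem cnt_isRepWord_eq {q : ℕ} (hq : Fintype.card F = q ^ 2) {m t : ℕ} (ht : t ≤ m)
    (a : ℕ → F × F) :
    cnt (fun w : Fin m → F × F => IsRepWord q w) t a = psiCount q m t a := by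
  rw [← psi_eq_cnt q ht, psi_eq_psiCount hq ht]

/-- The memory during the computation of the prefix enumerator of the word `a`, at the place `j`,
after the treatment of `e` letters. -/
structure IotaState (q m : ℕ) (idx : F × F → ℕ) (a : ℕ → F × F) (j B e : ℕ) (s : Mem F) :
    Prop where
  num : (s.num 0, s.num 1, s.num 2, s.num 20, s.num 21) = (q, m, j + 1, j, e)
  flag : s.num 22 = if idx (a j) < e then 1 else 0
  sum : s.num 23 = B + prefixSum (fun w : Fin m → F × F => IsRepWord q w) (letter F q) a j
    (min e (idx (a j)))
  fld : (s.fld 20, s.fld 21) = a j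
  alph : s.arr 2 = alphabet
  word : ∀ i, i ≠ j → s.word i = a i

theorem IotaState.step {q m : ℕ} (hq : Fintype.card F = q ^ 2) {idx : F × F → ℕ}
    (hidx : IsListing (q ^ 4) (letter F q) idx) {a : ℕ → F × F} {j B e : ℕ} (hj : j < m)
    (he : e < q ^ 4) {s : Mem F} (h : IotaState q m idx a j B e s) :
    IotaState q m idx a j B (e + 1) (progIotaLetter.exec q s) ∧
      progIotaLetter.time q s ≤ 80 + psiTime * (m + 1) := by
  obtain ⟨hnum, hflag, hsum, hfld, halph, hword⟩ := h
  have hw := exec_progLetter_word q s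
  have hk := exec_progLetter_keeps q s
  have ht1 := time_le_maxTime q progLetter (by simp [progLetter, Prog.loopFree]) s
  simp only [progIotaLetter, exec_seq, time_seq]
  generalize progLetter.exec q s = s₁ at hw hk ⊢
  simp only [Prod.mk.injEq] at hk hnum
  obtain ⟨k1, k2, k3⟩ := hk
  obtain ⟨n0, n1, n2, n20, n21⟩ := hnum
  have hw1 : s₁.word = Function.update a j (letter F q e) := by
    rw [hw, n20, n21, n0, halph]
    funext i
    by_cases hi : i = j
    · subst hi; simp [letter]
    · rw [Function.update_of_ne hi, Function.update_of_ne hi, hword i hi]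
  have t22 := exec_progTest q s₁
  have tk := exec_of_keeps q (fun s : Mem F => ((s.num 0, s.num 1, s.num 2, s.num 20, s.num 21,
    s.num 23), s.fld, s.arr)) progTest (by simp [progTest, Prog.Keeps, exec_setN]) s₁
  have ht2 := time_le_maxTime q progTest (by simp [progTest, Prog.loopFree]) s₁
  have hreach : s₁.word (s₁.num 20) = (s₁.fld 20, s₁.fld 21) ↔ idx (a j) = e := by
    rw [hw1, k1, k2, n20, hfld, Function.update_self]
    constructor
    · intro h; rw [← h, hidx.idx_letter e he]
    · intro h; rw [← h, hidx.letter_idx]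
  -- The test precedes the addition, so the flag is already raised at the actual letter and only
  -- strictly smaller letters are counted.
  have t22' : (progTest.exec q s₁).num 22 = if idx (a j) < e + 1 then 1 else 0 := by
    rw [t22, k1, hflag]
    by_cases h1 : idx (a j) = e
    · rw [if_pos (by rw [← k1]; exact hreach.2 h1), if_pos (by omega)]
    · rw [if_neg (by rw [← k1]; exact fun h' => h1 (hreach.1 h'))]
      by_cases h2 : idx (a j) < e
      · rw [if_pos h2, if_pos (by omega)]
      · rw [if_neg h2, if_neg (by omega)]
  generalize progTest.exec q s₁ = s₂ at t22' tk ⊢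
  simp only [Prod.mk.injEq] at tk
  obtain ⟨⟨u0, u1, u2, u20, u21, u23⟩, uf, ua⟩ := tk
  rw [k1] at u0 u1 u2 u20 u21 u23
  have hP := exec_progPsi (q := q) (m := m) (t := j + 1) (s := s₂)
    (by rw [u0, u1, u2, n0, n1, n2]) hj
  have hO := outer_exec_progPsi q s₂
  have hw2 : s₂.word = Function.update a j (letter F q e) := by
    rw [word_eq_of_arr_eq ua, hw1]
  have hadd : (progAdd.exec q s₂).num 23 = B + prefixSum (fun w : Fin m → F × F => IsRepWord q w)
      (letter F q) a j (min (e + 1) (idx (a j))) ∧ (progAdd.exec q s₂).outer.1.1 = s₂.outer.1.1 ∧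
      ((progAdd.exec q s₂).num 1, (progAdd.exec q s₂).num 2, (progAdd.exec q s₂).num 20,
        (progAdd.exec q s₂).num 21, (progAdd.exec q s₂).num 22) =
        (s₂.num 1, s₂.num 2, s₂.num 20, s₂.num 21, s₂.num 22) ∧
      (progAdd.exec q s₂).outer.2 = s₂.outer.2 := by
    rw [progAdd, exec_ite]
    by_cases h1 : idx (a j) < e + 1
    · rw [if_pos h1] at t22'
      rw [if_pos (show Cond.holds q s₂ (.le (.const 1) (.var 22)) from t22'.ge), exec_skip]
      refine ⟨?_, rfl, rfl, rfl⟩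
      rw [u23, hsum, min_eq_right (by omega), min_eq_right (by omega)]
    · rw [if_neg h1] at t22'
      rw [if_neg (show ¬ Cond.holds q s₂ (.le (.const 1) (.var 22)) from by
        intro h'
        have h' : 1 ≤ s₂.num 22 := h'
        omega), exec_seq]
      simp only [Mem.outer, Prod.mk.injEq] at hO
      obtain ⟨⟨o0, o1, o2, o20, o21, o22, o23⟩, of, oa⟩ := hO
      refine ⟨?_, ?_, ?_, ?_⟩
      · simp only [exec_setN, NExp.eval, Function.update_self]
        rw [hP.1, o23, u23, hsum, hw2, ← cnt_isRepWord_eq hq hj, min_eq_left (by omega),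
          min_eq_left (by omega), prefixSum, prefixSum, Finset.sum_range_succ, add_assoc]
      · simp [Mem.outer, exec_setN, o0]
      · simp [exec_setN, o1, o2, o20, o21, o22]
      · simp [Mem.outer, exec_setN, of, oa]
  have hT : progAdd.time q s₂ ≤ 10 + psiTime * (m + 1) := by
    refine le_trans (time_ite_le q s₂ _ _ _) ?_
    rw [time_seq]
    have e1 : (Cond.le (.const 1) (.var 22)).cost = 3 := rfl
    have e2 : Prog.skip.time q s₂ = 1 := rfl
    have e3 : (Prog.setN 23 (.add (.var 23) (.var 3))).time q (progPsi.exec q s₂) = 4 := rfl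
    rw [e1, e2, e3]
    have := hP.2
    omega
  generalize progAdd.exec q s₂ = s₃ at hadd ⊢
  simp only [Mem.outer, Prod.mk.injEq] at hadd
  obtain ⟨a23, a0, ⟨a1, a2, a20, a21, a22⟩, af, aa⟩ := hadd
  constructor
  · refine ⟨?_, ?_, ?_, ?_, ?_, ?_⟩
    · simp [exec_setN, NExp.eval, a0, a1, a2, a20, a21, u0, u1, u2, u20, u21, n0, n1, n2, n20, n21]
    · simp only [exec_setN]
      rw [Function.update_of_ne (by norm_num), a22, t22']
    · simp only [exec_setN]
      rw [Function.update_of_ne (by norm_num), a23]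
    · simp only [exec_setN]
      rw [af.1, af.2, uf, k2, hfld]
    · simp only [exec_setN]
      rw [aa, ua, k3, halph]
    · intro i hi
      have : s₃.word i = s₂.word i := congrFun (word_eq_of_arr_eq aa) i
      change s₃.word i = a i
      rw [this, hw2, Function.update_of_ne hi]
  · have e1 : progLetter.maxTime ≤ 40 := by decide
    have e2 : progTest.maxTime ≤ 20 := by decide
    have e3 : (Prog.setN 21 (.add (.var 21) (.const 1))).time q s₃ = 4 := rfl
    omega

end Programs

end HermGr

namespace HermGr

/-! ### Invariants of the ranking and unranking loops -/

section Programs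

variable {F : Type*} [Field F] [Fintype F] [LinearOrder F] {q m : ℕ} {idx : F × F → ℕ}
  {a : ℕ → F × F}

/-- The memory during the computation of the prefix enumerator of the word `a`, before the
treatment of the place `j`. -/
structure IotaPlaceState (q m : ℕ) (idx : F × F → ℕ) (a : ℕ → F × F) (j : ℕ) (s : Mem F) :
    Prop where
  num : (s.num 0, s.num 1, s.num 20) = (q, m, j)
  sum : s.num 23 = ∑ i ∈ Finset.range j,
    prefixSum (fun w : Fin m → F × F => IsRepWord q w) (letter F q) a i (idx (a i))
  alph : s.arr 2 = alphabet
  word : s.word = a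

/-- The loop runs through all q⁴ letters even after the actual one and overwrites place j; the
column saved in the field variables 20, 21 is put back at the end. -/
theorem IotaPlaceState.step (hq : Fintype.card F = q ^ 2)
    (hidx : IsListing (q ^ 4) (letter F q) idx) {j : ℕ} (hj : j < m) {s : Mem F}
    (h : IotaPlaceState q m idx a j s) :
    IotaPlaceState q m idx a (j + 1) (progIotaPlace.exec q s) ∧
      progIotaPlace.time q s ≤ 80 + q ^ 4 * (81 + psiTime * (m + 1)) := by
  obtain ⟨hnum, hsum, halph, hword⟩ := h
  simp only [Prod.mk.injEq] at hnum
  obtain ⟨n0, n1, n20⟩ := hnum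
  have hstart : IotaState q m idx a j (∑ i ∈ Finset.range j,
      prefixSum (fun w : Fin m → F × F => IsRepWord q w) (letter F q) a i (idx (a i))) 0
      (progIotaStart.exec q s) := by
    simp only [progIotaStart, exec_seq, exec_setF, exec_setN, NExp.eval, FExp.eval]
    refine ⟨?_, ?_, ?_, ?_, halph, fun i _ => congrFun hword i⟩
    · simp [n0, n1, n20]
    · simp
    · simp [hsum, prefixSum]
    · have := congrFun hword j
      rw [← this]
      simp [n20, Mem.word]
  have ht1 := time_le_maxTime q progIotaStart (by simp [progIotaStart, Prog.loopFree]) s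
  simp only [progIotaPlace, exec_seq, time_seq]
  have he0 : (progIotaStart.exec q s).num 0 = q := (Prod.mk.inj hstart.num).1
  generalize progIotaStart.exec q s = s₁ at hstart he0 ⊢
  obtain ⟨hl, ht2⟩ := loop_induction q s₁ expQ4 progIotaLetter (q ^ 4)
    (80 + psiTime * (m + 1)) (by rw [eval_expQ4, he0]) _ hstart
    (fun e he s hs => IotaState.step hq hidx hj he hs)
  generalize (Prog.loop expQ4 progIotaLetter).exec q s₁ = s₂ at hl ⊢
  have ht3 := time_le_maxTime q progIotaFinish (by simp [progIotaFinish, Prog.loopFree]) s₂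
  obtain ⟨lnum, lflag, lsum, lfld, lalph, lword⟩ := hl
  simp only [Prod.mk.injEq] at lnum
  obtain ⟨l0, l1, l2, l20, l21⟩ := lnum
  constructor
  · simp only [progIotaFinish, exec_seq, exec_store, exec_setN, NExp.eval, FExp.eval]
    refine ⟨?_, ?_, ?_, ?_⟩
    · simp [l0, l1, l20]
    · rw [Finset.sum_range_succ]
      simp [lsum, (hidx.idx_lt (a j)).le]
    · simp [lalph]
    · funext i
      by_cases hi : i = j
      · subst hi; simp [Mem.word, l20, ← lfld]
      · rw [← lword i hi]; simp [Mem.word, l20, hi]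
  · have e1 : progIotaStart.maxTime ≤ 30 := by decide
    have e2 : progIotaFinish.maxTime ≤ 30 := by decide
    have e3 : expQ4.cost ≤ 15 := by decide
    rw [show 81 + psiTime * (m + 1) = 80 + psiTime * (m + 1) + 1 by ring]
    omega

theorem place_bound {q m : ℕ} (hq : 0 < q) (hm : 4 ≤ m) (c : ℕ) :
    10 + m * (81 + q ^ 4 * (81 + c * (m + 1))) ≤ (200 + c) * (q ^ 4 * m ^ 3) := by
  have h1 : 1 ≤ q ^ 4 := Nat.one_le_pow _ _ hq
  have h2 : m + 1 ≤ m ^ 2 := by nlinarith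
  generalize q ^ 4 = Q at *
  have h3 : 81 + Q * (81 + c * (m + 1)) ≤ Q * (162 + c * m ^ 2) := by
    have : c * (m + 1) ≤ c * m ^ 2 := Nat.mul_le_mul_left c h2
    calc 81 + Q * (81 + c * (m + 1)) ≤ 81 * Q + Q * (81 + c * m ^ 2) :=
          Nat.add_le_add (by omega) (Nat.mul_le_mul_left Q (by omega))
      _ = Q * (162 + c * m ^ 2) := by ring
  have h4 : 162 + c * m ^ 2 ≤ (162 + c) * m ^ 2 := by nlinarith
  have h5 : 1 ≤ Q * m ^ 3 := Nat.one_le_iff_ne_zero.2 (by positivity)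
  calc 10 + m * (81 + Q * (81 + c * (m + 1))) ≤ 10 * (Q * m ^ 3) + m * (Q * ((162 + c) * m ^ 2)) :=
        Nat.add_le_add (by omega)
          (Nat.mul_le_mul_left m (h3.trans (Nat.mul_le_mul_left Q h4)))
    _ = (172 + c) * (Q * m ^ 3) := by ring
    _ ≤ (200 + c) * (Q * m ^ 3) := Nat.mul_le_mul_right _ (by omega)

theorem pos_of_card_eq_sq {F : Type*} [Field F] [Fintype F] {q : ℕ}
    (hq : Fintype.card F = q ^ 2) : 0 < q := by
  rcases Nat.eq_zero_or_pos q with rfl | h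
  · have := Fintype.card_pos (α := F)
    simp [hq] at this
  · exact h

theorem progIota_spec (hq : Fintype.card F = q ^ 2) (hm : 4 ≤ m) (G : Matrix (Fin 2) (Fin m) F) :
    numOut (progIota.exec q (initMem q m 0 G alphabet)) = iota q G ∧
      progIota.time q (initMem q m 0 G alphabet) ≤ (200 + psiTime) * (q ^ 4 * m ^ 3) := by
  obtain ⟨idx, hidx, hlt⟩ := exists_isListing_letter hq
  have hG := seqMat_word_initMem q m 0 G (alphabet (F := F))
  have hst : IotaPlaceState q m idx (initMem q m 0 G alphabet).word 0
      (initMem q m 0 G alphabet) := ⟨rfl, rfl, rfl, rfl⟩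
  have hn1 : (initMem q m 0 G (alphabet (F := F))).num 1 = m := rfl
  generalize initMem q m 0 G (alphabet (F := F)) = s at hst hG hn1 ⊢
  obtain ⟨hl, ht⟩ := loop_induction q s (.var 1) progIotaPlace m _ hn1 _ hst
    (fun j hj s hs => IotaPlaceState.step hq hidx hj hs)
  simp only [progIota, exec_seq, time_seq]
  constructor
  · rw [← hG, iota_seqMat hidx hlt, enumTail, Nat.Ico_zero_eq_range, ← hl.sum]
    rfl
  · refine le_trans ?_ (place_bound (pos_of_card_eq_sq hq) hm psiTime)
    have e1 : (Prog.setN 0 (.var 23)).time q ((Prog.loop (.var 1) progIotaPlace).exec q s) = 2 :=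
      rfl
    have e2 : (NExp.var 1).cost = 1 := rfl
    rw [show 81 + q ^ 4 * (81 + psiTime * (m + 1)) = 80 + q ^ 4 * (81 + psiTime * (m + 1)) + 1
      by ring]
    omega

/-- The memory during the computation of the word `a` from its number, at the place `j`, after the
treatment of `e` letters. -/
structure UnrankState (q m : ℕ) (idx : F × F → ℕ) (a : ℕ → F × F) (j e : ℕ) (s : Mem F) :
    Prop where
  num : (s.num 0, s.num 1, s.num 2, s.num 20, s.num 21) = (q, m, j + 1, j, e)
  flag : s.num 22 = if idx (a j) < e then 1 else 0
  sum : s.num 23 + prefixSum (fun w : Fin m → F × F => IsRepWord q w) (letter F q) a j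
    (min e (idx (a j))) =
      enumTail (fun w : Fin m → F × F => IsRepWord q w) (letter F q) idx a j
  alph : s.arr 2 = alphabet
  word : ∀ i < j, s.word i = a i
  reached : idx (a j) < e → s.word j = a j

/-- The remainder plus the counts already subtracted is the tail of ι from place j on. Before the
right letter the next count still fits into the remainder; at the right letter the remainder is the
tail from j+1 on, which is smaller than the count by `enumTail_lt`. Thus one comparison finds the
letter, and the flag protects it afterwards. -/
theorem UnrankState.step (hq : Fintype.card F = q ^ 2)
    (hidx : IsListing (q ^ 4) (letter F q) idx)
    (ha : IsRepWord q (fun i : Fin m => a i)) {j e : ℕ} (hj : j < m)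
    {s : Mem F} (h : UnrankState q m idx a j e s) :
    UnrankState q m idx a j (e + 1) (progUnrankLetter.exec q s) ∧
      progUnrankLetter.time q s ≤ 80 + psiTime * (m + 1) := by
  obtain ⟨hnum, hflag, hsum, halph, hword, hreach⟩ := h
  simp only [Prod.mk.injEq] at hnum
  obtain ⟨n0, n1, n2, n20, n21⟩ := hnum
  have hw := exec_progLetter_word q s
  have hk := exec_progLetter_keeps q s
  have ht1 := time_le_maxTime q progLetter (by simp [progLetter, Prog.loopFree]) s
  have e1 : progLetter.maxTime ≤ 40 := by decide
  have e2 : (Cond.le (.const 1) (.var 22)).cost = 3 := rfl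
  have e3 : Prog.skip.time q s = 1 := rfl
  have e4 : ∀ s' : Mem F, (Prog.setN 21 (.add (.var 21) (.const 1))).time q s' = 4 := fun _ => rfl
  have ht0 := time_ite_le q s (.le (.const 1) (.var 22)) .skip
    (.seq progLetter (.seq progPsi progDecide))
  simp only [progUnrankLetter, exec_seq, time_seq, exec_ite, e4] at ht0 ⊢
  generalize progLetter.exec q s = s₁ at hw hk ht0 ⊢
  simp only [Prod.mk.injEq] at hk
  obtain ⟨k1, k2, k3⟩ := hk
  have hw1 : ∀ i < j + 1, s₁.word i = Function.update a j (letter F q e) i := by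
    intro i hi
    rw [hw, n20, n21, n0, halph]
    by_cases hij : i = j
    · subst hij; simp [letter]
    · rw [Function.update_of_ne hij, Function.update_of_ne hij, hword i (by omega)]
  have hP := exec_progPsi (q := q) (m := m) (t := j + 1) (s := s₁)
    (by rw [k1, n0, n1, n2]) hj
  have hO := outer_exec_progPsi q s₁
  rw [← cnt_isRepWord_eq hq hj, cnt_congr _ hw1] at hP
  obtain ⟨hP3, hPt⟩ := hP
  generalize progPsi.exec q s₁ = s₂ at hP3 hO ht0 ⊢
  simp only [Mem.outer, Prod.mk.injEq, k1] at hO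
  obtain ⟨⟨o0, o1, o2, o20, o21, o22, o23⟩, -, oa⟩ := hO
  have ht2 := time_le_maxTime q progDecide (by simp [progDecide, Prog.loopFree]) s₂
  have e5 : progDecide.maxTime ≤ 15 := by decide
  refine ⟨?_, by omega⟩
  by_cases h1 : idx (a j) < e
  · rw [if_pos h1] at hflag
    rw [if_pos (show Cond.holds q s (.le (.const 1) (.var 22)) from hflag.ge), exec_skip]
    refine ⟨?_, ?_, ?_, halph, hword, fun _ => hreach h1⟩
    · simp [exec_setN, NExp.eval, n0, n1, n2, n20, n21]
    · rw [if_pos (by omega)]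
      simp [exec_setN, hflag]
    · rw [min_eq_right (by omega)] at hsum ⊢
      simpa [exec_setN] using hsum
  · rw [if_neg h1] at hflag
    rw [if_neg (show ¬ Cond.holds q s (.le (.const 1) (.var 22)) from by
      intro h'
      have h' : 1 ≤ s.num 22 := h'
      omega)]
    have hw2 : s₂.word = s₁.word := word_eq_of_arr_eq oa
    rw [min_eq_left (by omega)] at hsum
    have hp := prefixSum_mono (fun w : Fin m → F × F => IsRepWord q w) (letter F q) a j
      (n := e + 1) (n' := idx (a j))
    have hs : prefixSum (fun w : Fin m → F × F => IsRepWord q w) (letter F q) a j (e + 1) =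
        prefixSum (fun w : Fin m → F × F => IsRepWord q w) (letter F q) a j e + s₂.num 3 := by
      rw [hP3, prefixSum, prefixSum, Finset.sum_range_succ]
    have hT := enumTail_step (fun w : Fin m → F × F => IsRepWord q w) (letter F q) idx a hj
    rw [progDecide, exec_ite]
    rcases Nat.lt_or_ge e (idx (a j)) with h2 | h2
    · have hle : s₂.num 3 ≤ s₂.num 23 := by
        have := hp h2
        omega
      rw [if_pos (show Cond.holds q s₂ (.le (.var 3) (.var 23)) from hle)]
      refine ⟨?_, ?_, ?_, ?_, ?_, fun h3 => by omega⟩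
      · simp [exec_setN, NExp.eval, o0, o1, o2, o20, o21, n0, n1, n2, n20, n21]
      · rw [if_neg (by omega)]
        simp [exec_setN, o22, hflag]
      · rw [min_eq_left (by omega), hs]
        simp [exec_setN, NExp.eval]
        omega
      · simp [exec_setN, oa, k3, halph]
      · intro i hi
        change s₂.word i = a i
        rw [hw2, hw1 i (by omega), Function.update_of_ne (by omega)]
    · obtain rfl : e = idx (a j) := by omega
      rw [hidx.letter_idx, Function.update_eq_self] at hP3
      -- This strict inequality makes the comparison fail exactly at the letter sought.
      have hlt := enumTail_lt hidx (fun w : Fin m → F × F => IsRepWord q w) a ha (m - (j + 1)) (j + 1)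
        (by omega)
      rw [if_neg (show ¬ Cond.holds q s₂ (.le (.var 3) (.var 23)) from by
        intro h'
        have h' : s₂.num 3 ≤ s₂.num 23 := h'
        omega)]
      refine ⟨?_, ?_, ?_, ?_, ?_, fun _ => ?_⟩
      · simp [exec_setN, NExp.eval, o0, o1, o2, o20, o21, n0, n1, n2, n20, n21]
      · rw [if_pos (by omega)]
        simp [exec_setN, NExp.eval]
      · rw [min_eq_right (by omega)]
        simpa [exec_setN, o23] using hsum
      · simp [exec_setN, oa, k3, halph]
      · intro i hi
        change s₂.word i = a i
        rw [hw2, hw1 i (by omega), Function.update_of_ne (by omega)]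
      · change s₂.word j = a j
        rw [hw2, hw1 j (by omega), Function.update_self, hidx.letter_idx]

/-- The memory during the computation of the word `a` from its number, before the treatment of the
place `j`. -/
structure UnrankPlaceState (q m : ℕ) (idx : F × F → ℕ) (a : ℕ → F × F) (j : ℕ) (s : Mem F) :
    Prop where
  num : (s.num 0, s.num 1, s.num 20) = (q, m, j)
  sum : s.num 23 = enumTail (fun w : Fin m → F × F => IsRepWord q w) (letter F q) idx a j
  alph : s.arr 2 = alphabet
  word : ∀ i < j, s.word i = a i

theorem UnrankPlaceState.step (hq : Fintype.card F = q ^ 2)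
    (hidx : IsListing (q ^ 4) (letter F q) idx)
    (ha : IsRepWord q (fun i : Fin m => a i)) {j : ℕ} (hj : j < m)
    {s : Mem F} (h : UnrankPlaceState q m idx a j s) :
    UnrankPlaceState q m idx a (j + 1) (progUnrankPlace.exec q s) ∧
      progUnrankPlace.time q s ≤ 80 + q ^ 4 * (81 + psiTime * (m + 1)) := by
  obtain ⟨hnum, hsum, halph, hword⟩ := h
  simp only [Prod.mk.injEq] at hnum
  obtain ⟨n0, n1, n20⟩ := hnum
  have hstart : UnrankState q m idx a j 0 (progUnrankStart.exec q s) := by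
    simp only [progUnrankStart, exec_seq, exec_setN, NExp.eval]
    refine ⟨?_, ?_, ?_, halph, hword, fun h => absurd h (Nat.not_lt_zero _)⟩
    · simp [n0, n1, n20]
    · simp
    · simp [hsum, prefixSum]
  have ht1 := time_le_maxTime q progUnrankStart (by simp [progUnrankStart, Prog.loopFree]) s
  simp only [progUnrankPlace, exec_seq, time_seq]
  have he0 : (progUnrankStart.exec q s).num 0 = q := (Prod.mk.inj hstart.num).1
  generalize progUnrankStart.exec q s = s₁ at hstart he0 ⊢
  obtain ⟨hl, ht2⟩ := loop_induction q s₁ expQ4 progUnrankLetter (q ^ 4)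
    (80 + psiTime * (m + 1)) (by rw [eval_expQ4, he0]) _ hstart
    (fun e _ s hs => UnrankState.step hq hidx ha hj hs)
  generalize (Prog.loop expQ4 progUnrankLetter).exec q s₁ = s₂ at hl ⊢
  have e4 : (Prog.setN 20 (.add (.var 20) (.const 1))).time q s₂ = 4 := rfl
  obtain ⟨lnum, -, lsum, lalph, lword, lreached⟩ := hl
  simp only [Prod.mk.injEq] at lnum
  obtain ⟨l0, l1, l2, l20, l21⟩ := lnum
  constructor
  · refine ⟨?_, ?_, lalph, ?_⟩
    · simp [exec_setN, NExp.eval, l0, l1, l20]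
    · rw [min_eq_right (hidx.idx_lt _).le, enumTail_step _ _ _ _ hj, add_comm] at lsum
      simpa [exec_setN] using Nat.add_left_cancel lsum
    · intro i hi
      rcases Nat.lt_succ_iff_lt_or_eq.1 hi with hi | rfl
      · exact lword i hi
      · exact lreached (hidx.idx_lt _)
  · have e1 : progUnrankStart.maxTime ≤ 30 := by decide
    have e3 : expQ4.cost ≤ 15 := by decide
    rw [show 81 + psiTime * (m + 1) = 80 + psiTime * (m + 1) + 1 by ring]
    omega

/-- The input is taken as the rank of a known word, so that the invariant can refer to the word
being reconstructed. -/
theorem progUnrank_spec (hq : Fintype.card F = q ^ 2) (hm : 4 ≤ m)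
    {G : Matrix (Fin 2) (Fin m) F} (hG : G ∈ reps F q m) :
    matOut m (progUnrank.exec q
      (initMem q m (iota q G) (0 : Matrix (Fin 2) (Fin 0) F) alphabet)) = G ∧
      progUnrank.time q (initMem q m (iota q G) (0 : Matrix (Fin 2) (Fin 0) F) alphabet) ≤
        (200 + psiTime) * (q ^ 4 * m ^ 3) := by
  obtain ⟨idx, hidx, hlt⟩ := exists_isListing_letter hq
  obtain ⟨a, rfl⟩ := exists_seqMat G
  have ha : IsRepWord q (fun i : Fin m => a i) := hG
  have hst : UnrankPlaceState q m idx a 0 ((Prog.setN 23 (.var 2)).exec q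
      (initMem q m (iota q (seqMat a m)) (0 : Matrix (Fin 2) (Fin 0) F) alphabet)) :=
    ⟨rfl, iota_seqMat hidx hlt a, rfl, fun i hi => absurd hi (Nat.not_lt_zero i)⟩
  simp only [progUnrank, exec_seq, time_seq]
  have e1 : (Prog.setN 23 (.var 2)).time q
      (initMem q m (iota q (seqMat a m)) (0 : Matrix (Fin 2) (Fin 0) F) alphabet) = 2 := rfl
  rw [e1]
  generalize (Prog.setN 23 (.var 2)).exec q
    (initMem q m (iota q (seqMat a m)) (0 : Matrix (Fin 2) (Fin 0) F) alphabet) = s at hst ⊢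
  have hn1 : s.num 1 = m := (Prod.mk.inj (Prod.mk.inj hst.num).2).1
  obtain ⟨hl, ht⟩ := loop_induction q s (.var 1) progUnrankPlace m _ hn1 _ hst
    (fun j hj s hs => UnrankPlaceState.step hq hidx ha hj hs)
  constructor
  · rw [matOut_eq]
    unfold seqMat
    congr 1
    funext i
    exact hl.word i i.isLt
  · refine le_trans ?_ (place_bound (pos_of_card_eq_sq hq) hm psiTime)
    have e2 : (NExp.var 1).cost = 1 := rfl
    rw [show 81 + q ^ 4 * (81 + psiTime * (m + 1)) = 80 + q ^ 4 * (81 + psiTime * (m + 1)) + 1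
      by ring]
    omega

end Programs

end HermGr

theorem mainTheorem1 :
    -- counting the points with a prescribed beginning in `O(m ^ 2)` steps
    (∃ (P : HermGr.Prog) (C : ℕ),
      ∀ (F : Type*) [Field F] [Fintype F] (q m t : ℕ), Fintype.card F = q ^ 2 → 4 ≤ m →
        ∀ (ht : t ≤ m) (D : Matrix (Fin 2) (Fin t) F),
          HermGr.numOut (P.run q (HermGr.initMem q m t D (fun _ => 0))).1 =
              HermGr.psi q ht D ∧
            (P.run q (HermGr.initMem q m t D (fun _ => 0))).2 ≤ C * m ^ 2) ∧
    -- `ι` is an enumerator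
    (∀ (F : Type*) [Field F] [Fintype F] [LinearOrder F] (q m : ℕ),
      Fintype.card F = q ^ 2 → (∀ y : F, y ≠ 0 → 0 < y) → 4 ≤ m →
        Set.BijOn (HermGr.iota q) (HermGr.reps F q m) (Set.Iio (HermGr.numPoints F q m))) ∧
    -- computation of `ι` in `O(q ^ 4 * m ^ 3)` steps
    (∃ (P : HermGr.Prog) (C : ℕ),
      ∀ (F : Type*) [Field F] [Fintype F] [LinearOrder F] (q m : ℕ),
        Fintype.card F = q ^ 2 → (∀ y : F, y ≠ 0 → 0 < y) → 4 ≤ m →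
        ∀ G ∈ HermGr.reps F q m,
          HermGr.numOut (P.run q (HermGr.initMem q m 0 G HermGr.alphabet)).1 =
              HermGr.iota q G ∧
            (P.run q (HermGr.initMem q m 0 G HermGr.alphabet)).2 ≤ C * (q ^ 4 * m ^ 3)) ∧
    -- computation of the inverse of `ι` in `O(q ^ 4 * m ^ 3)` steps
    (∃ (P : HermGr.Prog) (C : ℕ),
      ∀ (F : Type*) [Field F] [Fintype F] [LinearOrder F] (q m : ℕ),
        Fintype.card F = q ^ 2 → (∀ y : F, y ≠ 0 → 0 < y) → 4 ≤ m →
        ∀ i < HermGr.numPoints F q m,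
          let r := P.run q (HermGr.initMem q m i (0 : Matrix (Fin 2) (Fin 0) F) HermGr.alphabet)
          HermGr.matOut m r.1 ∈ HermGr.reps F q m ∧ HermGr.iota q (HermGr.matOut m r.1) = i ∧
            r.2 ≤ C * (q ^ 4 * m ^ 3)) := by
  refine ⟨⟨HermGr.progCount, HermGr.psiTime + 2, fun F _ _ q m t hq hm ht D =>
      HermGr.progCount_spec hq hm ht D _⟩, fun F _ _ _ q m hq _ _ => HermGr.bijOn_iota hq m,
    ⟨HermGr.progIota, 200 + HermGr.psiTime, fun F _ _ _ q m hq _ hm G _ =>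
      HermGr.progIota_spec hq hm G⟩,
    ⟨HermGr.progUnrank, 200 + HermGr.psiTime, fun F _ _ _ q m hq _ hm i hi => ?_⟩⟩
  -- Surjectivity of ι supplies the word that the unranking program recovers.
  obtain ⟨G, hG, rfl⟩ := (HermGr.bijOn_iota hq m).surjOn hi
  obtain ⟨h1, h2⟩ := HermGr.progUnrank_spec hq hm hG
  refine ⟨?_, ?_, h2⟩
  · exact (congrArg (· ∈ HermGr.reps F q m) h1).mpr hG
  · exact congrArg (HermGr.iota q) h1
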